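/- **Setting.** Let $X_1,X_2,\dots$ be i.i.d. with distribution function $F_0$ and, independent of these, let $T_1,T_2,\dots$ be i.i.d. with distribution function $G$. One observes $(T_i,\Delta_i)$ with $\Delta_i=1_{\{X_i\le T_i\}}$, $1\le i\le n$ (current status model). Assume: (F.1) $F_0$ has bounded support $[0,M_0]$, is strictly increasing on $[0,M_0]$, and has a density $f_0$ that is bounded away from zero on $[0,M_0]$; (G.1) $G$ has support $[0,\infty)$, is strictly increasing on $[0,M_0]$, and has a density $g$ that is bounded away from zero and differentiable with bounded derivative on $[0,M_0]$; (K.1) $k$ is a symmetric probability density with support $[-1,1]$ that is twice continuously differentiable on $\mathbb R$. **Estimators.** For a bandwidth $h>0$, $i\in\{0,1\}$ and $s\ge 0$ let $$\hat g_{n,i}(s)=\frac1n\sum_{j\le n,\ \Delta_j=i}\frac1h\,k_s\Big(\frac{s-T_j}{h}\Big),\qquad \hat g_n=\hat g_{n,0}+\hat g_{n,1},$$ where $k_s=k$ for $s>h$ and, for $0\le s\le h$, $k_s=k^{\beta}$ with $\beta=s/h$ is the boundary kernel $$k^\beta(u)=\frac{\nu_{2,\beta}-\nu_{1,\beta}u}{\nu_{0,\beta}\nu_{2,\beta}-\nu_{1,\beta}^2}\,k(u)\,1_{(-1,\beta)}(u),\qquad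 \nu_{i,\beta}=\int_{-1}^{\beta}u^ik(u)\,du .$$ Let $\hat G_{n,i}(s)=\int_0^s\hat g_{n,i}(u)\,du$, $\hat G_n(s)=\int_0^s\hat g_n(u)\,du$ and $\tau=\sup\{s\ge0:\hat g_n(s)>0\}$. The maximum smoothed likelihood estimator (MSLE) $\hat F_n^{MS}(s)$ is the right-continuous slope, at the point with first coordinate $\hat G_n(s)$, of the lower convex hull of the curve $u\mapsto(\hat G_n(u),\hat G_{n,1}(u))$, $u\in[0,\tau]$. Put $$\hat f_n^{MS}=\frac{d}{ds}\hat F_n^{MS},\qquad \hat\lambda_n^{MS}=\frac{\hat f_n^{MS}}{1-\hat F_n^{MS}},\qquad \lambda_0=\frac{f_0}{1-F_0}.$$ The naive estimators are $$\hat F_n^{naive}=\frac{\hat g_{n,1}}{\hat g_n},\qquad \hat f_n^{naive}=\frac{\hat g_n\hat g_{n,1}'-\hat g_n'\hat g_{n,1}}{\hat g_n^2},\qquad \hat\lambda_n^{naive}=\frac{\hat f_n^{naive}}{1-\hat F_n^{naive}}.$$ **Claim.** Fix $t>0$ such that $F_0(t)<1$ and such that $f_0^{(3)}$ and $g^{(3)}$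 exist in a neighbourhood of $t$ and are continuous at $t$. Write $m_2(k)=\int u^2k(u)\,du$ and $$r(t)=\frac{1}{1-F_0(t)}\Big(f_0''(t)+2\,\frac{g''(t)f_0(t)+g'(t)f_0'(t)}{g(t)}-2\,\frac{g'(t)^2f_0(t)}{g(t)^2}\Big)+\frac{f_0(t)}{(1-F_0(t))^2}\Big(f_0'(t)+\frac{2g'(t)f_0(t)}{g(t)}\Big),$$ and assume $r(t)\ne0$. 1. For every $c>0$, with bandwidth $h=cn^{-1/7}$, as $n\to\infty$, $$n^{2/7}\big(\hat\lambda_n^{MS}(t)-\lambda_0(t)\big)\rightsquigarrow\mathcal N(\mu_c,\sigma_c^2),\qquad \mu_c=\tfrac12c^2m_2(k)\,r(t),\qquad \sigma_c^2=\frac{F_0(t)}{c^3g(t)(1-F_0(t))}\int k'(u)^2\,du ,$$ and the same holds with $\hat\lambda_n^{naive}$ in place of $\hat\lambda_n^{MS}$. 2. The asymptotic mean squared error $\mathrm{aMSE}(c)=\mu_c^2+\sigma_c^2$ has over all $c>0$ the unique minimizer $$c_{\lambda,MS}=\Big\{3\,\frac{F_0(t)}{g(t)(1-F_0(t))}\int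 k'(u)^2\,du\Big\}^{1/7}\big\{m_2(k)^2r(t)^2\big\}^{-1/7},$$ so the aMSE-optimal bandwidth is $h_n=c_{\lambda,MS}\,n^{-1/7}$. -/

import Mathlib

open MeasureTheory ProbabilityTheory Filter Topology Set

noncomputable section

namespace CurrentStatus

/-! ### Conditions on the model -/

/-- `f` is a (version of the) Lebesgue density of the measure `P` on `ℝ`. -/
def IsDensity (P : Measure ℝ) (f : ℝ → ℝ) : Prop :=
  Measurable f ∧ (∀ x, 0 ≤ f x) ∧ P = volume.withDensity (fun x => ENNReal.ofReal (f x))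

/-- Condition (F.1): the law `P` of the event time has bounded support `[0, M₀]`, its distribution
function is strictly increasing there, and it has a density `f₀` that stays away from zero
on `[0, M₀]`. -/
def CondF1 (P : Measure ℝ) (f₀ : ℝ → ℝ) (M₀ : ℝ) : Prop :=
  0 < M₀ ∧ P.support = Icc 0 M₀ ∧ StrictMonoOn (cdf P) (Icc 0 M₀) ∧ IsDensity P f₀ ∧
    ∃ ε > 0, ∀ x ∈ Icc 0 M₀, ε ≤ f₀ x

/-- Condition (G.1): the law `Q` of the censoring time has support `[0, ∞)`, its distribution
function is strictly increasing on `[0, M₀]`, and it has a density `g` that stays away from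
zero and has a bounded derivative on `[0, M₀]` (one-sided at the end points). -/
def CondG1 (Q : Measure ℝ) (g : ℝ → ℝ) (M₀ : ℝ) : Prop :=
  Q.support = Ici 0 ∧ StrictMonoOn (cdf Q) (Icc 0 M₀) ∧ IsDensity Q g ∧
    (∃ ε > 0, ∀ x ∈ Icc 0 M₀, ε ≤ g x) ∧
    DifferentiableOn ℝ g (Icc 0 M₀) ∧
    ∃ B, ∀ x ∈ Icc 0 M₀, |derivWithin g (Icc 0 M₀) x| ≤ B

/-- Condition (K.1): `k` is a probability density with support `[-1, 1]`, symmetric, and twice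
continuously differentiable on `ℝ`. -/
def CondK1 (k : ℝ → ℝ) : Prop :=
  (∀ u, 0 ≤ k u) ∧ (∫ u, k u) = 1 ∧ tsupport k = Icc (-1) 1 ∧ (∀ u, k (-u) = k u) ∧
    ContDiff ℝ 2 k

/-- The third derivative of `f` exists (near `t`) and is continuous at `t`. -/
def ThirdDerivContinuousAt (f : ℝ → ℝ) (t : ℝ) : Prop :=
  (∀ᶠ x in 𝓝 t, ∀ j < 3, DifferentiableAt ℝ (iteratedDeriv j f) x) ∧
    ContinuousAt (iteratedDeriv 3 f) t

/-- The current status model: i.i.d. event times `X i` with law `P`, and, independent of these,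
i.i.d. censoring times `T i` with law `Q`. -/
structure IsModel {Ω : Type*} [MeasurableSpace Ω] (μ : Measure Ω) (X T : ℕ → Ω → ℝ)
    (P Q : Measure ℝ) : Prop where
  hasLaw_event : ∀ i, HasLaw (X i) P μ
  hasLaw_censoring : ∀ i, HasLaw (T i) Q μ
  iIndep_event : iIndepFun X μ
  iIndep_censoring : iIndepFun T μ
  indep : IndepFun (fun ω i => X i ω) (fun ω i => T i ω) μ

/-- The observed status indicator `Δ = 1_{X ≤ T}`. -/
def status (x s : ℝ) : Fin 2 := if x ≤ s then 1 else 0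

/-! ### Smoothed empirical distribution

Below, `k` is the kernel, `h` the bandwidth, `n` the sample size, and `T`, `D` are the observed
censoring times and status indicators (only the first `n` of them are used). -/

/-- `ν_{i,β}(k) = ∫_{-1}^β u^i k(u) du`. -/
def nu (k : ℝ → ℝ) (i : ℕ) (β : ℝ) : ℝ := ∫ u in (-1)..β, u ^ i * k u

/-- The boundary kernel `k^β`. -/
def boundaryKernel (k : ℝ → ℝ) (β u : ℝ) : ℝ :=
  (Ioo (-1) β).indicator
    (fun u => (nu k 2 β - nu k 1 β * u) / (nu k 0 β * nu k 2 β - nu k 1 β ^ 2) * k u) u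

/-- The kernel used at the point `s`: the boundary kernel with `β = s / h` if `0 ≤ s ≤ h`, and
`k` itself otherwise. -/
def kernelAt (k : ℝ → ℝ) (h s u : ℝ) : ℝ :=
  if 0 ≤ s ∧ s ≤ h then boundaryKernel k (s / h) u else k u

/-- The kernel estimator `ĝ_{n,i}`, that is, the integral of `h⁻¹ k((s - u) / h)` (with the
boundary correction) against the empirical subdistribution of those `T j`, `j < n`, that have
status `i`. -/
def gHatSub (k : ℝ → ℝ) (h : ℝ) (n : ℕ) (T : ℕ → ℝ) (D : ℕ → Fin 2) (i : Fin 2) (s : ℝ) : ℝ :=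
  (1 / (n : ℝ)) * ∑ j ∈ Finset.range n,
    if D j = i then (1 / h) * kernelAt k h s ((s - T j) / h) else 0

/-- `ĝ_n = ĝ_{n,0} + ĝ_{n,1}`. -/
def gHat (k : ℝ → ℝ) (h : ℝ) (n : ℕ) (T : ℕ → ℝ) (D : ℕ → Fin 2) (s : ℝ) : ℝ :=
  gHatSub k h n T D 0 s + gHatSub k h n T D 1 s

/-- `Ĝ_{n,i}(s) = ∫_{[0,s]} ĝ_{n,i}(u) du`. -/
def GHatSub (k : ℝ → ℝ) (h : ℝ) (n : ℕ) (T : ℕ → ℝ) (D : ℕ → Fin 2) (i : Fin 2) (s : ℝ) : ℝ :=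
  ∫ u in Icc 0 s, gHatSub k h n T D i u

/-- `Ĝ_n(s) = ∫_{[0,s]} ĝ_n(u) du`. -/
def GHat (k : ℝ → ℝ) (h : ℝ) (n : ℕ) (T : ℕ → ℝ) (D : ℕ → Fin 2) (s : ℝ) : ℝ :=
  ∫ u in Icc 0 s, gHat k h n T D u

/-! ### Naive estimators -/

/-- `F̂_n^naive`. -/
def FNaive (k : ℝ → ℝ) (h : ℝ) (n : ℕ) (T : ℕ → ℝ) (D : ℕ → Fin 2) (s : ℝ) : ℝ :=
  gHatSub k h n T D 1 s / gHat k h n T D s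

/-- `f̂_n^naive = (ĝ_n ĝ'_{n,1} - ĝ'_n ĝ_{n,1}) / ĝ_n²`, where `ĝ'_n = ĝ'_{n,0} + ĝ'_{n,1}`. -/
def fNaive (k : ℝ → ℝ) (h : ℝ) (n : ℕ) (T : ℕ → ℝ) (D : ℕ → Fin 2) (s : ℝ) : ℝ :=
  (gHat k h n T D s * deriv (gHatSub k h n T D 1) s
    - (deriv (gHatSub k h n T D 0) s + deriv (gHatSub k h n T D 1) s) * gHatSub k h n T D 1 s)
    / gHat k h n T D s ^ 2

/-- The naive hazard rate estimator `λ̂_n^naive`. -/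
def hazardNaive (k : ℝ → ℝ) (h : ℝ) (n : ℕ) (T : ℕ → ℝ) (D : ℕ → Fin 2) (s : ℝ) : ℝ :=
  fNaive k h n T D s / (1 - FNaive k h n T D s)

/-! ### Maximum smoothed likelihood estimators -/

/-- `τ = sup {s ≥ 0 : ĝ_n(s) > 0}`. -/
def tau (k : ℝ → ℝ) (h : ℝ) (n : ℕ) (T : ℕ → ℝ) (D : ℕ → Fin 2) : ℝ :=
  sSup {s | 0 ≤ s ∧ 0 < gHat k h n T D s}

/-- The continuous cumulative sum diagram: the curve `s ↦ (Ĝ_n(s), Ĝ_{n,1}(s))`, `s ∈ [0, τ]`. -/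
def ccsd (k : ℝ → ℝ) (h : ℝ) (n : ℕ) (T : ℕ → ℝ) (D : ℕ → Fin 2) : Set (ℝ × ℝ) :=
  (fun s => (GHat k h n T D s, GHatSub k h n T D 1 s)) '' Icc 0 (tau k h n T D)

/-- The lower boundary of the convex hull of a planar set, as a function of the first
coordinate. -/
def lowerHull (S : Set (ℝ × ℝ)) (x : ℝ) : ℝ := sInf {y | (x, y) ∈ convexHull ℝ S}

/-- The MSLE `F̂_n^MS(s)`: the right-continuous slope (the right derivative) of the lower convex
hull of the cumulative sum diagram at the first coordinate `Ĝ_n(s)`. At and beyond the end point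
`Ĝ_n(τ)` of the diagram, where there is no right derivative, the left derivative is taken, so
that the estimator stays constant there. -/
def FMS (k : ℝ → ℝ) (h : ℝ) (n : ℕ) (T : ℕ → ℝ) (D : ℕ → Fin 2) (s : ℝ) : ℝ :=
  if GHat k h n T D s < GHat k h n T D (tau k h n T D) then
    derivWithin (lowerHull (ccsd k h n T D)) (Ioi (GHat k h n T D s)) (GHat k h n T D s)
  else
    derivWithin (lowerHull (ccsd k h n T D)) (Iio (GHat k h n T D s)) (GHat k h n T D s)

/-- `f̂_n^MS`, the derivative of `F̂_n^MS`. -/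
def fMS (k : ℝ → ℝ) (h : ℝ) (n : ℕ) (T : ℕ → ℝ) (D : ℕ → Fin 2) (s : ℝ) : ℝ :=
  deriv (FMS k h n T D) s

/-- The maximum smoothed likelihood hazard rate estimator `λ̂_n^MS`. -/
def hazardMS (k : ℝ → ℝ) (h : ℝ) (n : ℕ) (T : ℕ → ℝ) (D : ℕ → Fin 2) (s : ℝ) : ℝ :=
  fMS k h n T D s / (1 - FMS k h n T D s)

/-! ### Convergence in distribution -/

/-- Convergence in distribution of real-valued `Y n` to the law `ν`: convergence of the
distribution functions at each continuity point of the limit. The second clause is equivalent to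
the first if the `Y n` are measurable; stating both makes the notion the right one without
a measurability requirement (`μ` is then read as an outer measure). -/
def ConvergesInLaw {Ω : Type*} [MeasurableSpace Ω] (μ : Measure Ω) (Y : ℕ → Ω → ℝ)
    (ν : Measure ℝ) : Prop :=
  ∀ x, ν {x} = 0 →
    Tendsto (fun n => μ {ω | Y n ω ≤ x}) atTop (𝓝 (ν (Iic x))) ∧
    Tendsto (fun n => μ {ω | x < Y n ω}) atTop (𝓝 (ν (Ioi x)))

/-! ### Asymptotic bias, variance and mean squared error -/

/-- The hazard rate `f / (1 - F)`. -/
def hazard (F f : ℝ → ℝ) (t : ℝ) : ℝ := f t / (1 - F t)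

/-- `m₂(k) = ∫ u² k(u) du`. -/
def m2 (k : ℝ → ℝ) : ℝ := ∫ u, u ^ 2 * k u

/-- The function `r` in the asymptotic bias. -/
def rFun (F f g : ℝ → ℝ) (t : ℝ) : ℝ :=
  1 / (1 - F t) *
      (iteratedDeriv 2 f t + 2 * ((iteratedDeriv 2 g t * f t + deriv g t * deriv f t) / g t)
        - 2 * (deriv g t ^ 2 * f t / g t ^ 2))
    + f t / (1 - F t) ^ 2 * (deriv f t + 2 * deriv g t * f t / g t)

/-- The asymptotic bias `μ_{λ,MS} = ½ c² m₂(k) r(t)`. -/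
def hazardBias (F f g k : ℝ → ℝ) (t c : ℝ) : ℝ := 1 / 2 * c ^ 2 * m2 k * rFun F f g t

/-- The asymptotic variance
`σ²_{λ,MS} = F(t) / (c³ g(t) (1 - F(t))) ∫ k'(u)² du`. -/
def hazardVar (F g k : ℝ → ℝ) (t c : ℝ) : ℝ :=
  F t / (c ^ 3 * g t * (1 - F t)) * ∫ u, deriv k u ^ 2

/-- The asymptotic mean squared error, for the bandwidth `h = c n^{-1/7}`. -/
def aMSE (F f g k : ℝ → ℝ) (t c : ℝ) : ℝ := hazardBias F f g k t c ^ 2 + hazardVar F g k t c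

/-- The optimal bandwidth constant
`c_{λ,MS} = {3 F(t) / (g(t) (1 - F(t))) ∫ k'²}^{1/7} {m₂(k)² r(t)²}^{-1/7}`. -/
def cOpt (F f g k : ℝ → ℝ) (t : ℝ) : ℝ :=
  (3 * (F t / (g t * (1 - F t))) * ∫ u, deriv k u ^ 2) ^ (1 / 7 : ℝ)
    * (m2 k ^ 2 * rFun F f g t ^ 2) ^ (-(1 / 7) : ℝ)

end CurrentStatus

end

noncomputable section

set_option linter.unusedSectionVars false

namespace CurrentStatus


/-! ### Kernels -/

section Kernel

variable {k : ℝ → ℝ}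

/-! Let `q₁ = F g` and `q₀ = (1 - F) g` be the densities of the censoring times with status 1 and 0.
Away from the boundary the naive hazard estimator is a fixed rational function `(a₀ b₁ - b₀ a₁) /
((a₀ + a₁) a₀)` of the kernel estimators `aᵢ` of `qᵢ` and of their derivatives `bᵢ`. With `h = c
n^(-1/7)` the fluctuation of `bᵢ` has order `(n h³)^(-1/2) = n^(-2/7)`, and so do all biases, which
have order `h²`; the fluctuation of `aᵢ` has the smaller order `n^(-3/7)`. Hence `n^(2/7)` times the
error is a linear combination of the centred `bᵢ`, asymptotically normal by a central limit theorem
for triangular arrays (`tendstoInDistribution_derivFluct`), plus a remainder that tends to the bias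
constant because it is a continuous function of quantities converging in probability
(`tendstoInDistribution_interiorHazard`).

The MSLE equals the naive estimator at `t` with probability tending to one. If the cumulative sum
diagram lies above its tangent at each point near `t`, the hull is the diagram there and its slope
is the naive `F` (`CondK1.FMS_eq_FNaive`). For two points near `t` this holds because the naive `F`
is increasing: its derivative has numerator close to the Wronskian `q₀ q₁' - q₀' q₁ = f g² > 0`. If
the second point is far away, the population diagram clears the tangent by a fixed gap, and the
integrated estimators are uniformly consistent. All this is a deterministic consequence
(`CondK1.exists_hazardMS_eq`) of a single event: the empirical subdistribution functions are within
`κ h²` of their limits. The scale `h²` is what a second kernel derivative costs. It is `n^(-2/7)`,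
much coarser than the empirical rate `n^(-1/2)`, so Chebyshev's inequality on about `1 / h²`
bracketing points gives failure probability `O(n^(-1/7))` (`IsModel.measure_not_isClose_le`).

For the optimal bandwidth, the mean squared error has the form `A c⁴ + V / c³`, and its excess over
the value at the critical point factors with a double root. -/

lemma CondK1.eq_zero_of_one_le (hk : CondK1 k) {u : ℝ} (hu : 1 ≤ |u|) : k u = 0 := by
  obtain ⟨-, -, hs, hsymm, hc⟩ := hk
  have hcont : Continuous k := hc.continuous
  have h1 : ∀ x : ℝ, 1 < x → k x = 0 := fun x hx => by
    apply image_eq_zero_of_notMem_tsupport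
    rw [hs]
    exact fun h => absurd h.2 (not_le.2 hx)
  have h2 : ∀ x : ℝ, 1 ≤ x → k x = 0 := by
    intro x hx
    rcases hx.eq_or_lt with rfl | hx
    · have : Tendsto k (𝓝[>] 1) (𝓝 (k 1)) := hcont.continuousAt.mono_left nhdsWithin_le_nhds
      refine tendsto_nhds_unique this ?_
      refine tendsto_const_nhds.congr' ?_
      filter_upwards [self_mem_nhdsWithin] with y hy
      exact (h1 y hy).symm
    · exact h1 x hx
  rcases abs_cases u with ⟨h, _⟩ | ⟨h, _⟩
  · exact h2 u (h ▸ hu)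
  · rw [← hsymm]; exact h2 _ (h ▸ hu)

/-- Outside `[-1, 1]` the kernel is locally zero. The end points are limits of such points and `k'`
is continuous, so it vanishes there too. -/
lemma CondK1.deriv_eq_zero_of_one_le (hk : CondK1 k) {u : ℝ} (hu : 1 ≤ |u|) : deriv k u = 0 := by
  have hd : Continuous (deriv k) := hk.2.2.2.2.continuous_deriv (by norm_num)
  have h1 : ∀ x : ℝ, 1 < |x| → deriv k x = 0 := fun x hx => by
    have : k =ᶠ[𝓝 x] fun _ => 0 := by
      filter_upwards [(isOpen_lt continuous_const continuous_abs).mem_nhds hx] with y hy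
      exact hk.eq_zero_of_one_le hy.le
    rw [this.deriv_eq]; simp
  rcases hu.eq_or_lt with hu | hu
  · have hcl : u ∈ closure {x : ℝ | 1 < |x|} := by
      rcases (eq_or_eq_neg_of_abs_eq hu.symm) with rfl | rfl
      · refine closure_mono (s := Ioi 1) (fun x hx => ?_) (by simp)
        exact lt_of_lt_of_le hx (le_abs_self x)
      · refine closure_mono (s := Iio (-1)) (fun x hx => ?_) (by simp)
        have := neg_le_abs x
        have hx' : x < -1 := hx
        exact lt_of_lt_of_le (by linarith) this
    have : closure {x : ℝ | 1 < |x|} ⊆ {x | deriv k x = 0} :=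
      closure_minimal (fun x hx => h1 x hx) (isClosed_eq hd continuous_const)
    exact this hcl
  · exact h1 u hu

lemma CondK1.continuous (hk : CondK1 k) : Continuous k := hk.2.2.2.2.continuous

lemma CondK1.continuous_deriv (hk : CondK1 k) : Continuous (deriv k) :=
  hk.2.2.2.2.continuous_deriv (by norm_num)

lemma CondK1.contDiff_one (hk : CondK1 k) : ContDiff ℝ 1 k := hk.2.2.2.2.of_le (by norm_num)

lemma CondK1.contDiff_deriv (hk : CondK1 k) : ContDiff ℝ 1 (deriv k) := by
  have h : ContDiff ℝ (1 + 1) k := by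
    have := hk.2.2.2.2
    norm_num
    exact this
  exact (contDiff_succ_iff_deriv.1 h).2.2

lemma hasCompactSupport_of_eq_zero {κ : ℝ → ℝ} (h : ∀ u, 1 ≤ |u| → κ u = 0) :
    HasCompactSupport κ := by
  refine HasCompactSupport.intro (isCompact_Icc (a := (-1 : ℝ)) (b := 1)) fun x hx => h x ?_
  by_contra hlt
  exact hx (abs_le.1 (not_le.1 hlt).le)

lemma hasCompactSupport_rescale {κ : ℝ → ℝ} (hκ : HasCompactSupport κ) (s : ℝ) {h : ℝ}
    (hh : 0 < h) : HasCompactSupport (fun y => κ ((s - y) / h)) := by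
  obtain ⟨R, hR⟩ := hκ.isCompact.isBounded.subset_closedBall 0
  refine HasCompactSupport.intro (isCompact_closedBall s (h * R)) fun y hy => ?_
  apply image_eq_zero_of_notMem_tsupport
  intro hmem
  apply hy
  have := hR hmem
  rw [mem_closedBall_zero_iff, Real.norm_eq_abs, abs_div, abs_of_pos hh, div_le_iff₀ hh] at this
  rw [Metric.mem_closedBall, Real.dist_eq, abs_sub_comm]
  linarith

lemma integral_rescale (κ q : ℝ → ℝ) (s : ℝ) {h : ℝ} (hh : 0 < h) :
    ∫ y, κ ((s - y) / h) * q y = h * ∫ u, κ u * q (s - h * u) := by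
  have h1 : ∫ y, κ ((s - y) / h) * q y = ∫ y, κ (y / h) * q (s - y) := by
    rw [← integral_sub_left_eq_self (fun y => κ ((s - y) / h) * q y) volume s]
    simp
  have h2 : ∫ y, κ (y / h) * q (s - y) = ∫ y, (fun u => κ u * q (s - h * u)) (y / h) := by
    congr 1; ext y
    simp only
    rw [mul_div_cancel₀ _ hh.ne']
  rw [h1, h2, Measure.integral_comp_div (fun u => κ u * q (s - h * u)), abs_of_pos hh, smul_eq_mul]

/-- Only values of `q` on the unit interval enter, so that after rescaling regularity of `q` within
one bandwidth of the point is enough. -/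
lemma integral_eq_interval {κ : ℝ → ℝ} (hκ : ∀ u, 1 ≤ |u| → κ u = 0) (q : ℝ → ℝ) :
    ∫ u, κ u * q u = ∫ u in (-1)..1, κ u * q u := by
  rw [intervalIntegral.integral_of_le (by norm_num)]
  refine (setIntegral_eq_integral_of_forall_compl_eq_zero fun u hu => ?_).symm
  rw [hκ, zero_mul]
  by_contra hlt
  have := abs_lt.1 (not_le.1 hlt)
  exact hu ⟨this.1, this.2.le⟩

lemma mem_Icc_of_abs_le_one {s h u : ℝ} (hh : 0 < h) (hu : u ∈ Icc (-1 : ℝ) 1) :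
    s - h * u ∈ Icc (s - h) (s + h) := by
  constructor <;> nlinarith [hu.1, hu.2]

lemma smoothing_sub_le {κ q : ℝ → ℝ} (hκc : Continuous κ) (hκ : ∀ u, 1 ≤ |u| → κ u = 0) {s h e : ℝ}
    (hh : 0 < h) (hq : ContinuousOn q (Icc (s - h) (s + h)))
    (he : ∀ y ∈ Icc (s - h) (s + h), |q y - q s| ≤ e) :
    |(∫ u, κ u * q (s - h * u)) - (∫ u, κ u) * q s| ≤ e * ∫ u, |κ u| := by
  have hmaps : MapsTo (fun u => s - h * u) (Icc (-1) 1) (Icc (s - h) (s + h)) :=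
    fun u hu => mem_Icc_of_abs_le_one hh hu
  have hqc : ContinuousOn (fun u => q (s - h * u)) (Icc (-1) 1) :=
    hq.comp (by fun_prop) hmaps
  have e1 : (∫ u, κ u) = ∫ u in (-1)..1, κ u := by
    simpa using integral_eq_interval hκ (fun _ => 1)
  have e2 : (∫ u, |κ u|) = ∫ u in (-1)..1, |κ u| := by
    simpa using integral_eq_interval (κ := fun u => |κ u|) (by simpa using hκ) (fun _ => 1)
  rw [integral_eq_interval hκ (fun u => q (s - h * u)), e1, e2,
    ← intervalIntegral.integral_mul_const, ← intervalIntegral.integral_const_mul,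
    ← intervalIntegral.integral_sub, ← Real.norm_eq_abs]
  · refine intervalIntegral.norm_integral_le_of_norm_le (by norm_num) ?_ ?_
    · refine Eventually.of_forall fun u hu => ?_
      rw [← mul_sub, norm_mul, Real.norm_eq_abs, Real.norm_eq_abs, mul_comm]
      exact mul_le_mul_of_nonneg_right (he _ (hmaps ⟨hu.1.le, hu.2⟩)) (abs_nonneg _)
    · exact Continuous.intervalIntegrable (by fun_prop) _ _
  · exact ContinuousOn.intervalIntegrable_of_Icc (by norm_num) (hκc.continuousOn.mul hqc)
  · exact Continuous.intervalIntegrable (by fun_prop) _ _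

/-- Integration by parts moves the derivative from the kernel to `q` at the price of a factor `h`;
the boundary terms vanish because `k` does at `±1`. -/
lemma CondK1.integral_deriv_smoothing (hk : CondK1 k) {q q' : ℝ → ℝ} {s h : ℝ}
    (hh : 0 < h) (hq : ∀ y ∈ Icc (s - h) (s + h), HasDerivAt q (q' y) y)
    (hq' : ContinuousOn q' (Icc (s - h) (s + h))) :
    ∫ u, deriv k u * q (s - h * u) = h * ∫ u, k u * q' (s - h * u) := by
  have hmaps : MapsTo (fun u => s - h * u) (Icc (-1) 1) (Icc (s - h) (s + h)) :=
    fun u hu => mem_Icc_of_abs_le_one hh hu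
  have h11 : uIcc (-1 : ℝ) 1 = Icc (-1) 1 := uIcc_of_le (by norm_num)
  have hdiff : Differentiable ℝ k := hk.2.2.2.2.differentiable (by norm_num)
  rw [integral_eq_interval (fun u hu => hk.deriv_eq_zero_of_one_le hu) (fun u => q (s - h * u)),
    integral_eq_interval (fun u hu => hk.eq_zero_of_one_le hu) (fun u => q' (s - h * u))]
  have key := intervalIntegral.integral_mul_deriv_eq_deriv_mul (a := -1) (b := 1)
    (u := fun u => q (s - h * u)) (v := k) (u' := fun u => q' (s - h * u) * (-h)) (v' := deriv k)
    (fun u hu => by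
      rw [h11] at hu
      have h2 : HasDerivAt (fun u : ℝ => s - h * u) (-h) u := by
        simpa using ((hasDerivAt_id u).const_mul h).const_sub s
      exact (hq _ (hmaps hu)).comp u h2)
    (fun u _ => (hdiff u).hasDerivAt)
    (by
      apply ContinuousOn.intervalIntegrable
      rw [h11]
      exact (hq'.comp (by fun_prop) hmaps).mul continuousOn_const)
    (hk.continuous_deriv.intervalIntegrable _ _)
  rw [hk.eq_zero_of_one_le (u := 1) (by simp), hk.eq_zero_of_one_le (u := -1) (by simp)] at key
  simp_rw [mul_comm (deriv k _)]
  rw [key, ← intervalIntegral.integral_const_mul, mul_zero, mul_zero, sub_self, zero_sub,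
    ← intervalIntegral.integral_neg]
  congr 1; ext u; ring

end Kernel


/-! ### Empirical and population subdistributions -/

/-- Sum of the `ψ (T j)` with status `i`, divided by the sample size. -/
def empSub (n : ℕ) (T : ℕ → ℝ) (D : ℕ → Fin 2) (i : Fin 2) (ψ : ℝ → ℝ) : ℝ :=
  (1 / (n : ℝ)) * ∑ j ∈ Finset.range n, if D j = i then ψ (T j) else 0

/-- The empirical subdistribution functions are uniformly within `η` of those with densities
`q i`. -/
def IsClose (q : Fin 2 → ℝ → ℝ) (n : ℕ) (T : ℕ → ℝ) (D : ℕ → Fin 2) (η : ℝ) : Prop :=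
  ∀ i x, |empSub n T D i ((Iic x).indicator 1) - ∫ y in Iic x, q i y| ≤ η

section Emp

variable {n : ℕ} {T : ℕ → ℝ} {D : ℕ → Fin 2} {i : Fin 2}

lemma empSub_mono {ψ φ : ℝ → ℝ} (h : ∀ y, ψ y ≤ φ y) : empSub n T D i ψ ≤ empSub n T D i φ := by
  unfold empSub
  gcongr with j
  split_ifs
  · exact h _
  · rfl

lemma empSub_nonneg {ψ : ℝ → ℝ} (h : ∀ y, 0 ≤ ψ y) : 0 ≤ empSub n T D i ψ := by
  unfold empSub
  refine mul_nonneg (by positivity) (Finset.sum_nonneg fun j _ => ?_)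
  split_ifs
  · exact h _
  · rfl

lemma empSub_add (ψ φ : ℝ → ℝ) :
    empSub n T D i (fun y => ψ y + φ y) = empSub n T D i ψ + empSub n T D i φ := by
  unfold empSub
  rw [← mul_add, ← Finset.sum_add_distrib]
  congr 1
  exact Finset.sum_congr rfl fun j _ => by split_ifs <;> simp

lemma empSub_const_mul (c : ℝ) (ψ : ℝ → ℝ) :
    empSub n T D i (fun y => c * ψ y) = c * empSub n T D i ψ := by
  unfold empSub
  rw [mul_left_comm c, Finset.mul_sum _ _ c]
  congr 1
  exact Finset.sum_congr rfl fun j _ => by split_ifs <;> simp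

lemma empSub_sub (ψ φ : ℝ → ℝ) :
    empSub n T D i (fun y => ψ y - φ y) = empSub n T D i ψ - empSub n T D i φ := by
  have := empSub_add (n := n) (T := T) (D := D) (i := i) (fun y => ψ y - φ y) φ
  simp only [sub_add_cancel] at this
  linarith

lemma abs_empSub_le (ψ : ℝ → ℝ) : |empSub n T D i ψ| ≤ empSub n T D i (fun y => |ψ y|) := by
  rw [abs_le]
  constructor
  · have := empSub_const_mul (n := n) (T := T) (D := D) (i := i) (-1) (fun y => |ψ y|)
    have h2 := empSub_mono (n := n) (T := T) (D := D) (i := i) (ψ := fun y => -1 * |ψ y|) (φ := ψ)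
      fun y => by linarith [neg_abs_le (ψ y)]
    linarith
  · exact empSub_mono fun y => le_abs_self _

lemma empSub_integral {ν : Measure ℝ} {w : ℝ → ℝ → ℝ} (hw : ∀ y, Integrable (fun v => w v y) ν) :
    ∫ v, empSub n T D i (w v) ∂ν = empSub n T D i (fun y => ∫ v, w v y ∂ν) := by
  unfold empSub
  rw [integral_const_mul, integral_finsetSum]
  · congr 1
    exact Finset.sum_congr rfl fun j _ => by split_ifs <;> simp
  · intro j _
    split_ifs
    · exact hw _
    · exact integrable_zero _ _ _

lemma integrable_empSub {ν : Measure ℝ} {w : ℝ → ℝ → ℝ} (hw : ∀ y, Integrable (fun v => w v y) ν) :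
    Integrable (fun v => empSub n T D i (w v)) ν := by
  unfold empSub
  refine Integrable.const_mul (integrable_finsetSum _ fun j _ => ?_) _
  split_ifs
  · exact hw _
  · exact integrable_zero _ _ _

/-- Represents a smooth test function as a superposition of indicators of half-lines. Control of
distribution functions thereby becomes control of integrals of `ψ`. -/
lemma eq_neg_integral_deriv {ψ : ℝ → ℝ} (hψ : ContDiff ℝ 1 ψ) (hs : HasCompactSupport ψ) (x : ℝ) :
    ψ x = -∫ y, (Iic y).indicator 1 x * deriv ψ y := by
  have hc : Continuous (deriv ψ) := hψ.continuous_deriv le_rfl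
  have hint : Integrable (deriv ψ) := hc.integrable_of_hasCompactSupport hs.deriv
  have h1 : ∫ y, (Iic y).indicator (1 : ℝ → ℝ) x * deriv ψ y = ∫ y in Ici x, deriv ψ y := by
    rw [← integral_indicator measurableSet_Ici]
    congr 1; ext y
    by_cases hxy : x ≤ y
    · rw [indicator_of_mem (show x ∈ Iic y from hxy), indicator_of_mem (show y ∈ Ici x from hxy)]
      simp
    · rw [indicator_of_notMem (show x ∉ Iic y from hxy),
        indicator_of_notMem (show y ∉ Ici x from hxy)]
      simp
  have h2 : ∫ y in Ioi x, deriv ψ y = 0 - ψ x := by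
    refine integral_Ioi_of_hasDerivAt_of_tendsto hψ.continuous.continuousWithinAt
      (fun y _ => (hψ.differentiable (by norm_num) y).hasDerivAt) hint.integrableOn ?_
    have := hs.is_zero_at_infty
    rw [← Metric.cobounded_eq_cocompact] at this
    exact this.mono_left (by rw [IsOrderBornology.cobounded_eq]; exact le_sup_right)
  rw [h1, integral_Ici_eq_integral_Ioi, h2]
  ring

lemma integrable_indicator_mul {ψ' : ℝ → ℝ} (hint : Integrable ψ') (x : ℝ) :
    Integrable (fun y => (Iic y).indicator (1 : ℝ → ℝ) x * ψ' y) := by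
  have : (fun y => (Iic y).indicator (1 : ℝ → ℝ) x * ψ' y) = (Ici x).indicator ψ' := by
    ext y
    by_cases hxy : x ≤ y
    · rw [indicator_of_mem (show x ∈ Iic y from hxy), indicator_of_mem (show y ∈ Ici x from hxy)]
      simp
    · rw [indicator_of_notMem (show x ∉ Iic y from hxy),
        indicator_of_notMem (show y ∉ Ici x from hxy)]
      simp
  rw [this]
  exact hint.indicator measurableSet_Ici

/-- Integration by parts: both terms are minus the integral of a subdistribution function against
`ψ'`, so their difference is at most the uniform distance times the total variation of `ψ`. The
population side needs Fubini, the empirical side is a finite sum. -/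
lemma IsClose.abs_empSub_sub_le {q : Fin 2 → ℝ → ℝ} {η : ℝ} (hcl : IsClose q n T D η)
    (hq : Integrable (q i)) {ψ : ℝ → ℝ} (hψ : ContDiff ℝ 1 ψ) (hs : HasCompactSupport ψ) :
    |empSub n T D i ψ - ∫ y, ψ y * q i y| ≤ η * ∫ y, |deriv ψ y| := by
  have hc : Continuous (deriv ψ) := hψ.continuous_deriv le_rfl
  have hint : Integrable (deriv ψ) := hc.integrable_of_hasCompactSupport hs.deriv
  have e1 : empSub n T D i ψ
      = -∫ y, empSub n T D i ((Iic y).indicator 1) * deriv ψ y := by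
    have : ∀ y, empSub n T D i ((Iic y).indicator 1) * deriv ψ y
        = empSub n T D i (fun x => (Iic y).indicator 1 x * deriv ψ y) := fun y => by
      rw [mul_comm, ← empSub_const_mul]
      simp_rw [mul_comm]
    simp_rw [this]
    rw [empSub_integral (w := fun y x => (Iic y).indicator 1 x * deriv ψ y)
      (integrable_indicator_mul hint), ← neg_one_mul, ← empSub_const_mul]
    congr 1; ext x
    rw [eq_neg_integral_deriv hψ hs x, neg_one_mul]
  have hprod : Integrable (fun p : ℝ × ℝ => (Iic p.2).indicator (1 : ℝ → ℝ) p.1 * deriv ψ p.2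
      * q i p.1) (volume.prod volume) := by
    have h0 : Integrable (fun p : ℝ × ℝ => q i p.1 * deriv ψ p.2) (volume.prod volume) :=
      hq.mul_prod hint
    have h1 := h0.indicator (s := {p : ℝ × ℝ | p.1 ≤ p.2})
      (measurableSet_le measurable_fst measurable_snd)
    refine h1.congr (Eventually.of_forall fun p => ?_)
    by_cases hp : p.1 ≤ p.2
    · simp [indicator, hp, mul_comm]
    · simp [indicator, hp]
  have e2 : ∫ x, ψ x * q i x = -∫ y, (∫ x in Iic y, q i x) * deriv ψ y := by
    have h1 : ∀ x, ψ x * q i x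
        = -∫ y, (Iic y).indicator (1 : ℝ → ℝ) x * deriv ψ y * q i x := fun x => by
      rw [integral_mul_const, eq_neg_integral_deriv hψ hs x]; ring
    simp_rw [h1]
    rw [integral_neg, integral_integral_swap hprod]
    congr 2; ext y
    rw [← integral_indicator measurableSet_Iic, ← integral_mul_const]
    congr 1; ext x
    by_cases hxy : x ≤ y
    · simp [indicator, hxy, mul_comm]
    · simp [indicator, hxy]
  have i1 : Integrable fun y => empSub n T D i ((Iic y).indicator 1) * deriv ψ y := by
    have : ∀ y, empSub n T D i ((Iic y).indicator 1) * deriv ψ y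
        = empSub n T D i (fun x => (Iic y).indicator 1 x * deriv ψ y) := fun y => by
      rw [mul_comm, ← empSub_const_mul]
      simp_rw [mul_comm]
    simp_rw [this]
    exact integrable_empSub (w := fun y x => (Iic y).indicator 1 x * deriv ψ y)
      (integrable_indicator_mul hint)
  have i2 : Integrable fun y => (∫ x in Iic y, q i x) * deriv ψ y := by
    refine hprod.integral_prod_right.congr (Eventually.of_forall fun y => ?_)
    simp only
    rw [← integral_indicator measurableSet_Iic, ← integral_mul_const]
    congr 1; ext x
    by_cases hxy : x ≤ y
    · simp [indicator, hxy, mul_comm]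
    · simp [indicator, hxy]
  rw [e1, e2, neg_sub_neg, ← integral_sub i2 i1, ← integral_const_mul, ← Real.norm_eq_abs]
  refine norm_integral_le_of_norm_le (hint.abs.const_mul η) (Eventually.of_forall fun y => ?_)
  rw [← sub_mul, norm_mul, Real.norm_eq_abs, Real.norm_eq_abs, abs_sub_comm]
  exact mul_le_mul_of_nonneg_right (hcl i y) (abs_nonneg _)

end Emp


/-! ### Local consistency of the kernel estimators and their derivatives -/

section Local

variable {k : ℝ → ℝ} {n : ℕ} {T : ℕ → ℝ} {D : ℕ → Fin 2} {i : Fin 2} {h s : ℝ}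

lemma gHatSub_eq_empSub : gHatSub k h n T D i s
    = empSub n T D i (fun y => 1 / h * kernelAt k h s ((s - y) / h)) := rfl

lemma kernelAt_of_lt (hs : h < s) : kernelAt k h s = k := by
  ext u
  rw [kernelAt, if_neg fun hh => absurd hh.2 (not_le.2 hs)]

lemma gHatSub_of_lt (hs : h < s) :
    gHatSub k h n T D i s = empSub n T D i (fun y => 1 / h * k ((s - y) / h)) := by
  rw [gHatSub_eq_empSub, kernelAt_of_lt hs]

lemma CondK1.hasDerivAt_gHatSub (hk : CondK1 k) (hs : h < s) :
    HasDerivAt (gHatSub k h n T D i)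
      (empSub n T D i (fun y => 1 / h ^ 2 * deriv k ((s - y) / h))) s := by
  have hdiff : Differentiable ℝ k := hk.2.2.2.2.differentiable (by norm_num)
  have h1 : HasDerivAt (fun s => empSub n T D i (fun y => 1 / h * k ((s - y) / h)))
      (empSub n T D i (fun y => 1 / h ^ 2 * deriv k ((s - y) / h))) s := by
    unfold empSub
    refine HasDerivAt.const_mul _ (HasDerivAt.fun_sum fun j _ => ?_)
    split_ifs
    · have h2 : HasDerivAt (fun s : ℝ => (s - T j) / h) (1 / h) s :=
        ((hasDerivAt_id s).sub_const _).div_const _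
      have h3 := ((hdiff ((s - T j) / h)).hasDerivAt.comp s h2).const_mul (1 / h)
      convert! h3 using 1
      ring
    · exact hasDerivAt_const _ _
  refine h1.congr_of_eventuallyEq ?_
  filter_upwards [lt_mem_nhds hs] with x hx
  exact gHatSub_of_lt hx

lemma CondK1.gHatSub_nonneg (hk : CondK1 k) (hh : 0 < h) (hs : h < s) :
    0 ≤ gHatSub k h n T D i s := by
  rw [gHatSub_of_lt hs]
  exact empSub_nonneg fun y => mul_nonneg (by positivity) (hk.1 _)

/-- Total variation is invariant under rescaling. The powers of `1 / h` in the error bounds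
therefore come only from the prefactor of the kernel. -/
lemma integral_abs_deriv_rescale {κ : ℝ → ℝ} (hκ : Differentiable ℝ κ) (hh : 0 < h) :
    ∫ y, |deriv (fun y => κ ((s - y) / h)) y| = ∫ u, |deriv κ u| := by
  have : ∀ y, deriv (fun y => κ ((s - y) / h)) y = deriv κ ((s - y) / h) * (-1 / h) := fun y => by
    have h2 : HasDerivAt (fun y : ℝ => (s - y) / h) (-1 / h) y :=
      ((hasDerivAt_id y).const_sub s).div_const _
    exact ((hκ _).hasDerivAt.comp y h2).deriv
  simp_rw [this, abs_mul]
  rw [integral_rescale (fun u => |deriv κ u|) (fun _ => |(-1) / h|) s hh, integral_mul_const,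
    abs_div, abs_neg, abs_one, abs_of_pos hh]
  field_simp

lemma IsClose.abs_rescale_sub_le {q : Fin 2 → ℝ → ℝ} {η : ℝ} (hcl : IsClose q n T D η)
    (hq : Integrable (q i)) {κ : ℝ → ℝ} (hκ : ContDiff ℝ 1 κ) (hs : HasCompactSupport κ)
    (hh : 0 < h) (c : ℝ) (hc : 0 ≤ c) (s : ℝ) :
    |empSub n T D i (fun y => c * κ ((s - y) / h)) - c * (h * ∫ u, κ u * q i (s - h * u))|
      ≤ c * (η * ∫ u, |deriv κ u|) := by
  have h1 := hcl.abs_empSub_sub_le hq (ψ := fun y => κ ((s - y) / h)) (by fun_prop)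
    (hasCompactSupport_rescale hs s hh)
  rw [integral_abs_deriv_rescale (hκ.differentiable (by norm_num)) hh, integral_rescale κ _ _ hh]
    at h1
  rw [empSub_const_mul, ← mul_sub, abs_mul, abs_of_nonneg hc]
  exact mul_le_mul_of_nonneg_left h1 hc

/-- Locally uniform consistency of the kernel estimators and their derivatives. -/
lemma CondK1.exists_gHatSub_sub_le (hk : CondK1 k) {q q' : Fin 2 → ℝ → ℝ}
    (hq : ∀ i, Integrable (q i)) {a b a' b' : ℝ} (ha' : 0 < a') (ha : a' < a) (hb : b < b')
    (hd : ∀ i, ∀ y ∈ Icc a' b', HasDerivAt (q i) (q' i y) y)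
    (hd' : ∀ i, ContinuousOn (q' i) (Icc a' b')) {e : ℝ} (he : 0 < e) :
    ∃ κ > 0, κ < a' ∧ ∀ h, 0 < h → h < κ → ∀ n T D, IsClose q n T D (κ * h ^ 2) →
      ∀ i, ∀ s ∈ Icc a b, |gHatSub k h n T D i s - q i s| ≤ e ∧
        |deriv (gHatSub k h n T D i) s - q' i s| ≤ e := by
  set A := ∫ u, |deriv k u| with hA
  set A2 := ∫ u, |deriv (deriv k) u| with hA2
  have hA0 : 0 ≤ A := integral_nonneg fun u => abs_nonneg _
  have hA20 : 0 ≤ A2 := integral_nonneg fun u => abs_nonneg _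
  have hunif : ∀ f : ℝ → ℝ, ContinuousOn f (Icc a' b') → ∃ δ > 0, ∀ x ∈ Icc a' b',
      ∀ y ∈ Icc a' b', |x - y| < δ → |f x - f y| < e / 2 := fun f hf => by
    have := Metric.uniformContinuousOn_iff.1 (isCompact_Icc.uniformContinuousOn_of_continuous hf)
      (e / 2) (by positivity)
    simpa only [Real.dist_eq] using this
  have hqc : ∀ i, ContinuousOn (q i) (Icc a' b') := fun i y hy =>
    (hd i y hy).continuousAt.continuousWithinAt
  choose δ₁ hδ₁ H₁ using fun i => hunif (q i) (hqc i)
  choose δ₂ hδ₂ H₂ using fun i => hunif (q' i) (hd' i)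
  have hkint : (∫ u, |k u|) = 1 := by
    simp_rw [abs_of_nonneg (hk.1 _)]
    exact hk.2.1
  -- The requirements on `κ`: windows of width `h` around `[a, b]` stay in `[a', b']`, the
  -- oscillation of `q` and `q'` over them is below `e / 2`, and the total variation terms are below
  -- `e / 2`.
  have hev : ∀ᶠ κ in 𝓝[>] (0 : ℝ), κ < a' ∧ κ < a - a' ∧ κ < b' - b ∧ κ < 1 ∧ (∀ i, κ < δ₁ i) ∧
      (∀ i, κ < δ₂ i) ∧ κ * A < e / 2 ∧ κ * A2 < e / 2 := by
    have hlt : ∀ x : ℝ, 0 < x → ∀ᶠ κ in 𝓝[>] (0 : ℝ), κ < x := fun x hx =>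
      (eventually_lt_nhds hx).filter_mono nhdsWithin_le_nhds
    have hmul : ∀ B : ℝ, ∀ᶠ κ in 𝓝[>] (0 : ℝ), κ * B < e / 2 := fun B => by
      have : Tendsto (fun κ : ℝ => κ * B) (𝓝 0) (𝓝 (0 * B)) := tendsto_id.mul_const B
      rw [zero_mul] at this
      exact (this.eventually_lt_const (by positivity)).filter_mono nhdsWithin_le_nhds
    filter_upwards [hlt a' ha', hlt _ (sub_pos.2 ha), hlt _ (sub_pos.2 hb), hlt 1 one_pos,
      eventually_all.2 fun i => hlt _ (hδ₁ i), eventually_all.2 fun i => hlt _ (hδ₂ i), hmul A,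
      hmul A2] with κ h1 h2 h3 h4 h5 h6 h7 h8
    exact ⟨h1, h2, h3, h4, h5, h6, h7, h8⟩
  obtain ⟨κ, ⟨h1, h2, h3, h4, h5, h6, h7, h8⟩, hκ⟩ := (hev.and self_mem_nhdsWithin).exists
  refine ⟨κ, hκ, h1, fun h hh hhκ n T D hcl i s hs => ?_⟩
  have hsub : Icc (s - h) (s + h) ⊆ Icc a' b' := Icc_subset_Icc (by linarith [hs.1])
    (by linarith [hs.2])
  have hsm : s ∈ Icc a' b' := ⟨by linarith [hs.1], by linarith [hs.2]⟩
  have habs : ∀ y ∈ Icc (s - h) (s + h), |y - s| ≤ h := fun y hy => by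
    rw [abs_le]; constructor <;> linarith [hy.1, hy.2]
  have hhs : h < s := by linarith [hs.1]
  have hκ0 : 0 < κ := hκ
  constructor
  · have e1 := hcl.abs_rescale_sub_le (hq i) hk.contDiff_one
      (hasCompactSupport_of_eq_zero fun u hu => hk.eq_zero_of_one_le hu) hh (1 / h)
      (by positivity) s
    have e2 := smoothing_sub_le (e := e / 2) hk.continuous
      (fun u hu => hk.eq_zero_of_one_le hu) hh ((hqc i).mono hsub)
      fun y hy => (H₁ i y (hsub hy) s hsm ((habs y hy).trans_lt (hhκ.trans (h5 i)))).le
    rw [hk.2.1, one_mul, hkint, mul_one] at e2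
    rw [← gHatSub_of_lt hhs, ← mul_assoc, one_div_mul_cancel hh.ne', one_mul] at e1
    have e3 : 1 / h * (κ * h ^ 2 * A) ≤ e / 2 := by
      have : 1 / h * (κ * h ^ 2 * A) = (κ * A) * h := by field_simp
      rw [this]
      have : 0 ≤ κ * A := by positivity
      nlinarith
    calc _ ≤ _ := abs_sub_le _ _ _
      _ ≤ e / 2 + e / 2 := add_le_add (e1.trans e3) e2
      _ = e := by ring
  · have e1 := hcl.abs_rescale_sub_le (hq i) hk.contDiff_deriv
      (hasCompactSupport_of_eq_zero fun u hu => hk.deriv_eq_zero_of_one_le hu) hh (1 / h ^ 2)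
      (by positivity) s
    have e2 := smoothing_sub_le (e := e / 2) hk.continuous
      (fun u hu => hk.eq_zero_of_one_le hu) hh ((hd' i).mono hsub)
      fun y hy => (H₂ i y (hsub hy) s hsm ((habs y hy).trans_lt (hhκ.trans (h6 i)))).le
    rw [hk.2.1, one_mul, hkint, mul_one] at e2
    rw [(hk.hasDerivAt_gHatSub hhs).deriv]
    rw [hk.integral_deriv_smoothing hh (fun y hy => hd i y (hsub hy)) ((hd' i).mono hsub)] at e1
    have e4 : ∀ x : ℝ, 1 / h ^ 2 * (h * (h * x)) = x := fun x => by field_simp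
    rw [e4] at e1
    -- The prefactor `1 / h²` of the differentiated kernel exactly consumes the `h²` in the
    -- closeness assumption; for the estimator itself a factor `h` was to spare.
    have e3 : 1 / h ^ 2 * (κ * h ^ 2 * A2) ≤ e / 2 := by
      have : 1 / h ^ 2 * (κ * h ^ 2 * A2) = κ * A2 := by field_simp
      rw [this]
      exact h8.le
    calc _ ≤ _ := abs_sub_le _ _ _
      _ ≤ e / 2 + e / 2 := add_le_add (e1.trans e3) e2
      _ = e := by ring

end Local


/-! ### The boundary kernel and the integrated weights -/

section Boundary

variable {k : ℝ → ℝ}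

lemma CondK1.continuous_nu (hk : CondK1 k) (i : ℕ) : Continuous (nu k i) := by
  have hc := hk.continuous
  exact intervalIntegral.continuous_primitive
    (fun a b => Continuous.intervalIntegrable (by fun_prop) a b) _

lemma CondK1.exists_pos_mem_Ioo (hk : CondK1 k) {a b : ℝ} (ha : -1 ≤ a) (hab : a < b) (hb : b ≤ 1) :
    ∃ x ∈ Ioo a b, 0 < k x := by
  have hm : (a + b) / 2 ∈ tsupport k := by
    rw [hk.2.2.1]; constructor <;> linarith
  obtain ⟨x, hx, hkx⟩ := mem_closure_iff_nhds.1 hm (Ioo a b)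
    (Ioo_mem_nhds (by linarith) (by linarith))
  exact ⟨x, hx, lt_of_le_of_ne (hk.1 x) (Ne.symm hkx)⟩

lemma CondK1.nu_zero_pos (hk : CondK1 k) {β : ℝ} (h0 : 0 ≤ β) (h1 : β ≤ 1) : 0 < nu k 0 β := by
  obtain ⟨x, hx, hkx⟩ := hk.exists_pos_mem_Ioo le_rfl (by linarith : (-1 : ℝ) < β) h1
  have hc := hk.continuous
  refine intervalIntegral.integral_pos (by linarith) (by fun_prop)
    (fun u _ => by simpa using hk.1 u) ⟨x, ⟨hx.1.le, hx.2.le⟩, by simpa using hkx⟩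

/-- Divided by `ν₀²`, this is the variance of the law with density proportional to `k` on `[-1, β]`,
which is not concentrated at its mean `m`. -/
lemma CondK1.nu_det_pos (hk : CondK1 k) {β : ℝ} (h0 : 0 ≤ β) (h1 : β ≤ 1) :
    0 < nu k 0 β * nu k 2 β - nu k 1 β ^ 2 := by
  have hν0 := hk.nu_zero_pos h0 h1
  have hc := hk.continuous
  set m := nu k 1 β / nu k 0 β with hm
  have key : 0 < ∫ u in (-1)..β, (u - m) ^ 2 * k u := by
    -- Two points of positive density in disjoint intervals: at most one of them can be the mean.
    obtain ⟨x, hx, hkx⟩ := hk.exists_pos_mem_Ioo (a := -1) (b := -1 / 2) le_rfl (by norm_num)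
      (by norm_num)
    obtain ⟨y, hy, hky⟩ := hk.exists_pos_mem_Ioo (a := -1 / 2) (b := 0) (by norm_num) (by norm_num)
      (by norm_num)
    have hex : ∃ c ∈ Icc (-1) β, c ≠ m ∧ 0 < k c := by
      by_cases hxm : x = m
      · exact ⟨y, ⟨by linarith [hy.1], by linarith [hy.2]⟩, by rw [← hxm]; linarith [hx.2, hy.1],
          hky⟩
      · exact ⟨x, ⟨hx.1.le, by linarith [hx.2]⟩, hxm, hkx⟩
    obtain ⟨c, hcm, hne, hkc⟩ := hex
    refine intervalIntegral.integral_pos (by linarith) (by fun_prop)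
      (fun u _ => mul_nonneg (sq_nonneg _) (hk.1 u)) ⟨c, hcm, ?_⟩
    have := sub_ne_zero.2 hne
    positivity
  have hexp : ∫ u in (-1)..β, (u - m) ^ 2 * k u
      = nu k 2 β - 2 * m * nu k 1 β + m ^ 2 * nu k 0 β := by
    unfold nu
    rw [← intervalIntegral.integral_const_mul, ← intervalIntegral.integral_const_mul,
      ← intervalIntegral.integral_sub, ← intervalIntegral.integral_add]
    · congr 1; ext u; ring
    all_goals exact Continuous.intervalIntegrable (by fun_prop) _ _
  rw [hexp, hm] at key
  have := mul_pos hν0 key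
  field_simp at this
  linarith

/-- The boundary kernel is jointly continuous in `β` and `u` on a compact rectangle, since its
denominator never vanishes there. This makes the bound uniform in `β`. -/
lemma CondK1.exists_kernelAt_le (hk : CondK1 k) :
    ∃ B, 1 ≤ B ∧ ∀ h s u, 0 < h → |kernelAt k h s u| ≤ B := by
  obtain ⟨K, hK⟩ := hk.continuous.bounded_above_of_compact_support
    (hasCompactSupport_of_eq_zero fun u hu => hk.eq_zero_of_one_le hu)
  have hcont : ContinuousOn (fun p : ℝ × ℝ =>
      (nu k 2 p.1 - nu k 1 p.1 * p.2) / (nu k 0 p.1 * nu k 2 p.1 - nu k 1 p.1 ^ 2) * k p.2)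
      (Icc 0 1 ×ˢ Icc (-1) 1) := by
    have := hk.continuous_nu 0
    have := hk.continuous_nu 1
    have := hk.continuous_nu 2
    have := hk.continuous
    refine ContinuousOn.mul (ContinuousOn.div (by fun_prop) (by fun_prop) ?_) (by fun_prop)
    intro p hp
    exact (hk.nu_det_pos hp.1.1 hp.1.2).ne'
  obtain ⟨K', hK'⟩ := (isCompact_Icc.prod isCompact_Icc).exists_bound_of_continuousOn hcont
  refine ⟨max 1 (max K K'), le_max_left _ _, fun h s u hh => ?_⟩
  unfold kernelAt
  split_ifs with hs
  · unfold boundaryKernel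
    by_cases hu : u ∈ Ioo (-1) (s / h)
    · rw [indicator_of_mem hu]
      have h1 : s / h ≤ 1 := (div_le_one hh).2 hs.2
      exact (hK' (s / h, u) ⟨⟨div_nonneg hs.1 hh.le, h1⟩, hu.1.le, hu.2.le.trans h1⟩).trans
        ((le_max_right _ _).trans (le_max_right _ _))
    · rw [indicator_of_notMem hu, abs_zero]
      exact zero_le_one.trans (le_max_left _ _)
  · exact (hK u).trans ((le_max_left _ _).trans (le_max_right _ _))

lemma CondK1.kernelAt_eq_zero (hk : CondK1 k) {h s u : ℝ} (hu : 1 ≤ |u|) :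
    kernelAt k h s u = 0 := by
  unfold kernelAt
  split_ifs with hs
  · unfold boundaryKernel
    rw [indicator_apply]
    split_ifs with hm
    · rw [hk.eq_zero_of_one_le hu, mul_zero]
    · rfl
  · exact hk.eq_zero_of_one_le hu

lemma CondK1.measurable_kernelAt (hk : CondK1 k) (h y : ℝ) :
    Measurable (fun v => kernelAt k h v ((v - y) / h)) := by
  have := (hk.continuous_nu 0).measurable
  have := (hk.continuous_nu 1).measurable
  have := (hk.continuous_nu 2).measurable
  have := hk.continuous.measurable
  unfold kernelAt boundaryKernel
  simp only [indicator_apply, mem_Ioo]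
  refine Measurable.ite ?_ (Measurable.ite ?_ (by fun_prop) measurable_const) (by fun_prop)
  · exact measurableSet_Icc
  · have h1 : Measurable fun v : ℝ => (v - y) / h := by fun_prop
    have h2 : Measurable fun v : ℝ => v / h := by fun_prop
    exact (measurableSet_lt measurable_const h1).inter (measurableSet_lt h1 h2)

lemma CondK1.integrable_kernelAt (hk : CondK1 k) {h : ℝ} (hh : 0 < h) (y : ℝ) :
    Integrable (fun v => 1 / h * kernelAt k h v ((v - y) / h)) := by
  obtain ⟨B, -, hB⟩ := hk.exists_kernelAt_le
  have h1 : IntegrableOn (fun v => kernelAt k h v ((v - y) / h)) (Icc (y - h) (y + h)) :=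
    Measure.integrableOn_of_bounded (M := B) (by simp)
      (hk.measurable_kernelAt h y).aestronglyMeasurable
      (Eventually.of_forall fun v => hB h v _ hh)
  refine Integrable.const_mul ?_ _
  refine (integrableOn_iff_integrable_of_support_subset fun v hv => ?_).1 h1
  by_contra hout
  refine hv (hk.kernelAt_eq_zero ?_)
  by_contra hlt
  rw [not_le, abs_lt, lt_div_iff₀ hh, div_lt_iff₀ hh] at hlt
  exact hout ⟨by linarith [hlt.1], by linarith [hlt.2]⟩

/-- The weight that an observation `y` contributes to the integrated estimator at `u`. -/
def cumWeight (k : ℝ → ℝ) (h u y : ℝ) : ℝ :=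
  ∫ v in Icc 0 u, 1 / h * kernelAt k h v ((v - y) / h)

lemma CondK1.GHatSub_eq (hk : CondK1 k) {h : ℝ} (hh : 0 < h) (n : ℕ) (T : ℕ → ℝ) (D : ℕ → Fin 2)
    (i : Fin 2) (u : ℝ) : GHatSub k h n T D i u = empSub n T D i (cumWeight k h u) := by
  unfold GHatSub cumWeight
  simp_rw [gHatSub_eq_empSub]
  exact empSub_integral (w := fun v y => 1 / h * kernelAt k h v ((v - y) / h))
    fun y => (hk.integrable_kernelAt hh y).integrableOn

lemma CondK1.integrable_gHatSub (hk : CondK1 k) {h : ℝ} (hh : 0 < h) (n : ℕ) (T : ℕ → ℝ)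
    (D : ℕ → Fin 2) (i : Fin 2) : Integrable (gHatSub k h n T D i) := by
  have := integrable_empSub (n := n) (T := T) (D := D) (i := i)
    (w := fun v y => 1 / h * kernelAt k h v ((v - y) / h)) (hk.integrable_kernelAt hh)
  exact this

/-- The kernel integrates to one, so an observation contributes exactly 0 or 1 unless it is close to
the boundary or to `u`. In those zones the crude bound on the integral of the kernel is used. -/
lemma CondK1.exists_cumWeight_sub_le (hk : CondK1 k) :
    ∃ C, 0 ≤ C ∧ ∀ h u y, 0 < h → |cumWeight k h u y - (Iic u).indicator 1 y|
      ≤ C * (Iic (2 * h)).indicator 1 y + C * (Ioc (u - 2 * h) (u + h)).indicator 1 y := by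
  obtain ⟨B, hB1, hB⟩ := hk.exists_kernelAt_le
  refine ⟨2 * B + 1, by linarith, fun h u y hh => ?_⟩
  have hind : |(Iic u).indicator (1 : ℝ → ℝ) y| ≤ 1 := by
    rw [indicator_apply]; split_ifs <;> simp
  have hbd : |cumWeight k h u y| ≤ 2 * B := by
    unfold cumWeight
    have h1 : |∫ v in Icc 0 u, 1 / h * kernelAt k h v ((v - y) / h)|
        ≤ ∫ v in Icc 0 u, |1 / h * kernelAt k h v ((v - y) / h)| :=
      abs_integral_le_integral_abs
    have h2 : ∫ v in Icc 0 u, |1 / h * kernelAt k h v ((v - y) / h)|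
        ≤ ∫ v, |1 / h * kernelAt k h v ((v - y) / h)| :=
      setIntegral_le_integral (hk.integrable_kernelAt hh y).abs
        (Eventually.of_forall fun v => abs_nonneg _)
    have h3 : ∫ v, |1 / h * kernelAt k h v ((v - y) / h)|
        ≤ ∫ v, (Icc (y - h) (y + h)).indicator (fun _ => B / h) v := by
      refine integral_mono (hk.integrable_kernelAt hh y).abs ?_ fun v => ?_
      · exact (integrable_indicator_iff measurableSet_Icc).2 (by simp)
      · simp only
        by_cases hv : v ∈ Icc (y - h) (y + h)
        · rw [indicator_of_mem hv, abs_mul, abs_of_pos (by positivity : 0 < 1 / h),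
            div_eq_mul_one_div B h, mul_comm B]
          exact mul_le_mul_of_nonneg_left (hB h v _ hh) (by positivity)
        · rw [indicator_of_notMem hv, hk.kernelAt_eq_zero, mul_zero, abs_zero]
          by_contra hlt
          rw [not_le, abs_lt, lt_div_iff₀ hh, div_lt_iff₀ hh] at hlt
          exact hv ⟨by linarith [hlt.1], by linarith [hlt.2]⟩
    have h4 : ∫ v, (Icc (y - h) (y + h)).indicator (fun _ => B / h) v = 2 * B := by
      rw [integral_indicator measurableSet_Icc, setIntegral_const, measureReal_def,
        Real.volume_Icc, ENNReal.toReal_ofReal (by linarith), smul_eq_mul]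
      field_simp; ring
    linarith
  have hcrude : |cumWeight k h u y - (Iic u).indicator 1 y| ≤ 2 * B + 1 :=
    (abs_sub _ _).trans (add_le_add hbd hind)
  have hn1 : 0 ≤ (Iic (2 * h)).indicator (1 : ℝ → ℝ) y := indicator_nonneg (by simp) _
  have hn2 : 0 ≤ (Ioc (u - 2 * h) (u + h)).indicator (1 : ℝ → ℝ) y := indicator_nonneg (by simp) _
  have hC : 0 ≤ 2 * B + 1 := by linarith
  by_cases hy : y ≤ 2 * h
  · rw [indicator_of_mem (show y ∈ Iic (2 * h) from hy)]
    have := mul_nonneg hC hn2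
    simp only [Pi.one_apply] at *
    linarith
  by_cases hyu : y ∈ Ioc (u - 2 * h) (u + h)
  · rw [indicator_of_mem hyu]
    have := mul_nonneg hC hn1
    simp only [Pi.one_apply] at *
    linarith
  have heq : cumWeight k h u y = (Iic u).indicator 1 y := by
    rw [not_le] at hy
    -- An observation beyond `2h` never meets the boundary kernel: for `v ≤ h` it is at least one
    -- bandwidth away, and both kernels vanish.
    have hker : ∀ v, kernelAt k h v ((v - y) / h) = k ((v - y) / h) := fun v => by
      by_cases hv : h < v
      · rw [kernelAt_of_lt hv]
      · have : 1 ≤ |(v - y) / h| := by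
          rw [abs_div, abs_of_pos hh, le_div_iff₀ hh, abs_sub_comm]
          exact le_trans (by linarith) (le_abs_self _)
        rw [hk.kernelAt_eq_zero this, hk.eq_zero_of_one_le this]
    unfold cumWeight
    simp_rw [hker]
    by_cases hyle : y ≤ u - 2 * h
    · rw [indicator_of_mem (show y ∈ Iic u by simp only [mem_Iic]; linarith)]
      rw [setIntegral_eq_integral_of_forall_compl_eq_zero]
      · rw [integral_const_mul, integral_sub_right_eq_self (fun v => k (v / h)) y,
          Measure.integral_comp_div k, hk.2.1, abs_of_pos hh]
        simp [hh.ne']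
      · intro v hv
        rw [hk.eq_zero_of_one_le, mul_zero]
        by_contra hlt
        rw [not_le, abs_lt, lt_div_iff₀ hh, div_lt_iff₀ hh] at hlt
        exact hv ⟨by linarith [hlt.1], by linarith [hlt.2]⟩
    · have hgt : u + h < y := by
        by_contra hle
        exact hyu ⟨not_le.1 hyle, not_lt.1 hle⟩
      rw [indicator_of_notMem (show y ∉ Iic u by simp only [mem_Iic]; linarith)]
      refine setIntegral_eq_zero_of_forall_eq_zero fun v hv => ?_
      rw [hk.eq_zero_of_one_le, mul_zero]
      rw [abs_div, abs_of_pos hh, le_div_iff₀ hh, abs_sub_comm]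
      exact le_trans (by linarith [hv.2]) (le_abs_self _)
  rw [heq, sub_self, abs_zero]
  positivity

end Boundary

/-! ### Uniform consistency of the integrated estimators -/

section Global

variable {k : ℝ → ℝ}

lemma exists_integral_Ioc_le {q : ℝ → ℝ} (hq : Integrable q) {e : ℝ} (he : 0 < e) :
    ∃ δ > 0, ∀ a b, b - a < δ → |∫ y in Ioc a b, q y| ≤ e := by
  have hfin : ∫⁻ y, ‖q y‖ₑ ≠ ⊤ := hq.2.ne
  obtain ⟨δ, hδ, H⟩ := exists_pos_setLIntegral_lt_of_measure_lt hfin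
    (ε := ENNReal.ofReal e) (by simpa using he)
  have hδ' : ∃ δ' : ℝ, 0 < δ' ∧ ENNReal.ofReal δ' ≤ δ := by
    rcases eq_or_ne δ ⊤ with rfl | hne
    · exact ⟨1, one_pos, le_top⟩
    · exact ⟨δ.toReal, ENNReal.toReal_pos hδ.ne' hne, by rw [ENNReal.ofReal_toReal hne]⟩
  obtain ⟨δ', hδ'0, hδ'⟩ := hδ'
  refine ⟨δ', hδ'0, fun a b hab => ?_⟩
  have h1 := H (Ioc a b) (by
    rw [Real.volume_Ioc]
    exact ((ENNReal.ofReal_lt_ofReal_iff hδ'0).2 hab).trans_le hδ')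
  rw [← Real.norm_eq_abs, ← ENNReal.ofReal_le_ofReal_iff he.le, ofReal_norm]
  exact (enorm_integral_le_lintegral_enorm _).trans h1.le

/-- Uniform consistency of the integrated kernel estimators. -/
lemma CondK1.exists_GHatSub_sub_le (hk : CondK1 k) {q : Fin 2 → ℝ → ℝ}
    (hq : ∀ i, Integrable (q i)) (hq0 : ∀ i, ∫ y in Iic 0, q i y = 0) {e : ℝ} (he : 0 < e) :
    ∃ κ > 0, ∀ h, 0 < h → h < κ → ∀ n T D, IsClose q n T D κ →
      ∀ i, ∀ u, |GHatSub k h n T D i u - ∫ y in Iic u, q i y| ≤ e := by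
  obtain ⟨C, hC, hw⟩ := hk.exists_cumWeight_sub_le
  have he' : 0 < e / (2 * C + 2) / 2 := by positivity
  choose δ hδ hH using fun i => exists_integral_Ioc_le (hq i) he'
  -- The two exceptional zones are `(-∞, 2h]` and `(u - 2h, u + h]`; the latter has length `3h`,
  -- hence `δ / 3`. The closeness error is charged at most `3C + 1` times, which `8C + 8` leaves
  -- room for.
  refine ⟨min (e / (8 * C + 8)) (min (δ 0 / 3) (δ 1 / 3)), ?_, ?_⟩
  · have := hδ 0
    have := hδ 1
    positivity
  intro h hh hhκ n T D hcl i u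
  set η := min (e / (8 * C + 8)) (min (δ 0 / 3) (δ 1 / 3)) with hη
  have hη1 : η ≤ e / (8 * C + 8) := min_le_left _ _
  have hh3 : 3 * h < δ i := by
    have : h < δ i / 3 := by
      refine hhκ.trans_le ((min_le_right _ _).trans ?_)
      fin_cases i
      · exact min_le_left _ _
      · exact min_le_right _ _
    linarith
  have hsplit : ∀ a b, a ≤ b → (∫ y in Iic b, q i y) - ∫ y in Iic a, q i y
      = ∫ y in Ioc a b, q i y := fun a b hab => by
    rw [← Iic_union_Ioc_eq_Iic hab, setIntegral_union (by
      rw [disjoint_left]; intro x hx hx'; exact absurd hx'.1 (not_lt.2 hx)) measurableSet_Ioc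
      (hq i).integrableOn (hq i).integrableOn]
    ring
  have c1 := abs_le.1 (hcl i (2 * h))
  have c2 := abs_le.1 (hcl i (u + h))
  have c3 := abs_le.1 (hcl i (u - 2 * h))
  have c4 := abs_le.1 (hcl i u)
  have s1 := hsplit 0 (2 * h) (by linarith)
  -- There is no mass to the left of zero, so the boundary zone reduces to `(0, 2h]`.
  rw [hq0, sub_zero] at s1
  have s2 := hsplit (u - 2 * h) (u + h) (by linarith)
  have b1 := abs_le.1 (hH i 0 (2 * h) (by linarith))
  have b2 := abs_le.1 (hH i (u - 2 * h) (u + h) (by linarith))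
  have hIoc : empSub n T D i ((Ioc (u - 2 * h) (u + h)).indicator 1)
      = empSub n T D i ((Iic (u + h)).indicator 1)
        - empSub n T D i ((Iic (u - 2 * h)).indicator 1) := by
    rw [← empSub_sub]
    congr 1; ext y
    simp only [indicator_apply, mem_Ioc, mem_Iic, Pi.one_apply]
    by_cases hy1 : y ≤ u - 2 * h
    · have hy2 : y ≤ u + h := by linarith
      simp [hy1, hy2, not_lt.2 hy1]
    · simp [hy1, not_le.1 hy1]
  have main : |GHatSub k h n T D i u - empSub n T D i ((Iic u).indicator 1)|
      ≤ C * empSub n T D i ((Iic (2 * h)).indicator 1)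
        + C * empSub n T D i ((Ioc (u - 2 * h) (u + h)).indicator 1) := by
    rw [hk.GHatSub_eq hh, ← empSub_sub, ← empSub_const_mul, ← empSub_const_mul, ← empSub_add]
    exact (abs_empSub_le _).trans (empSub_mono fun y => hw h u y hh)
  have t1 : empSub n T D i ((Iic (2 * h)).indicator 1) ≤ η + e / (2 * C + 2) / 2 := by linarith
  have t2 : empSub n T D i ((Ioc (u - 2 * h) (u + h)).indicator 1)
      ≤ 2 * η + e / (2 * C + 2) / 2 := by linarith
  have hfin : C * (η + e / (2 * C + 2) / 2) + C * (2 * η + e / (2 * C + 2) / 2) + η ≤ e := by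
    have hx : e / (8 * C + 8) = e / (C + 1) / 8 := by field_simp
    have hy : e / (2 * C + 2) / 2 = e / (C + 1) / 4 := by field_simp; ring
    have hz : e / (C + 1) * C + e / (C + 1) = e := by field_simp
    rw [hx] at hη1
    rw [hy]
    have hp : 0 ≤ e / (C + 1) := by positivity
    nlinarith [mul_nonneg hC (sub_nonneg.2 hη1), mul_nonneg hC hp]
  calc |GHatSub k h n T D i u - ∫ y in Iic u, q i y|
      ≤ |GHatSub k h n T D i u - empSub n T D i ((Iic u).indicator 1)|
        + |empSub n T D i ((Iic u).indicator 1) - ∫ y in Iic u, q i y| := abs_sub_le _ _ _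
    _ ≤ C * (η + e / (2 * C + 2) / 2) + C * (2 * η + e / (2 * C + 2) / 2) + η :=
        add_le_add (main.trans (add_le_add (mul_le_mul_of_nonneg_left t1 hC)
          (mul_le_mul_of_nonneg_left t2 hC))) (hcl i u)
    _ ≤ e := hfin

end Global


/-! ### Lower convex hulls and supporting tangents -/

section Hull

/-- The half-plane above a supporting line is convex and contains the set, hence contains its hull;
nothing in the hull lies below the point of contact. -/
lemma lowerHull_eq_of_support {S : Set (ℝ × ℝ)} {x₀ y₀ a : ℝ} (hmem : (x₀, y₀) ∈ S)
    (hS : ∀ p ∈ S, y₀ + a * (p.1 - x₀) ≤ p.2) : lowerHull S x₀ = y₀ := by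
  have hconv : Convex ℝ {p : ℝ × ℝ | y₀ + a * (p.1 - x₀) ≤ p.2} := by
    intro p hp p' hp' c d hc hd hcd
    simp only [mem_ofPred_eq, Prod.fst_add, Prod.snd_add, Prod.smul_fst, Prod.smul_snd,
      smul_eq_mul] at *
    have h1 := mul_le_mul_of_nonneg_left hp hc
    have h2 := mul_le_mul_of_nonneg_left hp' hd
    have h3 : y₀ = c * y₀ + d * y₀ := by rw [← add_mul, hcd, one_mul]
    have h4 : x₀ = c * x₀ + d * x₀ := by rw [← add_mul, hcd, one_mul]
    calc y₀ + a * (c * p.1 + d * p'.1 - x₀)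
        = c * (y₀ + a * (p.1 - x₀)) + d * (y₀ + a * (p'.1 - x₀)) := by
          linear_combination h3 - a * h4
      _ ≤ _ := add_le_add h1 h2
  have hsub := convexHull_min (fun p hp => hS p hp) hconv
  have : IsLeast {y | (x₀, y) ∈ convexHull ℝ S} y₀ := by
    refine ⟨subset_convexHull ℝ S hmem, fun y hy => ?_⟩
    have : y₀ + a * (x₀ - x₀) ≤ y := hsub hy
    simpa using this
  exact this.csInf_eq

variable {k : ℝ → ℝ} {n : ℕ} {T : ℕ → ℝ} {D : ℕ → Fin 2} {h : ℝ}

lemma CondK1.GHatSub_sub (hk : CondK1 k) (hh : 0 < h) (i : Fin 2) {s u : ℝ} (hs : 0 ≤ s)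
    (hu : 0 ≤ u) : GHatSub k h n T D i u - GHatSub k h n T D i s
      = ∫ v in s..u, gHatSub k h n T D i v := by
  have hint := hk.integrable_gHatSub hh n T D i
  have h0 : ∀ x, 0 ≤ x → GHatSub k h n T D i x = ∫ v in 0..x, gHatSub k h n T D i v :=
    fun x hx => by
      rw [intervalIntegral.integral_of_le hx, GHatSub, integral_Icc_eq_integral_Ioc]
  rw [h0 u hu, h0 s hs, intervalIntegral.integral_interval_sub_left hint.intervalIntegrable
    hint.intervalIntegrable]

lemma CondK1.GHat_eq (hk : CondK1 k) (hh : 0 < h) (s : ℝ) :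
    GHat k h n T D s = GHatSub k h n T D 0 s + GHatSub k h n T D 1 s := by
  unfold GHat gHat GHatSub
  exact integral_add (hk.integrable_gHatSub hh n T D 0).integrableOn
    (hk.integrable_gHatSub hh n T D 1).integrableOn

/-- Strict differentiability is what the inverse function theorem requires in order to parametrize
the diagram by its first coordinate. -/
lemma CondK1.hasStrictDerivAt_GHatSub (hk : CondK1 k) (hh : 0 < h) (i : Fin 2) {s : ℝ}
    (hs : h < s) : HasStrictDerivAt (GHatSub k h n T D i) (gHatSub k h n T D i s) s := by
  have hint := hk.integrable_gHatSub hh n T D i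
  have h1 := intervalIntegral.integral_hasStrictDerivAt_right (a := 0) (b := s)
    hint.intervalIntegrable hint.aestronglyMeasurable.stronglyMeasurableAtFilter
    (hk.hasDerivAt_gHatSub hs).continuousAt
  refine h1.congr_of_eventuallyEq ?_
  filter_upwards [lt_mem_nhds (hh.trans hs)] with x hx
  rw [intervalIntegral.integral_of_le hx.le, GHatSub, integral_Icc_eq_integral_Ioc]

lemma CondK1.hasStrictDerivAt_GHat (hk : CondK1 k) (hh : 0 < h) {s : ℝ}
    (hs : h < s) : HasStrictDerivAt (GHat k h n T D) (gHat k h n T D s) s := by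
  refine ((hk.hasStrictDerivAt_GHatSub hh 0 hs).add
    (hk.hasStrictDerivAt_GHatSub hh 1 hs)).congr_of_eventuallyEq ?_
  exact Eventually.of_forall fun x => (hk.GHat_eq hh x).symm

/-- If the cumulative sum diagram lies above its tangents near `s`, the slope of its hull at `s`
is the slope of the diagram. -/
lemma CondK1.FMS_eq_FNaive (hk : CondK1 k) (hh : 0 < h) {c d : ℝ} (hc : h < c)
    (hd : d ≤ tau k h n T D) (hpos : ∀ s ∈ Ioo c d, 0 < gHat k h n T D s)
    (hsupp : ∀ s ∈ Ioo c d, ∀ u, 0 ≤ u →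
      GHatSub k h n T D 1 s + FNaive k h n T D s * (GHat k h n T D u - GHat k h n T D s)
        ≤ GHatSub k h n T D 1 u) {s : ℝ} (hs : s ∈ Ioo c d) :
    FMS k h n T D s = FNaive k h n T D s := by
  have hhull : ∀ s ∈ Ioo c d,
      lowerHull (ccsd k h n T D) (GHat k h n T D s) = GHatSub k h n T D 1 s := fun s hs => by
    refine lowerHull_eq_of_support (a := FNaive k h n T D s)
      ⟨s, ⟨by linarith [hs.1], hs.2.le.trans hd⟩, rfl⟩ ?_
    rintro p ⟨u, hu, rfl⟩
    exact hsupp s hs u hu.1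
  have hG := hk.hasStrictDerivAt_GHat (n := n) (T := T) (D := D) hh (hc.trans hs.1)
  have hG1 := hk.hasStrictDerivAt_GHatSub (n := n) (T := T) (D := D) hh 1 (hc.trans hs.1)
  have hne : gHat k h n T D s ≠ 0 := (hpos s hs).ne'
  -- The hull is a function of the first coordinate `Ĝ_n(s)`, so `Ĝ_n` is inverted near `s`; the
  -- hull then becomes `Ĝ_{n,1} ∘ Ĝ_n⁻¹`, whose derivative is `ĝ_{n,1} / ĝ_n`.
  set inv := hG.localInverse _ _ _ hne with hinv
  have hinvd := hG.to_localInverse hne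
  have hinvs : inv (GHat k h n T D s) = s := by
    have h1 := (hG.hasStrictFDerivAt_equiv hne).localInverse_apply_image
    exact h1
  have hright : ∀ᶠ x in 𝓝 (GHat k h n T D s), GHat k h n T D (inv x) = x :=
    (hG.hasStrictFDerivAt_equiv hne).eventually_right_inverse
  have hcont : Tendsto inv (𝓝 (GHat k h n T D s)) (𝓝 s) := by
    have := hinvd.hasDerivAt.continuousAt.tendsto
    rwa [← hinv, hinvs] at this
  have hev : lowerHull (ccsd k h n T D) =ᶠ[𝓝 (GHat k h n T D s)]
      fun x => GHatSub k h n T D 1 (inv x) := by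
    filter_upwards [hright, hcont.eventually (Ioo_mem_nhds hs.1 hs.2)] with x hx hx'
    rw [← hhull _ hx', hx]
  have hder : HasDerivAt (lowerHull (ccsd k h n T D)) (FNaive k h n T D s)
      (GHat k h n T D s) := by
    refine HasDerivAt.congr_of_eventuallyEq ?_ hev
    have h2 : HasDerivAt (GHatSub k h n T D 1) (gHatSub k h n T D 1 s)
        (inv (GHat k h n T D s)) := by rw [hinvs]; exact hG1.hasDerivAt
    have := h2.comp _ hinvd.hasDerivAt
    rwa [← div_eq_mul_inv] at this
  -- The hull has a two-sided derivative here, so the right and the left slope in the definition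
  -- agree.
  unfold FMS
  split_ifs
  · exact hder.hasDerivWithinAt.derivWithin (uniqueDiffWithinAt_Ioi _)
  · exact hder.hasDerivWithinAt.derivWithin (uniqueDiffWithinAt_Iio _)

lemma CondK1.hasDerivAt_FNaive (hk : CondK1 k) {s : ℝ} (hs : h < s)
    (hpos : gHat k h n T D s ≠ 0) :
    HasDerivAt (FNaive k h n T D) (fNaive k h n T D s) s := by
  have h0 := (hk.hasDerivAt_gHatSub (n := n) (T := T) (D := D) (i := 0) hs)
  have h1 := (hk.hasDerivAt_gHatSub (n := n) (T := T) (D := D) (i := 1) hs)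
  have := h1.div (h0.add h1) hpos
  unfold fNaive
  rw [h0.deriv, h1.deriv]
  convert! this using 1
  unfold gHat
  simp only [Pi.add_apply]
  ring

/-- The tangent condition is needed on a whole interval, not just at `s`, because `f̂^MS` is
obtained by differentiating `F̂^MS`. -/
lemma CondK1.hazardMS_eq_hazardNaive (hk : CondK1 k) (hh : 0 < h) {c d : ℝ} (hc : h < c)
    (hd : d ≤ tau k h n T D) (hpos : ∀ s ∈ Ioo c d, 0 < gHat k h n T D s)
    (hsupp : ∀ s ∈ Ioo c d, ∀ u, 0 ≤ u →
      GHatSub k h n T D 1 s + FNaive k h n T D s * (GHat k h n T D u - GHat k h n T D s)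
        ≤ GHatSub k h n T D 1 u) {s : ℝ} (hs : s ∈ Ioo c d) :
    hazardMS k h n T D s = hazardNaive k h n T D s := by
  have hev : FMS k h n T D =ᶠ[𝓝 s] FNaive k h n T D := by
    filter_upwards [Ioo_mem_nhds hs.1 hs.2] with x hx
    exact hk.FMS_eq_FNaive hh hc hd hpos hsupp hx
  unfold hazardMS hazardNaive fMS
  rw [hev.deriv_eq, hev.eq_of_nhds,
    (hk.hasDerivAt_FNaive (hc.trans hs.1) (hpos s hs).ne').deriv]

lemma CondK1.le_tau (hk : CondK1 k) (hh : 0 < h) {s : ℝ} (hs : 0 ≤ s)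
    (hpos : 0 < gHat k h n T D s) : s ≤ tau k h n T D := by
  -- Every observation lies more than a bandwidth below any larger point, so `ĝ_n` vanishes there
  -- and the supremum is over a bounded set.
  refine le_csSup ⟨∑ j ∈ Finset.range n, |T j| + h, ?_⟩ ⟨hs, hpos⟩
  rintro x ⟨-, hx⟩
  by_contra hlt
  rw [not_le] at hlt
  have hzero : ∀ i, gHatSub k h n T D i x = 0 := fun i => by
    unfold gHatSub
    rw [Finset.sum_eq_zero, mul_zero]
    intro j hj
    rw [hk.kernelAt_eq_zero]
    · simp
    · have h1 : |T j| ≤ ∑ j ∈ Finset.range n, |T j| :=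
        Finset.single_le_sum (f := fun j => |T j|) (fun j _ => abs_nonneg _) hj
      rw [abs_div, abs_of_pos hh, le_div_iff₀ hh]
      have := le_abs_self (x - T j)
      have := le_abs_self (T j)
      linarith
  simp [gHat, hzero] at hx

end Hull


/-- The density of the censoring times with status `i`. -/
def subDensity (F g : ℝ → ℝ) (i : Fin 2) (y : ℝ) : ℝ := (if i = 1 then F y else 1 - F y) * g y

/-- The derivative of `subDensity`, if `f` and `g'` are those of `F` and `g`. -/
def subDensityDeriv (F g f g' : ℝ → ℝ) (i : Fin 2) (y : ℝ) : ℝ :=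
  (if i = 1 then f y else -f y) * g y + (if i = 1 then F y else 1 - F y) * g' y

/-! ### Subdensities and the population gap above a tangent -/

section SubDensity

variable {F g f g' : ℝ → ℝ}

lemma subDensity_one (y : ℝ) : subDensity F g 1 y = F y * g y := by simp [subDensity]

lemma subDensity_zero (y : ℝ) : subDensity F g 0 y = (1 - F y) * g y := by simp [subDensity]

lemma subDensity_nonneg (hF0 : ∀ y, 0 ≤ F y) (hF1 : ∀ y, F y ≤ 1) (hg0 : ∀ y, 0 ≤ g y) (i : Fin 2)
    (y : ℝ) : 0 ≤ subDensity F g i y := by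
  unfold subDensity
  split_ifs
  · exact mul_nonneg (hF0 y) (hg0 y)
  · exact mul_nonneg (sub_nonneg.2 (hF1 y)) (hg0 y)

lemma subDensity_le (hF0 : ∀ y, 0 ≤ F y) (hF1 : ∀ y, F y ≤ 1) (hg0 : ∀ y, 0 ≤ g y) (i : Fin 2)
    (y : ℝ) : subDensity F g i y ≤ g y := by
  unfold subDensity
  split_ifs
  · exact mul_le_of_le_one_left (hg0 y) (hF1 y)
  · exact mul_le_of_le_one_left (hg0 y) (by linarith [hF0 y])

lemma integrable_subDensity (hFm : Monotone F) (hF0 : ∀ y, 0 ≤ F y) (hF1 : ∀ y, F y ≤ 1)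
    (hg : Integrable g) (hg0 : ∀ y, 0 ≤ g y) (i : Fin 2) : Integrable (subDensity F g i) := by
  have hm := hFm.measurable
  refine hg.mono' ?_ (Eventually.of_forall fun y => ?_)
  · unfold subDensity
    refine AEStronglyMeasurable.mul ?_ hg.1
    split_ifs
    · exact hm.aestronglyMeasurable
    · exact (hm.const_sub 1).aestronglyMeasurable
  · rw [Real.norm_eq_abs, abs_of_nonneg (subDensity_nonneg hF0 hF1 hg0 i y)]
    exact subDensity_le hF0 hF1 hg0 i y

lemma hasDerivAt_subDensity {y : ℝ} (hF : HasDerivAt F (f y) y) (hg : HasDerivAt g (g' y) y)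
    (i : Fin 2) : HasDerivAt (subDensity F g i) (subDensityDeriv F g f g' i y) y := by
  unfold subDensityDeriv subDensity
  split_ifs
  · exact hF.mul hg
  · exact (hF.const_sub 1).mul hg

lemma integral_Iic_sub {q : ℝ → ℝ} (hq : Integrable q) {a b : ℝ} (hab : a ≤ b) :
    (∫ y in Iic b, q y) - ∫ y in Iic a, q y = ∫ y in Ioc a b, q y := by
  rw [← Iic_union_Ioc_eq_Iic hab, setIntegral_union (by
    rw [disjoint_left]; intro x hx hx'; exact absurd hx'.1 (not_lt.2 hx)) measurableSet_Ioc
    hq.integrableOn hq.integrableOn]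
  ring

lemma setIntegral_Ioc_pos {g : ℝ → ℝ} (hg : Integrable g) {a b : ℝ} (hab : a < b)
    (hpos : ∀ y ∈ Ioc a b, 0 < g y) : 0 < ∫ y in Ioc a b, g y := by
  rw [← intervalIntegral.integral_of_le hab.le]
  exact intervalIntegral.intervalIntegral_pos_of_pos_on hg.intervalIntegrable
    (fun y hy => hpos y ⟨hy.1, hy.2.le⟩) hab

/-- The height of the population diagram above its tangent is the integral of `(F y - F s) g y` over
`(s, u]`. The integrand is nonnegative, and on `(p', b]` it is at least `(F p' - F p) g y`; this
bound does not depend on `s` or `u`. -/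
lemma support_gap_right (hFm : Monotone F) (hF0 : ∀ y, 0 ≤ F y) (hF1 : ∀ y, F y ≤ 1)
    (hg : Integrable g) (hg0 : ∀ y, 0 ≤ g y) {s p p' b u : ℝ} (hs : s ≤ p) (hp : p ≤ p')
    (hbu : b ≤ u) :
    (F p' - F p) * ∫ y in Ioc p' b, g y
      ≤ (∫ y in Ioc s u, subDensity F g 1 y)
        - F s * (∫ y in Ioc s u, (subDensity F g 0 y + subDensity F g 1 y)) := by
  have hi := integrable_subDensity hFm hF0 hF1 hg hg0 1
  have e1 : ∀ y, subDensity F g 0 y + subDensity F g 1 y = g y := fun y => by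
    rw [subDensity_zero, subDensity_one]; ring
  simp_rw [e1]
  rw [← integral_const_mul, ← integral_const_mul,
    ← integral_sub hi.integrableOn (hg.const_mul _).integrableOn]
  have hint : Integrable fun y => subDensity F g 1 y - F s * g y := hi.sub (hg.const_mul _)
  have hnn : ∀ y ∈ Ioc s u, 0 ≤ subDensity F g 1 y - F s * g y := fun y hy => by
    rw [subDensity_one, ← sub_mul]
    exact mul_nonneg (sub_nonneg.2 (hFm hy.1.le)) (hg0 y)
  calc ∫ y in Ioc p' b, (F p' - F p) * g y
      ≤ ∫ y in Ioc p' b, (subDensity F g 1 y - F s * g y) := by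
        refine setIntegral_mono_on (hg.const_mul _).integrableOn hint.integrableOn
          measurableSet_Ioc fun y hy => ?_
        rw [subDensity_one, ← sub_mul]
        exact mul_le_mul_of_nonneg_right (sub_le_sub (hFm hy.1.le) (hFm hs)) (hg0 y)
    _ ≤ _ := by
        refine setIntegral_mono_set hint.integrableOn ?_
          (Ioc_subset_Ioc (hs.trans hp) hbu).eventuallyLE
        filter_upwards [ae_restrict_mem measurableSet_Ioc] with y hy using hnn y hy

/-- The mirror image: to the left of `s` the integrand is `(F s - F y) g y`. -/
lemma support_gap_left (hFm : Monotone F) (hF0 : ∀ y, 0 ≤ F y) (hF1 : ∀ y, F y ≤ 1)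
    (hg : Integrable g) (hg0 : ∀ y, 0 ≤ g y) {s p p' b u : ℝ} (hs : p ≤ s) (hp : p' ≤ p)
    (hbu : u ≤ b) :
    (F p - F p') * ∫ y in Ioc b p', g y
      ≤ F s * (∫ y in Ioc u s, (subDensity F g 0 y + subDensity F g 1 y))
        - ∫ y in Ioc u s, subDensity F g 1 y := by
  have hi := integrable_subDensity hFm hF0 hF1 hg hg0 1
  have e1 : ∀ y, subDensity F g 0 y + subDensity F g 1 y = g y := fun y => by
    rw [subDensity_zero, subDensity_one]; ring
  simp_rw [e1]
  rw [← integral_const_mul, ← integral_const_mul,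
    ← integral_sub (hg.const_mul _).integrableOn hi.integrableOn]
  have hint : Integrable fun y => F s * g y - subDensity F g 1 y := (hg.const_mul _).sub hi
  have hnn : ∀ y ∈ Ioc u s, 0 ≤ F s * g y - subDensity F g 1 y := fun y hy => by
    rw [subDensity_one, ← sub_mul]
    exact mul_nonneg (sub_nonneg.2 (hFm hy.2)) (hg0 y)
  calc ∫ y in Ioc b p', (F p - F p') * g y
      ≤ ∫ y in Ioc b p', (F s * g y - subDensity F g 1 y) := by
        refine setIntegral_mono_on (hg.const_mul _).integrableOn hint.integrableOn
          measurableSet_Ioc fun y hy => ?_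
        rw [subDensity_one, ← sub_mul]
        exact mul_le_mul_of_nonneg_right (sub_le_sub (hFm hs) (hFm hy.2)) (hg0 y)
    _ ≤ _ := by
        refine setIntegral_mono_set hint.integrableOn ?_
          (Ioc_subset_Ioc hbu (hp.trans hs)).eventuallyLE
        filter_upwards [ae_restrict_mem measurableSet_Ioc] with y hy using hnn y hy

end SubDensity

/-! ### Coincidence of the MSLE and the naive estimator -/

section Isotonic

variable {k : ℝ → ℝ} {n : ℕ} {T : ℕ → ℝ} {D : ℕ → Fin 2} {h : ℝ}

/-- Where the naive estimator is monotone, the cumulative sum diagram lies above its tangents. -/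
lemma CondK1.support_of_monotoneOn (hk : CondK1 k) (hh : 0 < h) {a b : ℝ} (ha : h < a)
    (hpos : ∀ v ∈ Icc a b, 0 < gHat k h n T D v) (hmono : MonotoneOn (FNaive k h n T D) (Icc a b))
    {s u : ℝ} (hs : s ∈ Icc a b) (hu : u ∈ Icc a b) :
    GHatSub k h n T D 1 s + FNaive k h n T D s * (GHat k h n T D u - GHat k h n T D s)
      ≤ GHatSub k h n T D 1 u := by
  have hs0 : 0 ≤ s := by linarith [hs.1]
  have hu0 : 0 ≤ u := by linarith [hu.1]
  have hint := hk.integrable_gHatSub hh n T D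
  have hG : GHat k h n T D u - GHat k h n T D s = ∫ v in s..u, gHat k h n T D v := by
    rw [hk.GHat_eq hh, hk.GHat_eq hh]
    unfold gHat
    rw [intervalIntegral.integral_add (hint 0).intervalIntegrable (hint 1).intervalIntegrable,
      ← hk.GHatSub_sub hh 0 hs0 hu0, ← hk.GHatSub_sub hh 1 hs0 hu0]
    ring
  have hG1 := hk.GHatSub_sub (n := n) (T := T) (D := D) hh 1 hs0 hu0
  have hI : Integrable (gHat k h n T D) := (hint 0).add (hint 1)
  have hdiff : (GHatSub k h n T D 1 u - GHatSub k h n T D 1 s)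
      - FNaive k h n T D s * (GHat k h n T D u - GHat k h n T D s)
      = ∫ v in s..u, (gHatSub k h n T D 1 v - FNaive k h n T D s * gHat k h n T D v) := by
    rw [hG, hG1, intervalIntegral.integral_sub (hint 1).intervalIntegrable
      (hI.const_mul _).intervalIntegrable, intervalIntegral.integral_const_mul]
  -- This turns the height above the tangent into an integral of an increment of the naive `F`
  -- against `ĝ_n`, whose sign is that of `v - s`.
  have hform : ∀ v ∈ Icc a b, gHatSub k h n T D 1 v - FNaive k h n T D s * gHat k h n T D v
      = (FNaive k h n T D v - FNaive k h n T D s) * gHat k h n T D v := fun v hv => by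
    have := (hpos v hv).ne'
    rw [sub_mul]
    congr 1
    unfold FNaive
    field_simp
  suffices 0 ≤ ∫ v in s..u, (gHatSub k h n T D 1 v - FNaive k h n T D s * gHat k h n T D v) by
    linarith
  rcases le_total s u with hsu | hus
  · refine intervalIntegral.integral_nonneg hsu fun v hv => ?_
    have hvm : v ∈ Icc a b := ⟨hs.1.trans hv.1, hv.2.trans hu.2⟩
    rw [hform v hvm]
    exact mul_nonneg (sub_nonneg.2 (hmono hs hvm hv.1)) (hpos v hvm).le
  · rw [intervalIntegral.integral_symm, ← intervalIntegral.integral_neg]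
    refine intervalIntegral.integral_nonneg hus fun v hv => ?_
    have hvm : v ∈ Icc a b := ⟨hu.1.trans hv.1, hv.2.trans hs.2⟩
    rw [hform v hvm, ← neg_mul, neg_sub]
    exact mul_nonneg (sub_nonneg.2 (hmono hvm hs hv.2)) (hpos v hvm).le

variable {F g f g' : ℝ → ℝ}

/-- Each of the two products moves by at most `(2M + 1) e`. It will be applied to the Wronskian that
is the numerator of the naive density. -/
lemma perturb_det {x0 x1 y0 y1 X0 X1 Y0 Y1 M e : ℝ} (h0 : |x0 - X0| ≤ e) (h1 : |x1 - X1| ≤ e)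
    (h2 : |y0 - Y0| ≤ e) (h3 : |y1 - Y1| ≤ e) (hX0 : |X0| ≤ M) (hX1 : |X1| ≤ M) (hY0 : |Y0| ≤ M)
    (hY1 : |Y1| ≤ M) (he : e ≤ 1) :
    X0 * Y1 - Y0 * X1 - (4 * M + 2) * e ≤ x0 * y1 - y0 * x1 := by
  have he0 : 0 ≤ e := (abs_nonneg _).trans h0
  have hM : 0 ≤ M := (abs_nonneg _).trans hX0
  have key : ∀ {x y X Y : ℝ}, |x - X| ≤ e → |y - Y| ≤ e → |X| ≤ M → |Y| ≤ M →
      |x * y - X * Y| ≤ (2 * M + 1) * e := by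
    intro x y X Y hx hy hX hY
    have : x * y - X * Y = (x - X) * (y - Y) + (x - X) * Y + X * (y - Y) := by ring
    rw [this]
    have a1 : |(x - X) * (y - Y)| ≤ e * 1 := by
      rw [abs_mul]; exact mul_le_mul hx (hy.trans he) (abs_nonneg _) he0
    have a2 : |(x - X) * Y| ≤ e * M := by
      rw [abs_mul]; exact mul_le_mul hx hY (abs_nonneg _) he0
    have a3 : |X * (y - Y)| ≤ M * e := by
      rw [abs_mul]; exact mul_le_mul hX hy (abs_nonneg _) hM
    have := abs_add_three ((x - X) * (y - Y)) ((x - X) * Y) (X * (y - Y))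
    linarith
  have k1 := abs_le.1 (key h0 h3 hX0 hY1)
  have k2 := abs_le.1 (key h2 h1 hY0 hX1)
  linarith [k1.1, k2.2]

set_option maxHeartbeats 1000000 in
/-- With bandwidth `h` and an empirical distribution within `O(h²)` of the model, the maximum
smoothed likelihood estimator and the naive estimator coincide near `t`. -/
theorem CondK1.exists_hazardMS_eq (hk : CondK1 k) (hFm : Monotone F) (hF0 : ∀ y, 0 ≤ F y)
    (hF1 : ∀ y, F y ≤ 1) (hg : Integrable g) (hg0 : ∀ y, 0 ≤ g y) (hg1 : ∫ y, g y = 1)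
    (hgneg : ∫ y in Iic 0, g y = 0) {t r : ℝ} (hr : 0 < r) (hrt : 5 * r < t)
    (hFd : ∀ y ∈ Icc (t - 5 * r) (t + 5 * r), HasDerivAt F (f y) y)
    (hgd : ∀ y ∈ Icc (t - 5 * r) (t + 5 * r), HasDerivAt g (g' y) y)
    (hfc : ContinuousOn f (Icc (t - 5 * r) (t + 5 * r)))
    (hgc : ContinuousOn g' (Icc (t - 5 * r) (t + 5 * r)))
    (hfpos : ∀ y ∈ Icc (t - 5 * r) (t + 5 * r), 0 < f y)
    (hgpos : ∀ y ∈ Icc (t - 5 * r) (t + 5 * r), 0 < g y) :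
    ∃ κ > 0, ∀ h, 0 < h → h < κ → ∀ n T D, IsClose (subDensity F g) n T D (κ * h ^ 2) →
      hazardMS k h n T D t = hazardNaive k h n T D t := by
  set J := Icc (t - 5 * r) (t + 5 * r) with hJ
  set q := subDensity F g with hq
  set q' := subDensityDeriv F g f g' with hq'
  have hqi : ∀ i, Integrable (q i) := integrable_subDensity hFm hF0 hF1 hg hg0
  have hqneg : ∀ i, ∫ y in Iic 0, q i y = 0 := fun i => by
    refine le_antisymm ?_ (integral_nonneg fun y => subDensity_nonneg hF0 hF1 hg0 i y)
    exact (setIntegral_mono (hqi i).integrableOn hg.integrableOn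
      fun y => subDensity_le hF0 hF1 hg0 i y).trans_eq hgneg
  have hqd : ∀ i, ∀ y ∈ J, HasDerivAt (q i) (q' i y) y := fun i y hy =>
    hasDerivAt_subDensity (hFd y hy) (hgd y hy) i
  have hFcont : ContinuousOn F J := fun y hy => (hFd y hy).continuousAt.continuousWithinAt
  have hgcont : ContinuousOn g J := fun y hy => (hgd y hy).continuousAt.continuousWithinAt
  have hqc : ∀ i, ContinuousOn (q i) J := fun i y hy =>
    (hqd i y hy).continuousAt.continuousWithinAt
  have hqc' : ∀ i, ContinuousOn (q' i) J := fun i => by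
    rw [hq']
    unfold subDensityDeriv
    split_ifs <;> fun_prop
  have hJc : IsCompact J := isCompact_Icc
  have htJ : t ∈ J := ⟨by linarith, by linarith⟩
  obtain ⟨γ, hγ, hγg⟩ : ∃ γ > 0, ∀ y ∈ J, γ ≤ g y := by
    obtain ⟨y0, hy0, hmin⟩ := hJc.exists_isMinOn ⟨t, htJ⟩ hgcont
    exact ⟨g y0, hgpos y0 hy0, fun y hy => hmin hy⟩
  -- The numerator of the naive density estimates the Wronskian of the subdensities, in which the
  -- terms with `g'` cancel and leave `f g²`.
  obtain ⟨ν, hν, hνN⟩ : ∃ ν > 0, ∀ y ∈ J, ν ≤ q 0 y * q' 1 y - q' 0 y * q 1 y := by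
    have hN : ∀ y, q 0 y * q' 1 y - q' 0 y * q 1 y = f y * g y ^ 2 := fun y => by
      simp only [hq, hq', subDensity, subDensityDeriv, Fin.isValue, zero_ne_one, if_true, if_false]
      ring
    simp_rw [hN]
    have hc : ContinuousOn (fun y => f y * g y ^ 2) J := by fun_prop
    obtain ⟨y0, hy0, hmin⟩ := hJc.exists_isMinOn ⟨t, htJ⟩ hc
    exact ⟨_, mul_pos (hfpos y0 hy0) (pow_pos (hgpos y0 hy0) 2), fun y hy => hmin hy⟩
  obtain ⟨M, hM0, hM⟩ : ∃ M, 0 ≤ M ∧ ∀ i, ∀ y ∈ J, |q i y| ≤ M ∧ |q' i y| ≤ M := by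
    choose A hA using fun i => hJc.exists_bound_of_continuousOn (hqc i)
    choose B hB using fun i => hJc.exists_bound_of_continuousOn (hqc' i)
    refine ⟨|A 0| + |A 1| + |B 0| + |B 1|, by positivity, fun i y hy => ?_⟩
    have h1 := hA i y hy
    have h2 := hB i y hy
    rw [Real.norm_eq_abs] at h1 h2
    have p1 := abs_nonneg (A 0)
    have p2 := abs_nonneg (A 1)
    have p3 := abs_nonneg (B 0)
    have p4 := abs_nonneg (B 1)
    have p5 := le_abs_self (A 0)
    have p6 := le_abs_self (A 1)
    have p7 := le_abs_self (B 0)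
    have p8 := le_abs_self (B 1)
    fin_cases i <;> simp only [Fin.zero_eta, Fin.mk_one] at h1 h2 ⊢ <;>
      constructor <;> linarith
  have hFstrict : ∀ x ∈ J, ∀ y ∈ J, x < y → F x < F y := by
    have : StrictMonoOn F J := by
      refine strictMonoOn_of_deriv_pos (convex_Icc _ _) hFcont fun x hx => ?_
      rw [(hFd x (interior_subset hx)).deriv]
      exact hfpos x (interior_subset hx)
    exact fun x hx y hy hxy => this hx hy hxy
  have mJ : ∀ x, t - 5 * r ≤ x → x ≤ t + 5 * r → x ∈ J := fun x h1 h2 => ⟨h1, h2⟩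
  -- Nested windows around `t`: tangent points `s` range within `2r`, the increment of `F` is taken
  -- between `2r` and `3r`, the mass of `g` between `3r` and `4r`. Any `u` beyond `4r` thus clears
  -- the tangent by at least `cR` or `cL`.
  set cR := (F (t + 3 * r) - F (t + 2 * r)) * ∫ y in Ioc (t + 3 * r) (t + 4 * r), g y with hcR
  set cL := (F (t - 2 * r) - F (t - 3 * r)) * ∫ y in Ioc (t - 4 * r) (t - 3 * r), g y with hcL
  have hcR0 : 0 < cR := mul_pos (sub_pos.2 (hFstrict _ (mJ _ (by linarith) (by linarith)) _
    (mJ _ (by linarith) (by linarith)) (by linarith))) (setIntegral_Ioc_pos hg (by linarith)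
    fun y hy => hgpos y (mJ _ (by linarith [hy.1]) (by linarith [hy.2])))
  have hcL0 : 0 < cL := mul_pos (sub_pos.2 (hFstrict _ (mJ _ (by linarith) (by linarith)) _
    (mJ _ (by linarith) (by linarith)) (by linarith))) (setIntegral_Ioc_pos hg (by linarith)
    fun y hy => hgpos y (mJ _ (by linarith [hy.1]) (by linarith [hy.2])))
  -- The size of `e`: `4e ≤ γ` keeps `ĝ_n` above `γ / 2`; `(4M + 2) e < ν` keeps the Wronskian
  -- positive; `6e + 6e / γ` is the total error against the gap, namely `4e` from `Ĝ_n`, `2e` from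
  -- `Ĝ_{n,1}` and `6e / γ` from the slope.
  obtain ⟨e, he, he1, heγ, heν, heR, heL⟩ : ∃ e : ℝ, 0 < e ∧ e ≤ 1 ∧ 4 * e ≤ γ ∧
      (4 * M + 2) * e < ν ∧ 6 * e + 6 * e / γ < cR ∧ 6 * e + 6 * e / γ < cL := by
    have hev : ∀ᶠ e in 𝓝 (0 : ℝ), e < 1 ∧ 4 * e < γ ∧ (4 * M + 2) * e < ν ∧
        6 * e + 6 * e / γ < cR ∧ 6 * e + 6 * e / γ < cL := by
      have hz : ∀ φ : ℝ → ℝ, Continuous φ → φ 0 = 0 → ∀ x : ℝ, 0 < x → ∀ᶠ e in 𝓝 (0 : ℝ), φ e < x :=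
        fun φ hφ h0 x hx => (h0 ▸ hφ.tendsto 0).eventually_lt_const hx
      exact (hz _ continuous_id rfl _ one_pos).and ((hz _ (by fun_prop) (by simp) _ hγ).and
        ((hz _ (by fun_prop) (by simp) _ hν).and ((hz _ (by fun_prop) (by simp) _ hcR0).and
        (hz _ (by fun_prop) (by simp) _ hcL0))))
    obtain ⟨e, ⟨h1, h2, h3, h4, h5⟩, h0⟩ :=
      ((hev.filter_mono (nhdsWithin_le_nhds (s := Ioi 0))).and self_mem_nhdsWithin).exists
    exact ⟨e, h0, h1.le, h2.le, h3, h4, h5⟩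
  obtain ⟨κ₁, hκ₁, hκ₁', H₁⟩ := hk.exists_gHatSub_sub_le hqi (a := t - 4 * r) (b := t + 4 * r)
    (a' := t - 5 * r) (b' := t + 5 * r) (by linarith) (by linarith) (by linarith) hqd hqc' he
  obtain ⟨κ₂, hκ₂, H₂⟩ := hk.exists_GHatSub_sub_le hqi hqneg he
  refine ⟨min κ₁ (min κ₂ 1), by positivity, fun h hh hhκ n T D hcl => ?_⟩
  set κ := min κ₁ (min κ₂ 1) with hκdef
  have hκa : κ ≤ κ₁ := min_le_left _ _
  have hκb : κ ≤ κ₂ := (min_le_right _ _).trans (min_le_left _ _)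
  have hκc : κ ≤ 1 := (min_le_right _ _).trans (min_le_right _ _)
  have hκ0 : 0 < κ := by positivity
  have h1 := H₁ h hh (by linarith) n T D fun i x =>
    (hcl i x).trans (mul_le_mul_of_nonneg_right hκa (sq_nonneg h))
  have h2 := H₂ h hh (by linarith) n T D fun i x => (hcl i x).trans (by
    have : h ^ 2 ≤ 1 := pow_le_one₀ hh.le (by linarith)
    nlinarith)
  have hht : h < t - 4 * r := by linarith
  set K := Icc (t - 4 * r) (t + 4 * r) with hK
  have hKJ : K ⊆ J := Icc_subset_Icc (by linarith) (by linarith)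
  have hsum : ∀ y, q 0 y + q 1 y = g y := fun y => by
    rw [hq, subDensity_zero, subDensity_one]; ring
  have hge : ∀ s ∈ K, γ / 2 ≤ gHat k h n T D s := fun s hs => by
    have a0 := abs_le.1 (h1 0 s hs).1
    have a1 := abs_le.1 (h1 1 s hs).1
    have := hγg s (hKJ hs)
    have := hsum s
    unfold gHat
    linarith [a0.1, a1.1]
  have hpos : ∀ s ∈ K, 0 < gHat k h n T D s := fun s hs => by linarith [hge s hs]
  have hnum : ∀ s ∈ K, 0 < fNaive k h n T D s := fun s hs => by
    unfold fNaive
    refine div_pos ?_ (pow_pos (hpos s hs) 2)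
    have := perturb_det (h1 0 s hs).1 (h1 1 s hs).1 (h1 0 s hs).2 (h1 1 s hs).2
      (hM 0 s (hKJ hs)).1 (hM 1 s (hKJ hs)).1 (hM 0 s (hKJ hs)).2 (hM 1 s (hKJ hs)).2 he1
    have := hνN s (hKJ hs)
    unfold gHat
    linarith
  have hder : ∀ s ∈ K, HasDerivAt (FNaive k h n T D) (fNaive k h n T D s) s := fun s hs =>
    hk.hasDerivAt_FNaive (hht.trans_le hs.1) (hpos s hs).ne'
  have hmono : MonotoneOn (FNaive k h n T D) K := by
    refine (strictMonoOn_of_deriv_pos (convex_Icc _ _)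
      (fun s hs => (hder s hs).continuousAt.continuousWithinAt) fun x hx => ?_).monotoneOn
    rw [(hder x (interior_subset hx)).deriv]
    exact hnum x (interior_subset hx)
  have hnaive : ∀ s ∈ K, 0 ≤ FNaive k h n T D s ∧ FNaive k h n T D s ≤ 1 ∧
      |FNaive k h n T D s - F s| ≤ 6 * e / γ := fun s hs => by
    have n0 := hk.gHatSub_nonneg (n := n) (T := T) (D := D) (i := 0) hh (hht.trans_le hs.1)
    have n1 := hk.gHatSub_nonneg (n := n) (T := T) (D := D) (i := 1) hh (hht.trans_le hs.1)
    have hp := hpos s hs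
    refine ⟨div_nonneg n1 hp.le, (div_le_one hp).2 (by unfold gHat; linarith), ?_⟩
    have : FNaive k h n T D s - F s
        = (gHatSub k h n T D 1 s - F s * gHat k h n T D s) / gHat k h n T D s := by
      unfold FNaive
      field_simp
    rw [this, abs_div, abs_of_pos hp, div_le_div_iff₀ hp hγ]
    have a0 := abs_le.1 (h1 0 s hs).1
    have a1 := abs_le.1 (h1 1 s hs).1
    have hb : |gHatSub k h n T D 1 s - F s * gHat k h n T D s| ≤ 3 * e := by
      have : gHatSub k h n T D 1 s - F s * gHat k h n T D s
          = (1 - F s) * (gHatSub k h n T D 1 s - q 1 s)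
            - F s * (gHatSub k h n T D 0 s - q 0 s) := by
        rw [hq, subDensity_zero, subDensity_one]
        unfold gHat
        ring
      rw [this]
      have b1 : |(1 - F s) * (gHatSub k h n T D 1 s - q 1 s)| ≤ 1 * e := by
        rw [abs_mul]
        refine mul_le_mul ?_ (h1 1 s hs).1 (abs_nonneg _) zero_le_one
        rw [abs_of_nonneg (sub_nonneg.2 (hF1 s))]
        linarith [hF0 s]
      have b2 : |F s * (gHatSub k h n T D 0 s - q 0 s)| ≤ 1 * e := by
        rw [abs_mul]
        refine mul_le_mul ?_ (h1 0 s hs).1 (abs_nonneg _) zero_le_one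
        rw [abs_of_nonneg (hF0 s)]
        exact hF1 s
      have := abs_sub ((1 - F s) * (gHatSub k h n T D 1 s - q 1 s))
        (F s * (gHatSub k h n T D 0 s - q 0 s))
      linarith
    calc |gHatSub k h n T D 1 s - F s * gHat k h n T D s| * γ ≤ 3 * e * γ :=
          mul_le_mul_of_nonneg_right hb hγ.le
      _ = 6 * e * (γ / 2) := by ring
      _ ≤ 6 * e * gHat k h n T D s := mul_le_mul_of_nonneg_left (hge s hs) (by positivity)
  have hgle : ∀ a b : ℝ, ∫ y in Ioc a b, (q 0 y + q 1 y) ≤ 1 := fun a b => by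
    simp_rw [hsum]
    rw [← hg1]
    exact setIntegral_le_integral hg (Eventually.of_forall hg0)
  have hgge : ∀ a b : ℝ, 0 ≤ ∫ y in Ioc a b, (q 0 y + q 1 y) := fun a b => by
    simp_rw [hsum]
    exact integral_nonneg hg0
  have hinc : ∀ i, ∀ a b, a ≤ b → |GHatSub k h n T D i b - GHatSub k h n T D i a
      - ∫ y in Ioc a b, q i y| ≤ 2 * e := fun i a b hab => by
    rw [← integral_Iic_sub (hqi i) hab]
    have a0 := abs_le.1 (h2 i a)
    have a1 := abs_le.1 (h2 i b)
    rw [abs_le]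
    constructor <;> linarith [a0.1, a0.2, a1.1, a1.2]
  have hadd : ∀ a b : ℝ, ∫ y in Ioc a b, (q 0 y + q 1 y)
      = (∫ y in Ioc a b, q 0 y) + ∫ y in Ioc a b, q 1 y := fun a b =>
    integral_add (hqi 0).integrableOn (hqi 1).integrableOn
  refine hk.hazardMS_eq_hazardNaive hh (c := t - 2 * r) (d := t + 2 * r) (by linarith)
    (hk.le_tau hh (by linarith) (hpos _ ⟨by linarith, by linarith⟩))
    (fun s hs => hpos s ⟨by linarith [hs.1], by linarith [hs.2]⟩) ?_ ⟨by linarith, by linarith⟩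
  intro s hs u hu
  have hsK : s ∈ K := ⟨by linarith [hs.1], by linarith [hs.2]⟩
  obtain ⟨ha0, ha1, haF⟩ := hnaive s hsK
  set a := FNaive k h n T D s with hadef
  -- Within the window, monotonicity of the naive `F` gives the tangent bound; outside it, the
  -- population gap absorbs the estimation errors.
  by_cases huK : u ∈ K
  · exact hk.support_of_monotoneOn hh hht hpos hmono hsK huK
  have haF' := abs_le.1 haF
  rw [hk.GHat_eq hh, hk.GHat_eq hh]
  rcases le_or_gt (t - 4 * r) u with hul | hul
  · have hur : t + 4 * r < u := by
      by_contra hcon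
      exact huK ⟨hul, not_lt.1 hcon⟩
    have hsu : s ≤ u := by linarith [hs.2]
    have gap := support_gap_right (s := s) (p := t + 2 * r) (p' := t + 3 * r) (b := t + 4 * r)
      (u := u) hFm hF0 hF1 hg hg0 hs.2.le (by linarith) hur.le
    have i0 := abs_le.1 (hinc 0 s u hsu)
    have i1 := abs_le.1 (hinc 1 s u hsu)
    have w1 := hgle s u
    have w0 := hgge s u
    rw [← hq, ← hcR] at gap
    set W := ∫ y in Ioc s u, (q 0 y + q 1 y) with hW
    have z1 : (a - F s) * W ≤ 6 * e / γ := by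
      have : 0 ≤ 6 * e / γ := by positivity
      nlinarith [haF'.2]
    have z2 : GHatSub k h n T D 0 u + GHatSub k h n T D 1 u
        - (GHatSub k h n T D 0 s + GHatSub k h n T D 1 s) ≤ W + 4 * e := by
      rw [hW, hadd]; linarith [i0.2, i1.2]
    have z3 := mul_le_mul_of_nonneg_left z2 ha0
    have z4 : a * e ≤ 1 * e := mul_le_mul_of_nonneg_right ha1 he.le
    have z5 := i1.1
    linarith only [z1, z3, z4, z5, gap, heR]
  · have hus : u ≤ s := by linarith [hs.1]
    have gap := support_gap_left (s := s) (p := t - 2 * r) (p' := t - 3 * r) (b := t - 4 * r)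
      (u := u) hFm hF0 hF1 hg hg0 hs.1.le (by linarith) hul.le
    have i0 := abs_le.1 (hinc 0 u s hus)
    have i1 := abs_le.1 (hinc 1 u s hus)
    have w1 := hgle u s
    have w0 := hgge u s
    rw [← hq, ← hcL] at gap
    set W := ∫ y in Ioc u s, (q 0 y + q 1 y) with hW
    have z1 : (F s - a) * W ≤ 6 * e / γ := by
      have : 0 ≤ 6 * e / γ := by positivity
      nlinarith [haF'.1]
    have z2 : W - 4 * e ≤ GHatSub k h n T D 0 s + GHatSub k h n T D 1 s
        - (GHatSub k h n T D 0 u + GHatSub k h n T D 1 u) := by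
      rw [hW, hadd]; linarith [i0.1, i1.1]
    have z3 := mul_le_mul_of_nonneg_left z2 ha0
    have z4 : a * e ≤ 1 * e := mul_le_mul_of_nonneg_right ha1 he.le
    have z5 := i1.2
    linarith only [z1, z3, z4, z5, gap, heL]

end Isotonic


/-! ### Independence, Chebyshev bounds and a triangular central limit theorem -/

section IID

variable {Ω : Type*} [MeasurableSpace Ω] {μ : Measure Ω} [IsProbabilityMeasure μ]

/-- Rectangle events form a π-system generating the σ-algebra of each pair. On finite intersections
of them the probability factors, first between the two sequences and then within each. -/
lemma iIndepFun_prodMk_of_measurable {β γ : Type*} [MeasurableSpace β] [MeasurableSpace γ]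
    {X : ℕ → Ω → β} {T : ℕ → Ω → γ} (mX : ∀ i, Measurable (X i)) (mT : ∀ i, Measurable (T i))
    (hX : iIndepFun X μ) (hT : iIndepFun T μ)
    (hXT : IndepFun (fun ω i => X i ω) (fun ω i => T i ω) μ) :
    iIndepFun (fun i ω => (X i ω, T i ω)) μ := by
  rw [iIndepFun_iff_iIndep]
  refine iIndepSets.iIndep (fun i => ((mX i).prodMk (mT i)).comap_le)
    (fun i => {s | ∃ A B, MeasurableSet A ∧ MeasurableSet B ∧ s = X i ⁻¹' A ∩ T i ⁻¹' B})
    (fun i => ?_) (fun i => ?_) ?_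
  · rintro _ ⟨A, B, hA, hB, rfl⟩ _ ⟨A', B', hA', hB', rfl⟩ -
    refine ⟨A ∩ A', B ∩ B', hA.inter hA', hB.inter hB', ?_⟩
    ext; simp only [mem_inter_iff, mem_preimage]; tauto
  · change MeasurableSpace.comap (fun ω => (X i ω, T i ω)) Prod.instMeasurableSpace = _
    rw [← generateFrom_prod, MeasurableSpace.comap_generateFrom]
    congr 1
    ext s
    constructor
    · rintro ⟨_, ⟨A, hA, B, hB, rfl⟩, rfl⟩
      exact ⟨A, B, hA, hB, by ext; simp⟩
    · rintro ⟨A, B, hA, hB, rfl⟩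
      exact ⟨A ×ˢ B, ⟨A, hA, B, hB, rfl⟩, by ext; simp⟩
  · rw [iIndepSets_iff]
    intro S f hf
    have hf' : ∀ i, ∃ A B, MeasurableSet A ∧ MeasurableSet B ∧
        (i ∈ S → f i = X i ⁻¹' A ∩ T i ⁻¹' B) := fun i => by
      by_cases hi : i ∈ S
      · obtain ⟨A, B, hA, hB, h⟩ := hf i hi
        exact ⟨A, B, hA, hB, fun _ => h⟩
      · exact ⟨∅, ∅, .empty, .empty, fun h => absurd h hi⟩
    choose A B hA hB hfe using hf'
    have hint : ∀ S' : Finset ℕ, μ ((⋂ i ∈ S', X i ⁻¹' A i) ∩ ⋂ i ∈ S', T i ⁻¹' B i)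
        = (∏ i ∈ S', μ (X i ⁻¹' A i)) * ∏ i ∈ S', μ (T i ⁻¹' B i) := fun S' => by
      have e1 : (⋂ i ∈ S', X i ⁻¹' A i)
          = (fun ω i => X i ω) ⁻¹' {x | ∀ i ∈ S', x i ∈ A i} := by ext; simp
      have e2 : (⋂ i ∈ S', T i ⁻¹' B i)
          = (fun ω i => T i ω) ⁻¹' {x | ∀ i ∈ S', x i ∈ B i} := by ext; simp
      have m1 : MeasurableSet {x : ℕ → β | ∀ i ∈ S', x i ∈ A i} := by
        have : {x : ℕ → β | ∀ i ∈ S', x i ∈ A i} = ⋂ i ∈ S', (fun x => x i) ⁻¹' A i := by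
          ext; simp
        rw [this]
        exact S'.measurableSet_biInter fun i _ => measurable_pi_apply i (hA i)
      have m2 : MeasurableSet {x : ℕ → γ | ∀ i ∈ S', x i ∈ B i} := by
        have : {x : ℕ → γ | ∀ i ∈ S', x i ∈ B i} = ⋂ i ∈ S', (fun x => x i) ⁻¹' B i := by
          ext; simp
        rw [this]
        exact S'.measurableSet_biInter fun i _ => measurable_pi_apply i (hB i)
      rw [← hX.measure_inter_preimage_eq_mul S' fun i _ => hA i,
        ← hT.measure_inter_preimage_eq_mul S' fun i _ => hB i, e1, e2]
      exact hXT.measure_inter_preimage_eq_mul _ _ m1 m2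
    have hpre : ∀ i ∈ S, μ (f i) = μ (X i ⁻¹' A i) * μ (T i ⁻¹' B i) := fun i hi => by
      have := hint {i}
      simpa [hfe i hi] using this
    have hinter : (⋂ i ∈ S, f i) = (⋂ i ∈ S, X i ⁻¹' A i) ∩ ⋂ i ∈ S, T i ⁻¹' B i := by
      ext ω
      simp only [mem_iInter, mem_inter_iff]
      constructor
      · intro h
        exact ⟨fun i hi => ((hfe i hi) ▸ h i hi : ω ∈ X i ⁻¹' A i ∩ T i ⁻¹' B i).1,
          fun i hi => ((hfe i hi) ▸ h i hi : ω ∈ X i ⁻¹' A i ∩ T i ⁻¹' B i).2⟩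
      · rintro ⟨h1, h2⟩ i hi
        rw [hfe i hi]
        exact ⟨h1 i hi, h2 i hi⟩
    rw [hinter, hint, ← Finset.prod_mul_distrib]
    exact Finset.prod_congr rfl fun i hi => (hpre i hi).symm

/-- The variables of the model are only almost everywhere measurable, so the argument runs on
measurable modifications. -/
lemma iIndepFun_prodMk {β γ : Type*} [MeasurableSpace β] [MeasurableSpace γ]
    {X : ℕ → Ω → β} {T : ℕ → Ω → γ} (mX : ∀ i, AEMeasurable (X i) μ)
    (mT : ∀ i, AEMeasurable (T i) μ) (hX : iIndepFun X μ) (hT : iIndepFun T μ)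
    (hXT : IndepFun (fun ω i => X i ω) (fun ω i => T i ω) μ) :
    iIndepFun (fun i ω => (X i ω, T i ω)) μ := by
  have eX : ∀ i, X i =ᵐ[μ] (mX i).mk := fun i => (mX i).ae_eq_mk
  have eT : ∀ i, T i =ᵐ[μ] (mT i).mk := fun i => (mT i).ae_eq_mk
  have h := iIndepFun_prodMk_of_measurable (fun i => (mX i).measurable_mk)
    (fun i => (mT i).measurable_mk) (hX.congr eX) (hT.congr eT)
    (hXT.congr (by filter_upwards [ae_all_iff.2 eX] with ω h; funext i; exact h i)
      (by filter_upwards [ae_all_iff.2 eT] with ω h; funext i; exact h i))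
  refine h.congr fun i => ?_
  filter_upwards [eX i, eT i] with ω h1 h2
  rw [h1, h2]

variable {E : Type*} [MeasurableSpace E] {W : ℕ → Ω → E} {ρ : Measure E}

lemma memLp_comp_of_bounded {φ : E → ℝ} (hφ : Measurable φ) {C : ℝ} (hC : ∀ x, |φ x| ≤ C)
    {w : Ω → E} (hw : HasLaw w ρ μ) : MemLp (fun ω => φ (w ω)) 2 μ :=
  MemLp.of_bound (hφ.comp_aemeasurable hw.aemeasurable).aestronglyMeasurable C
    (Eventually.of_forall fun _ => hC _)

lemma integral_comp_hasLaw {Ω' : Type*} [MeasurableSpace Ω'] {μ' : Measure Ω'} {φ : E → ℝ}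
    (hφ : Measurable φ) {w : Ω' → E} (hw : HasLaw w ρ μ') : ∫ ω, φ (w ω) ∂μ' = ∫ x, φ x ∂ρ := by
  rw [← hw.map_eq, integral_map hw.aemeasurable hφ.aestronglyMeasurable]

lemma measure_mean_sub_ge_le (hW : ∀ j, HasLaw (W j) ρ μ) (hI : iIndepFun W μ) {φ : E → ℝ}
    (hφ : Measurable φ) {C : ℝ} (hC : ∀ x, |φ x| ≤ C) {n : ℕ} (hn : 0 < n) {c : ℝ} (hc : 0 < c) :
    μ {ω | c ≤ |(1 / (n : ℝ)) * ∑ j ∈ Finset.range n, φ (W j ω) - ∫ x, φ x ∂ρ|}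
      ≤ ENNReal.ofReal ((∫ x, φ x ^ 2 ∂ρ) / (n * c ^ 2)) := by
  have hL : ∀ j, MemLp (fun ω => φ (W j ω)) 2 μ := fun j => memLp_comp_of_bounded hφ hC (hW j)
  have hn' : (0 : ℝ) < n := by exact_mod_cast hn
  have hmean : μ[fun ω => (1 / (n : ℝ)) * ∑ j ∈ Finset.range n, φ (W j ω)] = ∫ x, φ x ∂ρ := by
    rw [integral_const_mul, integral_finsetSum _ fun j _ => (hL j).integrable (by norm_num)]
    simp_rw [integral_comp_hasLaw hφ (hW _)]
    simp
    field_simp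
  have hsum : MemLp (fun ω => ∑ j ∈ Finset.range n, φ (W j ω)) 2 μ :=
    memLp_finsetSum _ fun j _ => hL j
  have hch := meas_ge_le_variance_div_sq (hsum.const_mul (1 / (n : ℝ))) hc
  rw [hmean] at hch
  refine hch.trans (ENNReal.ofReal_le_ofReal ?_)
  have hvar : variance (fun ω => ∑ j ∈ Finset.range n, φ (W j ω)) μ ≤ n * ∫ x, φ x ^ 2 ∂ρ := by
    have h1 := IndepFun.variance_sum (μ := μ) (X := fun j ω => φ (W j ω)) (s := Finset.range n)
      (fun j _ => hL j) (fun i _ j _ hij => (hI.indepFun hij).comp hφ hφ)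
    have h2 : (∑ j ∈ Finset.range n, fun ω => φ (W j ω))
        = fun ω => ∑ j ∈ Finset.range n, φ (W j ω) := by ext; simp
    rw [h2] at h1
    rw [h1]
    calc ∑ j ∈ Finset.range n, variance (fun ω => φ (W j ω)) μ
        ≤ ∑ j ∈ Finset.range n, ∫ x, φ x ^ 2 ∂ρ := by
          refine Finset.sum_le_sum fun j _ => ?_
          refine (variance_le_expectation_sq (hL j).1).trans_eq ?_
          exact integral_comp_hasLaw (hφ.pow_const 2) (hW j)
      _ = _ := by simp
  rw [variance_const_mul, div_le_div_iff₀ (by positivity) (by positivity)]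
  have hI0 : 0 ≤ ∫ x, φ x ^ 2 ∂ρ := integral_nonneg fun x => sq_nonneg _
  calc (1 / (n : ℝ)) ^ 2 * variance (fun ω => ∑ j ∈ Finset.range n, φ (W j ω)) μ * (n * c ^ 2)
      ≤ (1 / (n : ℝ)) ^ 2 * (n * ∫ x, φ x ^ 2 ∂ρ) * (n * c ^ 2) := by gcongr
    _ = (∫ x, φ x ^ 2 ∂ρ) * c ^ 2 := by field_simp

/-- Chebyshev for the fluctuation plus convergence of the mean. The deterministic `d n` allows a
centring that may diverge together with the scaling. -/
lemma tendstoInMeasure_mean (hW : ∀ j, HasLaw (W j) ρ μ) (hI : iIndepFun W μ) {φ : ℕ → E → ℝ}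
    (hφ : ∀ n, Measurable (φ n)) (hC : ∀ n, ∃ C, ∀ x, |φ n x| ≤ C) {L : ℝ} {d : ℕ → ℝ}
    (hmean : Tendsto (fun n => ∫ x, φ n x ∂ρ + d n) atTop (𝓝 L))
    (hvar : Tendsto (fun n : ℕ => (∫ x, φ n x ^ 2 ∂ρ) / n) atTop (𝓝 0)) :
    TendstoInMeasure μ
      (fun (n : ℕ) ω => (1 / (n : ℝ)) * ∑ j ∈ Finset.range n, φ n (W j ω) + d n) atTop
      (fun _ => L) := by
  rw [tendstoInMeasure_iff_norm]
  intro ε hε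
  have hlim : Tendsto (fun n : ℕ => ENNReal.ofReal ((∫ x, φ n x ^ 2 ∂ρ) / (n * (ε / 2) ^ 2))) atTop
      (𝓝 0) := by
    rw [← ENNReal.ofReal_zero]
    refine ENNReal.tendsto_ofReal ?_
    have := hvar.div_const ((ε / 2) ^ 2)
    rw [zero_div] at this
    refine this.congr fun n => ?_
    rw [div_div]
  refine tendsto_of_tendsto_of_tendsto_of_le_of_le' tendsto_const_nhds hlim
    (Eventually.of_forall fun _ => zero_le) ?_
  have hnear : ∀ᶠ n in atTop, |(∫ x, φ n x ∂ρ) + d n - L| < ε / 2 := by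
    have := Metric.tendsto_nhds.1 hmean (ε / 2) (by positivity)
    simpa only [Real.dist_eq] using this
  filter_upwards [hnear, eventually_gt_atTop 0] with n hn hn0
  obtain ⟨C, hC⟩ := hC n
  refine (measure_mono fun ω hω => ?_).trans
    (measure_mean_sub_ge_le hW hI (hφ n) hC hn0 (half_pos hε))
  have hω' : ε ≤ |(1 / (n : ℝ)) * ∑ j ∈ Finset.range n, φ n (W j ω) + d n - L| := hω
  have h3 := abs_sub_le ((1 / (n : ℝ)) * ∑ j ∈ Finset.range n, φ n (W j ω) + d n)
    (∫ x, φ n x ∂ρ + d n) L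
  rw [add_sub_add_right_eq_sub] at h3
  change ε / 2 ≤ _
  linarith

/-- Second order Taylor expansion of the exponential, integrated. In the cubic remainder one factor
`|φ|` is replaced by its bound `M`, so the error is small relative to the second moment; no third
moment condition is needed. -/
lemma norm_charFun_sub_le [IsProbabilityMeasure ρ] {φ : E → ℝ} (hφ : Measurable φ)
    {M : ℝ} (hM : ∀ x, |φ x| ≤ M)
    (h0 : ∫ x, φ x ∂ρ = 0) (s : ℝ) (hs : |s| * M ≤ 1) :
    ‖charFun (ρ.map φ) s - 1 + ((s ^ 2 / 2 * ∫ x, φ x ^ 2 ∂ρ : ℝ) : ℂ)‖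
      ≤ |s| ^ 3 * M * ∫ x, φ x ^ 2 ∂ρ := by
  have hint : Integrable φ ρ := Integrable.of_bound hφ.aestronglyMeasurable M
    (Eventually.of_forall hM)
  have hint2 : Integrable (fun x => φ x ^ 2) ρ :=
    Integrable.of_bound (hφ.pow_const 2).aestronglyMeasurable (M ^ 2)
      (Eventually.of_forall fun x => by
        rw [Real.norm_eq_abs, abs_pow]
        exact pow_le_pow_left₀ (abs_nonneg _) (hM x) 2)
  have hmexp : Measurable fun x => Complex.exp (s * φ x * Complex.I) := by fun_prop
  have hintexp : Integrable (fun x => Complex.exp (s * φ x * Complex.I)) ρ := by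
    refine Integrable.of_bound hmexp.aestronglyMeasurable 1 (Eventually.of_forall fun x => ?_)
    rw [← Complex.ofReal_mul, Complex.norm_exp_ofReal_mul_I]
  have e1 : charFun (ρ.map φ) s = ∫ x, Complex.exp (s * φ x * Complex.I) ∂ρ := by
    rw [charFun_apply_real, integral_map hφ.aemeasurable (by fun_prop)]
  have e2 : charFun (ρ.map φ) s - 1 + ((s ^ 2 / 2 * ∫ x, φ x ^ 2 ∂ρ : ℝ) : ℂ)
      = ∫ x, (Complex.exp (s * φ x * Complex.I) - 1 - (s * Complex.I) * ((φ x : ℝ) : ℂ)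
        + (s ^ 2 / 2) * ((φ x ^ 2 : ℝ) : ℂ)) ∂ρ := by
    rw [integral_add, integral_sub, integral_sub hintexp (integrable_const _),
      integral_const_mul, integral_const_mul, integral_complex_ofReal, integral_complex_ofReal,
      h0, e1]
    · simp
    · exact hintexp.sub (integrable_const _)
    · exact (hint.ofReal).const_mul _
    · exact (hintexp.sub (integrable_const _)).sub ((hint.ofReal).const_mul _)
    · exact (hint2.ofReal).const_mul _
  rw [e2, ← integral_const_mul]
  refine norm_integral_le_of_norm_le (hint2.const_mul _) (Eventually.of_forall fun x => ?_)
  have hnorm : ‖(s * φ x * Complex.I : ℂ)‖ = |s| * |φ x| := by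
    rw [← Complex.ofReal_mul, norm_mul, Complex.norm_I, mul_one, Complex.norm_real,
      Real.norm_eq_abs, abs_mul]
  have hle : |s| * |φ x| ≤ 1 := (mul_le_mul_of_nonneg_left (hM x) (abs_nonneg s)).trans hs
  have hb := Complex.exp_bound (x := s * φ x * Complex.I) (by rw [hnorm]; exact hle)
    (n := 3) (by norm_num)
  have e3 : (Complex.exp (s * φ x * Complex.I) - 1 - (s * Complex.I) * ((φ x : ℝ) : ℂ)
        + (s ^ 2 / 2) * ((φ x ^ 2 : ℝ) : ℂ))
      = Complex.exp (s * φ x * Complex.I)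
        - ∑ m ∈ Finset.range 3, (s * φ x * Complex.I : ℂ) ^ m / (m.factorial : ℂ) := by
    simp only [Finset.sum_range_succ, Finset.sum_range_zero, Nat.factorial]
    push_cast
    linear_combination ((s : ℂ) ^ 2 * (φ x : ℂ) ^ 2 / 2) * Complex.I_sq
  rw [e3]
  refine hb.trans ?_
  rw [hnorm]
  have h4 : (|s| * |φ x|) ^ 3 ≤ |s| ^ 3 * M * φ x ^ 2 := by
    have : (|s| * |φ x|) ^ 3 = |s| ^ 3 * |φ x| * φ x ^ 2 := by
      rw [← sq_abs (φ x)]; ring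
    rw [this]
    exact mul_le_mul_of_nonneg_right (mul_le_mul_of_nonneg_left (hM x) (by positivity))
      (sq_nonneg _)
  -- The remainder constant of the exponential series at order 3 is `4 / (3! · 3)`, which is less
  -- than one.
  refine le_trans (mul_le_of_le_one_right (by positivity) ?_) h4
  norm_num [Nat.factorial]

/-- A central limit theorem for row sums of bounded triangular arrays. -/
lemma tendstoInDistribution_rowSum [IsProbabilityMeasure ρ] (hW : ∀ j, HasLaw (W j) ρ μ)
    (hI : iIndepFun W μ)
    {φ : ℕ → E → ℝ} (hφ : ∀ n, Measurable (φ n)) {M : ℕ → ℝ} (hM : ∀ n x, |φ n x| ≤ M n)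
    (hM0 : Tendsto M atTop (𝓝 0)) (h0 : ∀ n, ∫ x, φ n x ∂ρ = 0) {v : NNReal}
    (hv : Tendsto (fun n : ℕ => n * ∫ x, φ n x ^ 2 ∂ρ) atTop (𝓝 v)) :
    TendstoInDistribution (fun (n : ℕ) ω => ∑ j ∈ Finset.range n, φ n (W j ω)) atTop
      (id : ℝ → ℝ) (fun _ => μ) (gaussianReal 0 v) where
  forall_aemeasurable n :=
    Finset.aemeasurable_fun_sum _ fun j _ => (hφ n).comp_aemeasurable (hW j).aemeasurable
  tendsto := by
    refine ProbabilityMeasure.tendsto_iff_tendsto_charFun.2 fun s => ?_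
    simp only [ProbabilityMeasure.coe_mk, Measure.map_id, charFun_gaussianReal]
    have hchar : ∀ n : ℕ, charFun (μ.map fun ω => ∑ j ∈ Finset.range n, φ n (W j ω)) s
        = charFun (ρ.map (φ n)) s ^ n := fun n => by
      have hI' : iIndepFun (fun j ω => φ n (W j ω)) μ := hI.comp _ fun _ => hφ n
      have mm : ∀ j, AEMeasurable (fun ω => φ n (W j ω)) μ := fun j =>
        (hφ n).comp_aemeasurable (hW j).aemeasurable
      rw [(hI'.restrict _).charFun_map_fun_finsetSum_eq_prod fun j _ => mm j]
      have : ∀ j, μ.map (fun ω => φ n (W j ω)) = ρ.map (φ n) := fun j => by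
        rw [← (hW j).map_eq, AEMeasurable.map_map_of_aemeasurable (hφ n).aemeasurable
          (hW j).aemeasurable]
        rfl
      simp [this]
    simp_rw [hchar]
    -- With `n (χₙ - 1)` convergent, `χₙⁿ = (1 + (χₙ - 1))ⁿ` converges to the exponential of the
    -- limit.
    have hkey : Tendsto (fun n : ℕ => (n : ℂ) * (charFun (ρ.map (φ n)) s - 1)) atTop
        (𝓝 (-(s ^ 2 * v / 2) : ℂ)) := by
      have hA : Tendsto (fun n : ℕ => ((s ^ 2 / 2 * (n * ∫ x, φ n x ^ 2 ∂ρ) : ℝ) : ℂ)) atTop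
          (𝓝 ((s ^ 2 / 2 * v : ℝ) : ℂ)) :=
        (Complex.continuous_ofReal.tendsto _).comp (hv.const_mul _)
      have hB : Tendsto (fun n : ℕ => (n : ℂ) * (charFun (ρ.map (φ n)) s - 1
          + ((s ^ 2 / 2 * ∫ x, φ n x ^ 2 ∂ρ : ℝ) : ℂ))) atTop (𝓝 0) := by
        rw [tendsto_zero_iff_norm_tendsto_zero]
        have hbound : Tendsto (fun n : ℕ => |s| ^ 3 * M n * (n * ∫ x, φ n x ^ 2 ∂ρ)) atTop
            (𝓝 0) := by
          have := (hM0.const_mul (|s| ^ 3)).mul hv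
          simpa using this
        refine squeeze_zero' (Eventually.of_forall fun _ => norm_nonneg _) ?_ hbound
        have hsm : ∀ᶠ n in atTop, |s| * M n < 1 := by
          have := hM0.const_mul |s|
          rw [mul_zero] at this
          exact this.eventually_lt_const one_pos
        filter_upwards [hsm] with n hn
        rw [norm_mul, Complex.norm_natCast]
        calc (n : ℝ) * ‖_‖ ≤ n * (|s| ^ 3 * M n * ∫ x, φ n x ^ 2 ∂ρ) :=
              mul_le_mul_of_nonneg_left (norm_charFun_sub_le (hφ n) (hM n) (h0 n) s hn.le)
                (Nat.cast_nonneg n)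
          _ = _ := by ring
      have := hB.sub hA
      refine (this.congr fun n => ?_).trans_eq ?_
      · push_cast; ring
      · push_cast; congr 1; ring
    have := Complex.tendsto_one_add_pow_exp_of_tendsto hkey
    simp only [add_sub_cancel] at this
    refine this.trans_eq ?_
    congr 2
    push_cast
    ring

end IID


/-! ### Bracketing of subdistribution functions -/

section Bracketing

lemma continuous_integral_Iic {q : ℝ → ℝ} (hq : Integrable q) :
    Continuous fun x => ∫ y in Iic x, q y := by
  have h1 : ∀ x, ∫ y in Iic x, q y = (∫ y in Iic 0, q y) + ∫ y in 0..x, q y := fun x => by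
    rw [← intervalIntegral.integral_Iic_sub_Iic hq.integrableOn hq.integrableOn]
    ring
  rw [funext h1]
  exact continuous_const.add
    (intervalIntegral.continuous_primitive (fun a b => hq.intervalIntegrable) 0)

lemma tendsto_integral_Iic {q : ℝ → ℝ} (hq : Integrable q) :
    Tendsto (fun x => ∫ y in Iic x, q y) atTop (𝓝 (∫ y, q y)) :=
  (aecover_Iic tendsto_id).integral_tendsto_of_countably_generated hq

/-- Finitely many sets suffice to control the deviation of a subdistribution function. -/
lemma exists_bracketing {q : ℝ → ℝ} (hq : Integrable q) (hq0 : ∀ y, 0 ≤ q y)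
    (hqneg : ∫ y in Iic 0, q y = 0) (hq1 : ∫ y, q y ≤ 1) {N : ℕ} (hN : 0 < N) :
    ∃ A : ℕ → Set ℝ, (∀ j, MeasurableSet (A j)) ∧
      ∀ (n : ℕ) (T : ℕ → ℝ) (D : ℕ → Fin 2) (i : Fin 2) (η : ℝ),
        (∀ j ∈ Finset.range (N + 2),
          |empSub n T D i ((A j).indicator 1) - ∫ y in A j, q y| ≤ η) →
        ∀ x, |empSub n T D i ((Iic x).indicator 1) - ∫ y in Iic x, q y| ≤ η + 2 / N := by
  set H : ℝ → ℝ := fun x => ∫ y in Iic x, q y with hH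
  have hHc : Continuous H := continuous_integral_Iic hq
  have hHm : Monotone H := fun a b hab =>
    setIntegral_mono_set hq.integrableOn (Eventually.of_forall hq0)
      (Iic_subset_Iic.2 hab).eventuallyLE
  have hH0 : ∀ x, 0 ≤ H x := fun x => integral_nonneg hq0
  have hH1 : ∀ x, H x ≤ 1 := fun x =>
    (setIntegral_le_integral hq (Eventually.of_forall hq0)).trans hq1
  have hN' : (0 : ℝ) < N := by exact_mod_cast hN
  classical
  -- Half-lines at the quantiles of level `j / N`. A level that is not attained exceeds the total
  -- mass when it lies above some value of `H`, and the whole line then serves as upper bracket.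
  let A : ℕ → Set ℝ := fun j => if hb : ∃ b, H b = j / N then Iic hb.choose else univ
  refine ⟨A, fun j => ?_, fun n T D i η hcl x => ?_⟩
  · by_cases hb : ∃ b, H b = j / N
    · simp only [A, dif_pos hb]; exact measurableSet_Iic
    · simp only [A, dif_neg hb]; exact MeasurableSet.univ
  have hmono : ∀ {S S' : Set ℝ}, S ⊆ S' →
      empSub n T D i (S.indicator 1) ≤ empSub n T D i (S'.indicator 1) := fun hss =>
    empSub_mono fun y => indicator_le_indicator_of_subset hss (by simp) y
  set J := ⌊(N : ℝ) * H x⌋₊ with hJ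
  have hNH : 0 ≤ (N : ℝ) * H x := mul_nonneg hN'.le (hH0 x)
  have hJ1 : (J : ℝ) ≤ N * H x := Nat.floor_le hNH
  have hJ2 : (N : ℝ) * H x < J + 1 := Nat.lt_floor_add_one _
  have hJN : J ≤ N := by
    have : (J : ℝ) ≤ N := hJ1.trans (by nlinarith [hH1 x])
    exact_mod_cast this
  have h2N : 2 / (N : ℝ) = 1 / N + 1 / N := by ring
  have h1N : 0 < 1 / (N : ℝ) := by positivity
  rw [abs_le]
  constructor
  · rcases Nat.eq_zero_or_pos J with h0 | hpos
    · have : H x < 1 / N := by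
        rw [lt_div_iff₀ hN', mul_comm]
        simpa [h0] using hJ2
      have h3 : 0 ≤ empSub n T D i ((Iic x).indicator 1) :=
        empSub_nonneg fun y => indicator_nonneg (by simp) y
      have h4 : 0 ≤ η := (abs_nonneg _).trans (hcl 0 (by simp))
      change _ ≤ _ - H x
      linarith
    · have hlt : ((J - 1 : ℕ) : ℝ) / N < H x := by
        rw [Nat.cast_sub hpos, Nat.cast_one, div_lt_iff₀ hN', mul_comm (H x)]
        linarith
      have hb : ∃ b, H b = ((J - 1 : ℕ) : ℝ) / N :=
        mem_range_of_exists_le_of_exists_ge hHc ⟨0, by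
          simp only [hH]
          rw [hqneg]
          positivity⟩ ⟨x, hlt.le⟩
      have hA : A (J - 1) = Iic hb.choose := dif_pos hb
      have hbs := hb.choose_spec
      have hbx : hb.choose ≤ x := by
        by_contra hcon
        have := hHm (not_le.1 hcon).le
        linarith
      have h3 := hcl (J - 1) (by simp; omega)
      rw [hA] at h3
      have h5 : H hb.choose = ∫ y in Iic hb.choose, q y := rfl
      rw [← h5, hbs] at h3
      have h4 := hmono (Iic_subset_Iic.2 hbx)
      have h3' := abs_le.1 h3
      have h6 : H x - 2 / N ≤ ((J - 1 : ℕ) : ℝ) / N := by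
        rw [Nat.cast_sub hpos, Nat.cast_one, sub_le_iff_le_add, ← add_div, le_div_iff₀ hN',
          mul_comm]
        linarith
      change _ ≤ _ - H x
      linarith [h3'.1]
  · have hlt : H x < ((J + 1 : ℕ) : ℝ) / N := by
      rw [lt_div_iff₀ hN', mul_comm]
      push_cast
      exact hJ2
    have h6 : ((J + 1 : ℕ) : ℝ) / N ≤ H x + 1 / N := by
      rw [Nat.cast_add, Nat.cast_one, add_div, add_le_add_iff_right, div_le_iff₀ hN', mul_comm]
      exact hJ1
    -- Since `J ≤ N`, the upper bracket has index at most `N + 1`; hence `N + 2` sets in all.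
    have h3 := hcl (J + 1) (by simp; omega)
    have hgoal : ∫ y in A (J + 1), q y ≤ H x + 1 / N ∧ Iic x ⊆ A (J + 1) := by
      by_cases hb : ∃ b, H b = ((J + 1 : ℕ) : ℝ) / N
      · have hA : A (J + 1) = Iic hb.choose := dif_pos hb
        have hbs := hb.choose_spec
        rw [hA]
        refine ⟨hbs.le.trans h6, Iic_subset_Iic.2 ?_⟩
        by_contra hcon
        have := hHm (not_le.1 hcon).le
        linarith
      · have hA : A (J + 1) = univ := dif_neg hb
        rw [hA]
        refine ⟨?_, subset_univ _⟩
        rw [setIntegral_univ]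
        refine le_trans (le_of_tendsto (tendsto_integral_Iic hq)
          (Eventually.of_forall fun b => ?_)) h6
        by_contra hcon
        exact hb (mem_range_of_exists_le_of_exists_ge hHc ⟨x, hlt.le⟩ ⟨b, (not_le.1 hcon).le⟩)
    have h4 := hmono hgoal.2
    have h3' := abs_le.1 h3
    change _ - H x ≤ _
    linarith [h3'.2, hgoal.1]

end Bracketing

/-! ### Observations as functions of latent pairs, and the Glivenko-Cantelli rate -/

section Model

variable {Ω : Type*} [MeasurableSpace Ω] {μ : Measure Ω} [IsProbabilityMeasure μ]
  {X T : ℕ → Ω → ℝ} {P Q : Measure ℝ} [IsProbabilityMeasure P] [IsProbabilityMeasure Q]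
  {g : ℝ → ℝ}

lemma IsModel.iIndepFun_obs (h : IsModel μ X T P Q) : iIndepFun (fun j ω => (X j ω, T j ω)) μ :=
  iIndepFun_prodMk (fun i => (h.hasLaw_event i).aemeasurable)
    (fun i => (h.hasLaw_censoring i).aemeasurable) h.iIndep_event h.iIndep_censoring h.indep

lemma IsModel.hasLaw_obs (h : IsModel μ X T P Q) (j : ℕ) :
    HasLaw (fun ω => (X j ω, T j ω)) (P.prod Q) μ where
  aemeasurable := (h.hasLaw_event j).aemeasurable.prodMk (h.hasLaw_censoring j).aemeasurable
  map_eq := by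
    have hind : IndepFun (X j) (T j) μ :=
      h.indep.comp (measurable_pi_apply j) (measurable_pi_apply j)
    rw [(indepFun_iff_map_prod_eq_prod_map_map (h.hasLaw_event j).aemeasurable
      (h.hasLaw_censoring j).aemeasurable).1 hind, (h.hasLaw_event j).map_eq,
      (h.hasLaw_censoring j).map_eq]

/-- A function of the observed pair that depends on the status, as a function of the latent one. -/
def latent (φ : Fin 2 → ℝ → ℝ) (p : ℝ × ℝ) : ℝ := φ (status p.1 p.2) p.2

lemma measurable_latent {φ : Fin 2 → ℝ → ℝ} (hφ : ∀ i, Measurable (φ i)) :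
    Measurable (latent φ) := by
  have h : latent φ = fun p : ℝ × ℝ => if p.1 ≤ p.2 then φ 1 p.2 else φ 0 p.2 := by
    ext p
    unfold latent status
    split_ifs <;> rfl
  rw [h]
  exact Measurable.ite (measurableSet_le measurable_fst measurable_snd)
    ((hφ 1).comp measurable_snd) ((hφ 0).comp measurable_snd)

lemma IsDensity.integrable (hQ : IsDensity Q g) : Integrable g := by
  obtain ⟨hm, h0, he⟩ := hQ
  have h1 : ∫⁻ x, ENNReal.ofReal (g x) = 1 := by
    have : Q univ = 1 := measure_univ
    rw [he, withDensity_apply _ MeasurableSet.univ, Measure.restrict_univ] at this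
    exact this
  refine ⟨hm.aestronglyMeasurable, ?_⟩
  rw [hasFiniteIntegral_iff_ofReal (Eventually.of_forall h0), h1]
  exact ENNReal.one_lt_top

lemma IsDensity.integral_eq (hQ : IsDensity Q g) (ψ : ℝ → ℝ) :
    ∫ y, ψ y ∂Q = ∫ y, ψ y * g y := by
  obtain ⟨hm, h0, he⟩ := hQ
  rw [he, integral_withDensity_eq_integral_toReal_smul hm.ennreal_ofReal
    (Eventually.of_forall fun _ => ENNReal.ofReal_lt_top)]
  congr 1; ext y
  rw [ENNReal.toReal_ofReal (h0 y), smul_eq_mul, mul_comm]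

/-- Given a censoring time `y`, the status is 1 with probability `F y`; integrating out the event
time yields the two subdensities. -/
lemma integral_latent (hQ : IsDensity Q g) {φ : Fin 2 → ℝ → ℝ} (hφ : ∀ i, Measurable (φ i))
    {C : ℝ} (hC : ∀ i y, |φ i y| ≤ C) :
    ∫ p, latent φ p ∂(P.prod Q) = (∫ y, φ 0 y * subDensity (cdf P) g 0 y)
      + ∫ y, φ 1 y * subDensity (cdf P) g 1 y := by
  have hint : Integrable (latent φ) (P.prod Q) :=
    Integrable.of_bound (measurable_latent hφ).aestronglyMeasurable C
      (Eventually.of_forall fun p => hC _ _)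
  have hd : ∀ i, Integrable (subDensity (cdf P) g i) :=
    integrable_subDensity (monotone_cdf P) (cdf_nonneg P) (cdf_le_one P) hQ.integrable hQ.2.1
  have hin : ∀ y, ∫ x, latent φ (x, y) ∂P = φ 0 y * (1 - cdf P y) + φ 1 y * cdf P y := fun y => by
    have e : ∀ x, latent φ (x, y) = φ 0 y + (Iic y).indicator (fun _ => φ 1 y - φ 0 y) x :=
      fun x => by
        unfold latent status
        by_cases hxy : x ≤ y
        · simp [hxy]
        · simp [hxy]
    simp_rw [e]
    rw [integral_add (integrable_const _) ((integrable_const _).indicator measurableSet_Iic),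
      integral_indicator measurableSet_Iic, setIntegral_const, integral_const, cdf_eq_real]
    simp
    ring
  rw [integral_prod_symm _ hint]
  simp_rw [hin]
  rw [hQ.integral_eq, ← integral_add]
  · congr 1; ext y
    rw [subDensity_zero, subDensity_one]
    ring
  · exact (hd 0).bdd_mul (hφ 0).aestronglyMeasurable (Eventually.of_forall (hC 0))
  · exact (hd 1).bdd_mul (hφ 1).aestronglyMeasurable (Eventually.of_forall (hC 1))

/-- The function of the observed pair that is `ψ` of the censoring time if the status is `i`. -/
def single (i : Fin 2) (ψ : ℝ → ℝ) (i' : Fin 2) (y : ℝ) : ℝ := if i' = i then ψ y else 0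

lemma measurable_single {i : Fin 2} {ψ : ℝ → ℝ} (hψ : Measurable ψ) (i' : Fin 2) :
    Measurable (single i ψ i') := by
  unfold single
  split_ifs
  · exact hψ
  · exact measurable_const

lemma abs_single_le {i : Fin 2} {ψ : ℝ → ℝ} {C : ℝ} (hC : ∀ y, |ψ y| ≤ C) (i' : Fin 2) (y : ℝ) :
    |single i ψ i' y| ≤ C := by
  unfold single
  split_ifs
  · exact hC y
  · simpa using (abs_nonneg _).trans (hC y)

lemma integral_latent_single (hQ : IsDensity Q g) {i : Fin 2} {ψ : ℝ → ℝ} (hψ : Measurable ψ)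
    {C : ℝ} (hC : ∀ y, |ψ y| ≤ C) :
    ∫ p, latent (single i ψ) p ∂(P.prod Q) = ∫ y, ψ y * subDensity (cdf P) g i y := by
  rw [integral_latent hQ (measurable_single hψ) (abs_single_le hC)]
  unfold single
  fin_cases i <;> simp

lemma empSub_eq_latent (n : ℕ) (i : Fin 2) (ψ : ℝ → ℝ) (ω : Ω) :
    empSub n (fun j => T j ω) (fun j => status (X j ω) (T j ω)) i ψ
      = (1 / (n : ℝ)) * ∑ j ∈ Finset.range n, latent (single i ψ) (X j ω, T j ω) := rfl

lemma integral_subDensity_Iic_zero (hQ : IsDensity Q g) (hneg : ∫ y in Iic 0, g y = 0)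
    (i : Fin 2) : ∫ y in Iic 0, subDensity (cdf P) g i y = 0 := by
  refine le_antisymm ?_ (integral_nonneg fun y =>
    subDensity_nonneg (cdf_nonneg P) (cdf_le_one P) hQ.2.1 i y)
  exact (setIntegral_mono (integrable_subDensity (monotone_cdf P) (cdf_nonneg P) (cdf_le_one P)
    hQ.integrable hQ.2.1 i).integrableOn hQ.integrable.integrableOn
    fun y => subDensity_le (cdf_nonneg P) (cdf_le_one P) hQ.2.1 i y).trans_eq hneg

lemma IsDensity.integral_eq_one (hQ : IsDensity Q g) : ∫ y, g y = 1 := by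
  have := hQ.integral_eq (fun _ => 1)
  simpa using this.symm

/-- A Glivenko-Cantelli bound with a rate. -/
lemma IsModel.measure_not_isClose_le (h : IsModel μ X T P Q) (hQ : IsDensity Q g)
    (hneg : ∫ y in Iic 0, g y = 0) {n : ℕ} (hn : 0 < n) {η : ℝ} (hη : 0 < η) :
    μ {ω | ¬ IsClose (subDensity (cdf P) g) n (fun j => T j ω)
        (fun j => status (X j ω) (T j ω)) (3 * η)}
      ≤ ENNReal.ofReal (2 * (1 / η + 3) * (1 / (n * η ^ 2))) := by
  -- With this many brackets the discretization error is at most `2η`, which together with the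
  -- deviation `η` at the brackets makes `3η`.
  set N := ⌈1 / η⌉₊ with hN
  have hN0 : 0 < N := Nat.ceil_pos.2 (by positivity)
  have hN0' : (0 : ℝ) < N := by exact_mod_cast hN0
  have hNle : 1 / η ≤ N := Nat.le_ceil _
  have hNlt : (N : ℝ) < 1 / η + 1 := Nat.ceil_lt_add_one (by positivity)
  have h2N : 2 / (N : ℝ) ≤ 2 * η := by
    rw [div_le_iff₀ hN0']
    rw [div_le_iff₀ hη] at hNle
    linarith
  set q := subDensity (cdf P) g with hq
  have hd : ∀ i, Integrable (q i) :=
    integrable_subDensity (monotone_cdf P) (cdf_nonneg P) (cdf_le_one P) hQ.integrable hQ.2.1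
  have hd0 : ∀ i y, 0 ≤ q i y := subDensity_nonneg (cdf_nonneg P) (cdf_le_one P) hQ.2.1
  have hd1 : ∀ i, ∫ y, q i y ≤ 1 := fun i => by
    rw [← hQ.integral_eq_one]
    exact integral_mono (hd i) hQ.integrable
      fun y => subDensity_le (cdf_nonneg P) (cdf_le_one P) hQ.2.1 i y
  choose A hAm hA using fun i => exists_bracketing (hd i) (hd0 i)
    (integral_subDensity_Iic_zero hQ hneg i) (hd1 i) hN0
  set B : Fin 2 → ℕ → Set Ω := fun i j => {ω | η ≤ |(1 / (n : ℝ)) * ∑ l ∈ Finset.range n,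
    latent (single i ((A i j).indicator 1)) (X l ω, T l ω)
      - ∫ p, latent (single i ((A i j).indicator 1)) p ∂(P.prod Q)|} with hB
  have hindle : ∀ i j y, |(A i j).indicator (1 : ℝ → ℝ) y| ≤ 1 := fun i j y => by
    classical
    rw [indicator_apply]; split_ifs <;> simp
  have hindm : ∀ i j, Measurable ((A i j).indicator (1 : ℝ → ℝ)) := fun i j =>
    measurable_one.indicator (hAm i j)
  have hBm : ∀ i j, μ (B i j) ≤ ENNReal.ofReal (1 / (n * η ^ 2)) := fun i j => by
    refine (measure_mean_sub_ge_le h.hasLaw_obs h.iIndepFun_obs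
      (measurable_latent (measurable_single (hindm i j)))
      (fun p => abs_single_le (hindle i j) _ _) hn hη).trans (ENNReal.ofReal_le_ofReal ?_)
    refine div_le_div_of_nonneg_right ?_ (by positivity)
    calc ∫ p, latent (single i ((A i j).indicator 1)) p ^ 2 ∂(P.prod Q)
        ≤ ∫ _, (1 : ℝ) ∂(P.prod Q) := by
          refine integral_mono_of_nonneg (Eventually.of_forall fun p => sq_nonneg _)
            (integrable_const _) (Eventually.of_forall fun p => ?_)
          have := abs_single_le (i := i) (hindle i j) (status p.1 p.2) p.2
          exact (sq_le_one_iff_abs_le_one _).2 this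
      _ = 1 := by simp
  -- Union bound over two statuses and `N + 2` brackets, each failing with probability at most `1 /
  -- (n η²)`.
  have hsub : {ω | ¬ IsClose q n (fun j => T j ω) (fun j => status (X j ω) (T j ω)) (3 * η)}
      ⊆ ⋃ i ∈ (Finset.univ : Finset (Fin 2)), ⋃ j ∈ Finset.range (N + 2), B i j := by
    intro ω hω
    by_contra hcon
    apply hω
    intro i x
    refine (hA i n _ _ i η (fun j hj => ?_) x).trans (by linarith)
    have hnot : ω ∉ B i j := fun hmem => hcon (by
      simp only [mem_iUnion]
      exact ⟨i, Finset.mem_univ i, j, hj, hmem⟩)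
    have : |(1 / (n : ℝ)) * ∑ l ∈ Finset.range n,
      latent (single i ((A i j).indicator 1)) (X l ω, T l ω)
      - ∫ p, latent (single i ((A i j).indicator 1)) p ∂(P.prod Q)| < η := not_le.1 hnot
    rw [integral_latent_single hQ (hindm i j) (hindle i j), ← empSub_eq_latent] at this
    have e : ∫ y, (A i j).indicator 1 y * subDensity (cdf P) g i y = ∫ y in A i j, q i y := by
      rw [← integral_indicator (hAm i j)]
      congr 1; ext y
      classical
      by_cases hy : y ∈ A i j <;> simp [hy, hq]
    rw [e] at this
    exact this.le
  calc μ _ ≤ μ (⋃ i ∈ (Finset.univ : Finset (Fin 2)), ⋃ j ∈ Finset.range (N + 2), B i j) :=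
        measure_mono hsub
    _ ≤ ∑ i ∈ (Finset.univ : Finset (Fin 2)), ∑ j ∈ Finset.range (N + 2), μ (B i j) :=
        (measure_biUnion_finset_le _ _).trans
          (Finset.sum_le_sum fun i _ => measure_biUnion_finset_le _ _)
    _ ≤ ∑ i ∈ (Finset.univ : Finset (Fin 2)), ∑ j ∈ Finset.range (N + 2),
        ENNReal.ofReal (1 / (n * η ^ 2)) :=
        Finset.sum_le_sum fun i _ => Finset.sum_le_sum fun j _ => hBm i j
    _ = ENNReal.ofReal (2 * ((N : ℝ) + 2) * (1 / (n * η ^ 2))) := by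
        rw [ENNReal.ofReal_mul (by positivity)]
        simp only [Finset.sum_const, Finset.card_range, Finset.card_univ, Fintype.card_fin,
          nsmul_eq_mul]
        rw [← mul_assoc]
        congr 1
        rw [ENNReal.ofReal_mul (by norm_num)]
        congr 1
        · simp
        · rw [← Nat.cast_ofNat (R := ℝ), ← Nat.cast_add, ENNReal.ofReal_natCast]
    _ ≤ _ := by
        refine ENNReal.ofReal_le_ofReal (mul_le_mul_of_nonneg_right ?_ (by positivity))
        linarith

end Model


/-! ### Asymptotic expansion of kernel smoothing -/

section Moments

lemma tendsto_smoothing {κ q : ℝ → ℝ} {t : ℝ} (hκc : Continuous κ)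
    (hκ : ∀ u, 1 ≤ |u| → κ u = 0) (hq : ∀ᶠ y in 𝓝 t, ContinuousAt q y) :
    Tendsto (fun h => ∫ u, κ u * q (t - h * u)) (𝓝[>] 0) (𝓝 ((∫ u, κ u) * q t)) := by
  rw [Metric.tendsto_nhds]
  intro ε hε
  set K := ∫ u, |κ u| with hK
  have hK0 : 0 ≤ K := integral_nonneg fun _ => abs_nonneg _
  have hnear : ∀ᶠ y in 𝓝 t, |q y - q t| < ε / (K + 1) := by
    have := Metric.tendsto_nhds.1 hq.self_of_nhds.tendsto (ε / (K + 1)) (by positivity)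
    simpa only [Real.dist_eq] using this
  obtain ⟨δ, hδ, H⟩ := Metric.eventually_nhds_iff.1 (hq.and hnear)
  filter_upwards [Ioo_mem_nhdsGT hδ] with h hh
  have hin : ∀ y ∈ Icc (t - h) (t + h), dist y t < δ := fun y hy => by
    rw [Real.dist_eq, abs_lt]
    constructor <;> linarith [hy.1, hy.2, hh.2]
  rw [Real.dist_eq]
  refine (smoothing_sub_le (e := ε / (K + 1)) hκc hκ hh.1
    (fun y hy => (H (hin y hy)).1.continuousWithinAt) fun y hy => (H (hin y hy)).2.le).trans_lt ?_
  rw [← hK, div_mul_eq_mul_div, div_lt_iff₀ (by positivity)]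
  nlinarith

/-- Mean value inequality for the remainder, whose derivative is `o(x)` because `φ'` is
differentiable at `t`. A second derivative is thus needed at the point only. -/
lemma peano_two {φ φ' : ℝ → ℝ} {φ₂ t : ℝ} (h1 : ∀ᶠ y in 𝓝 t, HasDerivAt φ (φ' y) y)
    (h2 : HasDerivAt φ' φ₂ t) {ε : ℝ} (hε : 0 < ε) :
    ∃ δ > 0, ∀ x, |x| < δ → |φ (t + x) - φ t - φ' t * x - φ₂ * x ^ 2 / 2| ≤ ε * x ^ 2 := by
  have h3 : ∀ᶠ y in 𝓝 t, |φ' y - φ' t - (y - t) * φ₂| ≤ ε * |y - t| := by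
    have := h2.isLittleO.def hε
    simpa [Real.norm_eq_abs] using this
  obtain ⟨δ, hδ, H⟩ := Metric.eventually_nhds_iff.1 (h1.and h3)
  refine ⟨δ, hδ, fun x hx => ?_⟩
  have hd : ∀ y ∈ Icc (-|x|) |x|, HasDerivWithinAt
      (fun y => φ (t + y) - φ t - φ' t * y - φ₂ * y ^ 2 / 2) (φ' (t + y) - φ' t - φ₂ * y)
      (Icc (-|x|) |x|) y := fun y hy => by
    have hy' : dist (t + y) t < δ := by
      rw [Real.dist_eq, add_sub_cancel_left]
      exact (abs_le.2 hy).trans_lt hx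
    have e1 : HasDerivAt (fun y => φ (t + y)) (φ' (t + y)) y := (H hy').1.comp_const_add t y
    have e2 : HasDerivAt (fun y : ℝ => φ' t * y) (φ' t) y := by
      simpa using (hasDerivAt_id y).const_mul (φ' t)
    have e3 : HasDerivAt (fun y : ℝ => φ₂ * y ^ 2 / 2) (φ₂ * y) y := by
      have := ((hasDerivAt_pow 2 y).const_mul φ₂).div_const 2
      convert! this using 1
      simp; ring
    exact (((e1.sub_const _).sub e2).sub e3).hasDerivWithinAt
  have hb : ∀ y ∈ Icc (-|x|) |x|, ‖φ' (t + y) - φ' t - φ₂ * y‖ ≤ ε * |x| := fun y hy => by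
    have hy1 := abs_le.2 hy
    have hy' : dist (t + y) t < δ := by
      rw [Real.dist_eq, add_sub_cancel_left]
      exact hy1.trans_lt hx
    have := (H hy').2
    rw [add_sub_cancel_left, mul_comm y] at this
    exact this.trans (mul_le_mul_of_nonneg_left hy1 hε.le)
  have := (convex_Icc (-|x|) |x|).norm_image_sub_le_of_norm_hasDerivWithin_le hd hb
    (x := 0) (y := x) ⟨by simp, abs_nonneg x⟩ (abs_le.1 le_rfl)
  simp only [add_zero, mul_zero, sub_self, sub_zero, Real.norm_eq_abs, ne_eq,
    OfNat.ofNat_ne_zero, not_false_eq_true, zero_pow, zero_div] at this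
  refine this.trans_eq ?_
  rw [mul_assoc, ← pow_two, sq_abs]

variable {k : ℝ → ℝ}

lemma CondK1.integral_mul_self (hk : CondK1 k) : ∫ u, k u * u = 0 := by
  have h1 : ∫ u, k u * u = ∫ u, k (-u) * (-u) :=
    (integral_neg_eq_self (fun u => k u * u) volume).symm
  simp_rw [hk.2.2.2.1, mul_neg] at h1
  rw [integral_neg] at h1
  linarith

/-- The second order bias expansion of kernel smoothing. -/
lemma CondK1.tendsto_bias (hk : CondK1 k) {φ φ' : ℝ → ℝ} {φ₂ t : ℝ}
    (h1 : ∀ᶠ y in 𝓝 t, HasDerivAt φ (φ' y) y) (h2 : HasDerivAt φ' φ₂ t) :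
    Tendsto (fun h => ((∫ u, k u * φ (t - h * u)) - φ t) / h ^ 2) (𝓝[>] 0)
      (𝓝 (m2 k * φ₂ / 2)) := by
  rw [Metric.tendsto_nhds]
  intro ε hε
  obtain ⟨δ₁, hδ₁, H₁⟩ := peano_two h1 h2 (half_pos hε)
  obtain ⟨δ₂, hδ₂, H₂⟩ := Metric.eventually_nhds_iff.1 h1
  filter_upwards [Ioo_mem_nhdsGT hδ₁, Ioo_mem_nhdsGT hδ₂] with h hh1 hh2
  have hh : 0 < h := hh1.1
  have hc := hk.continuous
  have hz : ∀ u, 1 ≤ |u| → k u = 0 := fun u hu => hk.eq_zero_of_one_le hu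
  have hcs : HasCompactSupport k := hasCompactSupport_of_eq_zero hz
  have hmaps : MapsTo (fun u => t - h * u) (Icc (-1) 1) (Icc (t - h) (t + h)) :=
    fun u hu => mem_Icc_of_abs_le_one hh hu
  have hφc : ContinuousOn φ (Icc (t - h) (t + h)) := fun y hy => by
    refine (H₂ ?_).continuousAt.continuousWithinAt
    rw [Real.dist_eq, abs_lt]
    constructor <;> linarith [hy.1, hy.2, hh2.2]
  have e0 := integral_eq_interval hz (fun u => φ (t - h * u))
  have e1 := integral_eq_interval hz (fun _ => φ t)
  rw [integral_mul_const, hk.2.1, one_mul] at e1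
  have e2 := integral_eq_interval hz (fun u => u)
  rw [hk.integral_mul_self] at e2
  have e3 := integral_eq_interval hz (fun u => u ^ 2)
  have hm2 : m2 k = ∫ u, k u * u ^ 2 := by unfold m2; simp_rw [mul_comm]
  rw [← hm2] at e3
  have i0 : IntervalIntegrable (fun u => k u * φ (t - h * u)) volume (-1) 1 :=
    ContinuousOn.intervalIntegrable_of_Icc (by norm_num)
      (hc.continuousOn.mul (hφc.comp (by fun_prop) hmaps))
  -- Unit mass removes the constant term, symmetry of `k` the linear one, and `m₂` comes from the
  -- quadratic one.
  have key : ((∫ u, k u * φ (t - h * u)) - φ t) - h ^ 2 * (m2 k * φ₂ / 2)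
      = ∫ u in (-1)..1, k u * (φ (t + -(h * u)) - φ t - φ' t * (-(h * u))
        - φ₂ * (-(h * u)) ^ 2 / 2) := by
    have expand : ∀ u, k u * (φ (t + -(h * u)) - φ t - φ' t * (-(h * u))
        - φ₂ * (-(h * u)) ^ 2 / 2) = k u * φ (t - h * u) - k u * φ t
          + (φ' t * h) * (k u * u) - (φ₂ * h ^ 2 / 2) * (k u * u ^ 2) := fun u => by
      rw [← sub_eq_add_neg]; ring
    simp_rw [expand]
    rw [intervalIntegral.integral_sub, intervalIntegral.integral_add,
      intervalIntegral.integral_sub i0, intervalIntegral.integral_const_mul,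
      intervalIntegral.integral_const_mul, ← e0, ← e1, ← e2, ← e3]
    · ring
    · exact Continuous.intervalIntegrable (by fun_prop) _ _
    · exact i0.sub (Continuous.intervalIntegrable (by fun_prop) _ _)
    · exact Continuous.intervalIntegrable (by fun_prop) _ _
    · exact (i0.sub (Continuous.intervalIntegrable (by fun_prop) _ _)).add
        (Continuous.intervalIntegrable (by fun_prop) _ _)
    · exact Continuous.intervalIntegrable (by fun_prop) _ _
  have hbound : |((∫ u, k u * φ (t - h * u)) - φ t) - h ^ 2 * (m2 k * φ₂ / 2)|
      ≤ ε / 2 * h ^ 2 := by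
    rw [key, ← Real.norm_eq_abs]
    have : ε / 2 * h ^ 2 = ∫ u in (-1)..1, k u * (ε / 2 * h ^ 2) := by
      have e4 := integral_eq_interval hz (fun _ => ε / 2 * h ^ 2)
      rw [← e4, integral_mul_const, hk.2.1, one_mul]
    rw [this]
    refine intervalIntegral.norm_integral_le_of_norm_le (by norm_num) ?_
      (Continuous.intervalIntegrable (by fun_prop) _ _)
    refine Eventually.of_forall fun u hu => ?_
    have hu1 : |u| ≤ 1 := abs_le.2 ⟨hu.1.le, hu.2⟩
    rw [norm_mul, Real.norm_eq_abs, abs_of_nonneg (hk.1 u), Real.norm_eq_abs]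
    refine mul_le_mul_of_nonneg_left ?_ (hk.1 u)
    have hlt : |-(h * u)| < δ₁ := by
      rw [abs_neg, abs_mul, abs_of_pos hh]
      nlinarith [hh1.2]
    refine (H₁ _ hlt).trans ?_
    refine mul_le_mul_of_nonneg_left ?_ (half_pos hε).le
    have : u ^ 2 ≤ 1 := (sq_le_one_iff_abs_le_one u).2 hu1
    nlinarith [sq_nonneg h]
  rw [Real.dist_eq]
  have hdiv : ((∫ u, k u * φ (t - h * u)) - φ t) / h ^ 2 - m2 k * φ₂ / 2
      = (((∫ u, k u * φ (t - h * u)) - φ t) - h ^ 2 * (m2 k * φ₂ / 2)) / h ^ 2 := by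
    field_simp
  rw [hdiv, abs_div, abs_of_pos (by positivity : 0 < h ^ 2), div_lt_iff₀ (by positivity)]
  have : 0 < h ^ 2 := by positivity
  nlinarith

end Moments

/-! ### Powers of the sample size -/

section Rates

/-- `n ^ (1/7)`. -/
def root7 (n : ℕ) : ℝ := (n : ℝ) ^ (1 / 7 : ℝ)

lemma root7_pos {n : ℕ} (hn : 0 < n) : 0 < root7 n :=
  Real.rpow_pos_of_pos (by exact_mod_cast hn) _

lemma root7_pow (n : ℕ) : root7 n ^ 7 = n := by
  unfold root7
  rw [← Real.rpow_natCast, ← Real.rpow_mul (Nat.cast_nonneg n)]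
  norm_num

lemma rpow_two_sevenths (n : ℕ) : (n : ℝ) ^ (2 / 7 : ℝ) = root7 n ^ 2 := by
  unfold root7
  rw [← Real.rpow_natCast, ← Real.rpow_mul (Nat.cast_nonneg n)]
  norm_num

lemma rpow_neg_seventh (n : ℕ) : (n : ℝ) ^ (-(1 / 7) : ℝ) = (root7 n)⁻¹ :=
  Real.rpow_neg (Nat.cast_nonneg n) _

lemma tendsto_root7 : Tendsto root7 atTop atTop :=
  (tendsto_rpow_atTop (by norm_num)).comp tendsto_natCast_atTop_atTop

lemma tendsto_bandwidth {c : ℝ} (hc : 0 < c) :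
    Tendsto (fun n : ℕ => c * (root7 n)⁻¹) atTop (𝓝[>] 0) := by
  rw [tendsto_nhdsWithin_iff]
  constructor
  · simpa using (tendsto_inv_atTop_zero.comp tendsto_root7).const_mul c
  · filter_upwards [eventually_gt_atTop 0] with n hn
    exact mul_pos hc (inv_pos.2 (root7_pos hn))

end Rates


/-! ### Limits in probability of the kernel estimators -/

section Estimators

variable {Ω : Type*} [MeasurableSpace Ω] {μ : Measure Ω} [IsProbabilityMeasure μ]
  {X T : ℕ → Ω → ℝ} {P Q : Measure ℝ} [IsProbabilityMeasure P] [IsProbabilityMeasure Q]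
  {g k : ℝ → ℝ} {t : ℝ}

/-- The average of `a * κ ((t - T) / h)` over the observations with status `i`. -/
def kernelMean (X T : ℕ → Ω → ℝ) (κ : ℝ → ℝ) (t a h : ℝ) (i : Fin 2) (n : ℕ) (ω : Ω) : ℝ :=
  empSub n (fun j => T j ω) (fun j => status (X j ω) (T j ω)) i (fun y => a * κ ((t - y) / h))

lemma integral_kernel (hQ : IsDensity Q g) {κ : ℝ → ℝ} (hκ : Continuous κ) {K : ℝ}
    (hK : ∀ u, |κ u| ≤ K) (a : ℝ) {h : ℝ} (hh : 0 < h) (i : Fin 2) :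
    ∫ p, latent (single i (fun y => a * κ ((t - y) / h))) p ∂(P.prod Q)
      = a * (h * ∫ u, κ u * subDensity (cdf P) g i (t - h * u)) := by
  rw [integral_latent_single hQ (C := |a| * K) (by fun_prop) fun y => by
    rw [abs_mul]; exact mul_le_mul_of_nonneg_left (hK _) (abs_nonneg _)]
  simp_rw [mul_assoc]
  rw [integral_const_mul, integral_rescale κ _ t hh]

lemma integral_kernel_sq (hQ : IsDensity Q g) {κ : ℝ → ℝ} (hκ : Continuous κ) {K : ℝ}
    (hK : ∀ u, |κ u| ≤ K) (a : ℝ) {h : ℝ} (hh : 0 < h) (i : Fin 2) :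
    ∫ p, latent (single i (fun y => a * κ ((t - y) / h))) p ^ 2 ∂(P.prod Q)
      = a ^ 2 * (h * ∫ u, κ u ^ 2 * subDensity (cdf P) g i (t - h * u)) := by
  have h1 := integral_kernel (P := P) (t := t) hQ (κ := fun u => κ u ^ 2) (by fun_prop)
    (K := K ^ 2) (fun u => by
      rw [abs_pow]; exact pow_le_pow_left₀ (abs_nonneg _) (hK u) 2) (a ^ 2) hh i
  rw [← h1]
  congr 1; ext p
  unfold latent single
  split_ifs <;> ring

lemma aemeasurable_kernelMean (hm : IsModel μ X T P Q) {κ : ℝ → ℝ} (hκ : Continuous κ) (a h : ℝ)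
    (i : Fin 2) (n : ℕ) : AEMeasurable (kernelMean X T κ t a h i n) μ := by
  unfold kernelMean
  simp_rw [empSub_eq_latent]
  refine AEMeasurable.const_mul (Finset.aemeasurable_fun_sum _ fun j _ => ?_) _
  exact (measurable_latent (measurable_single (by fun_prop))).comp_aemeasurable
    (hm.hasLaw_obs j).aemeasurable

/-- The weak law of large numbers for kernel averages. -/
lemma tendstoInMeasure_kernelMean (hm : IsModel μ X T P Q) (hQ : IsDensity Q g) {κ : ℝ → ℝ}
    (hκ : Continuous κ) {K : ℝ} (hK : ∀ u, |κ u| ≤ K) (hκ0 : ∀ u, 1 ≤ |u| → κ u = 0) {i : Fin 2}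
    (hq : ∀ᶠ y in 𝓝 t, ContinuousAt (subDensity (cdf P) g i) y) {a h d : ℕ → ℝ} {L : ℝ}
    (hh : Tendsto h atTop (𝓝[>] 0))
    (hmean : Tendsto (fun n => a n * (h n * ∫ u, κ u * subDensity (cdf P) g i (t - h n * u)) + d n)
      atTop (𝓝 L))
    (hvar : Tendsto (fun n : ℕ => a n ^ 2 * h n / n) atTop (𝓝 0)) :
    TendstoInMeasure μ (fun n ω => kernelMean X T κ t (a n) (h n) i n ω + d n) atTop
      (fun _ => L) := by
  have hpos : ∀ᶠ n in atTop, 0 < h n := (tendsto_nhdsWithin_iff.1 hh).2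
  refine tendstoInMeasure_mean hm.hasLaw_obs hm.iIndepFun_obs
    (φ := fun n => latent (single i (fun y => a n * κ ((t - y) / h n))))
    (fun n => measurable_latent (measurable_single (by fun_prop)))
    (fun n => ⟨|a n| * K, fun p => abs_single_le (fun y => by
      rw [abs_mul]; exact mul_le_mul_of_nonneg_left (hK _) (abs_nonneg _)) _ _⟩) ?_ ?_
  · refine hmean.congr' ?_
    filter_upwards [hpos] with n hn
    rw [integral_kernel hQ hκ hK _ hn]
  · have h1 := (tendsto_smoothing (κ := fun u => κ u ^ 2) (by fun_prop)
      (fun u hu => by simp [hκ0 u hu]) hq).comp hh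
    have h2 := hvar.mul h1
    rw [zero_mul] at h2
    refine h2.congr' ?_
    filter_upwards [hpos] with n hn
    rw [integral_kernel_sq hQ hκ hK _ hn]
    simp only [Function.comp_apply]
    ring

lemma CondK1.exists_bound (hk : CondK1 k) : ∃ K, ∀ u, |k u| ≤ K :=
  hk.continuous.bounded_above_of_compact_support
    (hasCompactSupport_of_eq_zero fun _ hu => hk.eq_zero_of_one_le hu)

lemma CondK1.exists_bound_deriv (hk : CondK1 k) : ∃ K, ∀ u, |deriv k u| ≤ K :=
  hk.continuous_deriv.bounded_above_of_compact_support
    (hasCompactSupport_of_eq_zero fun _ hu => hk.deriv_eq_zero_of_one_le hu)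

variable {i : Fin 2} {q' : ℝ → ℝ} {c : ℝ}

lemma tendstoInMeasure_gHatSub (hm : IsModel μ X T P Q) (hQ : IsDensity Q g) (hk : CondK1 k)
    (hc : 0 < c) (hq : ∀ᶠ y in 𝓝 t, ContinuousAt (subDensity (cdf P) g i) y) :
    TendstoInMeasure μ (fun n ω => kernelMean X T k t (1 / (c * (root7 n)⁻¹)) (c * (root7 n)⁻¹)
      i n ω) atTop (fun _ => subDensity (cdf P) g i t) := by
  obtain ⟨K, hK⟩ := hk.exists_bound
  have hh := tendsto_bandwidth hc
  have := tendstoInMeasure_kernelMean (d := fun _ => 0) (L := subDensity (cdf P) g i t)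
    (a := fun n => 1 / (c * (root7 n)⁻¹)) hm hQ hk.continuous hK
    (fun u hu => hk.eq_zero_of_one_le hu) hq hh ?_ ?_
  · simpa using this
  · have h1 := (tendsto_smoothing hk.continuous (fun u hu => hk.eq_zero_of_one_le hu) hq).comp hh
    rw [hk.2.1, one_mul] at h1
    refine h1.congr' ?_
    filter_upwards [eventually_gt_atTop 0] with n hn
    have := root7_pos hn
    simp only [Function.comp_apply]
    field_simp
    simp
  · have h1 : Tendsto (fun n : ℕ => c⁻¹ * ((root7 n)⁻¹) ^ 6) atTop (𝓝 (c⁻¹ * 0 ^ 6)) :=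
      ((tendsto_inv_atTop_zero.comp tendsto_root7).pow 6).const_mul _
    simp only [ne_eq, OfNat.ofNat_ne_zero, not_false_eq_true, zero_pow, mul_zero] at h1
    refine h1.congr' ?_
    filter_upwards [eventually_gt_atTop 0] with n hn
    have := root7_pos hn
    rw [← root7_pow n]
    field_simp

/-- The scaled fluctuation has variance of order `n^(4/7) / (n h)`, that is `n^(-2/7)`. At this
bandwidth only the bias of the subdensity estimator survives. -/
lemma tendstoInMeasure_scaled_gHatSub (hm : IsModel μ X T P Q) (hQ : IsDensity Q g)
    (hk : CondK1 k) (hc : 0 < c)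
    (hq : ∀ᶠ y in 𝓝 t, HasDerivAt (subDensity (cdf P) g i) (q' y) y) {q₂ : ℝ}
    (hq' : HasDerivAt q' q₂ t) :
    TendstoInMeasure μ (fun n ω => root7 n ^ 2 * (kernelMean X T k t (1 / (c * (root7 n)⁻¹))
      (c * (root7 n)⁻¹) i n ω - subDensity (cdf P) g i t)) atTop
      (fun _ => c ^ 2 * (m2 k * q₂ / 2)) := by
  obtain ⟨K, hK⟩ := hk.exists_bound
  have hh := tendsto_bandwidth hc
  have := tendstoInMeasure_kernelMean (d := fun n => -(root7 n ^ 2 * subDensity (cdf P) g i t))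
    (L := c ^ 2 * (m2 k * q₂ / 2)) (a := fun n => root7 n ^ 2 * (1 / (c * (root7 n)⁻¹))) hm hQ
    hk.continuous hK (fun u hu => hk.eq_zero_of_one_le hu)
    (hq.mono fun y hy => hy.continuousAt) hh ?_ ?_
  · refine this.congr_left fun n => Eventually.of_forall fun ω => ?_
    simp only [kernelMean, mul_assoc]
    rw [empSub_const_mul (root7 n ^ 2)]
    ring
  · have h1 := ((hk.tendsto_bias hq hq').comp hh).const_mul (c ^ 2)
    refine h1.congr' ?_
    filter_upwards [eventually_gt_atTop 0] with n hn
    have := root7_pos hn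
    simp only [Function.comp_apply]
    field_simp
    ring
  · have h1 : Tendsto (fun n : ℕ => c⁻¹ * ((root7 n)⁻¹) ^ 2) atTop (𝓝 (c⁻¹ * 0 ^ 2)) :=
      ((tendsto_inv_atTop_zero.comp tendsto_root7).pow 2).const_mul _
    simp only [ne_eq, OfNat.ofNat_ne_zero, not_false_eq_true, zero_pow, mul_zero] at h1
    refine h1.congr' ?_
    filter_upwards [eventually_gt_atTop 0] with n hn
    have := root7_pos hn
    rw [← root7_pow n]
    field_simp

/-- The mean of the derivative of the kernel estimator. -/
def derivMean (F g k : ℝ → ℝ) (t h : ℝ) (i : Fin 2) : ℝ :=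
  1 / h * ∫ u, deriv k u * subDensity F g i (t - h * u)

lemma eventually_derivMean_eq (hk : CondK1 k)
    (hq : ∀ᶠ y in 𝓝 t, HasDerivAt (subDensity (cdf P) g i) (q' y) y)
    (hq' : ∀ᶠ y in 𝓝 t, ContinuousAt q' y) :
    ∀ᶠ h in 𝓝[>] (0 : ℝ), derivMean (cdf P) g k t h i = ∫ u, k u * q' (t - h * u) := by
  obtain ⟨δ, hδ, H⟩ := Metric.eventually_nhds_iff.1 (hq.and hq')
  filter_upwards [Ioo_mem_nhdsGT hδ] with h hh
  have hin : ∀ y ∈ Icc (t - h) (t + h), dist y t < δ := fun y hy => by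
    rw [Real.dist_eq, abs_lt]
    constructor <;> linarith [hy.1, hy.2, hh.2]
  have hh0 : h ≠ 0 := hh.1.ne'
  unfold derivMean
  rw [hk.integral_deriv_smoothing hh.1 (fun y hy => (H (hin y hy)).1)
    fun y hy => (H (hin y hy)).2.continuousWithinAt]
  field_simp

lemma tendsto_derivMean (hk : CondK1 k) (hc : 0 < c)
    (hq : ∀ᶠ y in 𝓝 t, HasDerivAt (subDensity (cdf P) g i) (q' y) y)
    (hq' : ∀ᶠ y in 𝓝 t, ContinuousAt q' y) :
    Tendsto (fun n => derivMean (cdf P) g k t (c * (root7 n)⁻¹) i) atTop (𝓝 (q' t)) := by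
  have h1 := tendsto_smoothing hk.continuous (fun u hu => hk.eq_zero_of_one_le hu) hq'
  rw [hk.2.1, one_mul] at h1
  refine (h1.comp (tendsto_bandwidth hc)).congr' ?_
  filter_upwards [(tendsto_bandwidth hc).eventually (eventually_derivMean_eq hk hq hq')] with n hn
  exact hn.symm

/-- After integration by parts the mean is a smoothing of `q'`, so the bias expansion applies with
one more derivative. -/
lemma tendsto_scaled_derivMean (hk : CondK1 k) (hc : 0 < c)
    (hq : ∀ᶠ y in 𝓝 t, HasDerivAt (subDensity (cdf P) g i) (q' y) y) {q₂ : ℝ → ℝ} {q₃ : ℝ}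
    (hq' : ∀ᶠ y in 𝓝 t, HasDerivAt q' (q₂ y) y) (hq₂ : HasDerivAt q₂ q₃ t) :
    Tendsto (fun n => root7 n ^ 2 * (derivMean (cdf P) g k t (c * (root7 n)⁻¹) i - q' t)) atTop
      (𝓝 (c ^ 2 * (m2 k * q₃ / 2))) := by
  refine (((hk.tendsto_bias hq' hq₂).comp (tendsto_bandwidth hc)).const_mul (c ^ 2)).congr' ?_
  filter_upwards [(tendsto_bandwidth hc).eventually (eventually_derivMean_eq hk hq
    (hq'.mono fun y hy => hy.continuousAt)), eventually_gt_atTop 0] with n hn hn0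
  have := root7_pos hn0
  rw [hn]
  simp only [Function.comp_apply]
  field_simp

lemma tendstoInMeasure_deriv_gHatSub (hm : IsModel μ X T P Q) (hQ : IsDensity Q g) (hk : CondK1 k)
    (hc : 0 < c) (hq : ∀ᶠ y in 𝓝 t, HasDerivAt (subDensity (cdf P) g i) (q' y) y)
    (hq' : ∀ᶠ y in 𝓝 t, ContinuousAt q' y) :
    TendstoInMeasure μ (fun n ω => kernelMean X T (deriv k) t (1 / (c * (root7 n)⁻¹) ^ 2)
      (c * (root7 n)⁻¹) i n ω) atTop (fun _ => q' t) := by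
  obtain ⟨K, hK⟩ := hk.exists_bound_deriv
  have := tendstoInMeasure_kernelMean (d := fun _ => 0) (L := q' t)
    (a := fun n => 1 / (c * (root7 n)⁻¹) ^ 2) hm hQ hk.continuous_deriv hK
    (fun u hu => hk.deriv_eq_zero_of_one_le hu) (hq.mono fun y hy => hy.continuousAt)
    (tendsto_bandwidth hc) ?_ ?_
  · simpa using this
  · refine (tendsto_derivMean hk hc hq hq').congr' ?_
    filter_upwards [eventually_gt_atTop 0] with n hn
    have := root7_pos hn
    unfold derivMean
    field_simp
    simp
  · have h1 : Tendsto (fun n : ℕ => (c⁻¹) ^ 3 * ((root7 n)⁻¹) ^ 4) atTop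
        (𝓝 ((c⁻¹) ^ 3 * 0 ^ 4)) :=
      ((tendsto_inv_atTop_zero.comp tendsto_root7).pow 4).const_mul _
    simp only [ne_eq, OfNat.ofNat_ne_zero, not_false_eq_true, zero_pow, mul_zero] at h1
    refine h1.congr' ?_
    filter_upwards [eventually_gt_atTop 0] with n hn
    have := root7_pos hn
    rw [← root7_pow n]
    field_simp

end Estimators


/-! ### Asymptotic normality of the derivative estimators -/

section CentralLimit

variable {Ω : Type*} [MeasurableSpace Ω] {μ : Measure Ω} [IsProbabilityMeasure μ]
  {X T : ℕ → Ω → ℝ} {P Q : Measure ℝ} [IsProbabilityMeasure P] [IsProbabilityMeasure Q]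
  {g k : ℝ → ℝ} {t c : ℝ}

lemma sum_empSub_eq_latent (n : ℕ) (w : Fin 2 → ℝ) (ψ : ℝ → ℝ) (ω : Ω) :
    ∑ i, w i * empSub n (fun j => T j ω) (fun j => status (X j ω) (T j ω)) i ψ
      = (1 / (n : ℝ)) * ∑ j ∈ Finset.range n, latent (fun i y => w i * ψ y) (X j ω, T j ω) := by
  unfold empSub latent
  rw [Fin.sum_univ_two, mul_left_comm, mul_left_comm (w 1), ← mul_add, Finset.mul_sum,
    Finset.mul_sum, ← Finset.sum_add_distrib]
  congr 1
  refine Finset.sum_congr rfl fun j _ => ?_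
  simp only
  generalize status (X j ω) (T j ω) = d
  fin_cases d <;> simp

/-- Fluctuation of a linear combination of the derivatives of the kernel estimators. -/
def derivFluct (X T : ℕ → Ω → ℝ) (F g k : ℝ → ℝ) (t c : ℝ) (w : Fin 2 → ℝ) (n : ℕ) (ω : Ω) : ℝ :=
  root7 n ^ 2 * ∑ i, w i * (kernelMean X T (deriv k) t (1 / (c * (root7 n)⁻¹) ^ 2)
    (c * (root7 n)⁻¹) i n ω - derivMean F g k t (c * (root7 n)⁻¹) i)

lemma root7_zero : root7 0 = 0 := by
  unfold root7
  rw [Nat.cast_zero, Real.zero_rpow (by norm_num)]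

/-- A row sum of independent terms with weight `a n` of order `n^(-3/7)`, so bounds and hence the
cubic remainders vanish. An observation has only one status, so there are no cross terms: the
variance is `n a² h` times the sum of `wᵢ² ∫ k'² qᵢ`, and `n a² h = c⁻³`. -/
lemma tendstoInDistribution_derivFluct (hm : IsModel μ X T P Q) (hQ : IsDensity Q g)
    (hk : CondK1 k) (hc : 0 < c)
    (hq : ∀ i, ∀ᶠ y in 𝓝 t, ContinuousAt (subDensity (cdf P) g i) y) (w : Fin 2 → ℝ) {v : NNReal}
    (hv : (v : ℝ) = (c ^ 3)⁻¹ * ((∫ u, deriv k u ^ 2) * ∑ i, w i ^ 2 * subDensity (cdf P) g i t)) :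
    TendstoInDistribution (fun (n : ℕ) ω => derivFluct X T (cdf P) g k t c w n ω) atTop
      (id : ℝ → ℝ) (fun _ => μ) (gaussianReal 0 v) := by
  obtain ⟨K, hK⟩ := hk.exists_bound_deriv
  have hK0 : 0 ≤ K := (abs_nonneg _).trans (hK 0)
  have hkc := hk.continuous_deriv
  set B := |w 0| + |w 1| with hB
  have hBw : ∀ i, |w i| ≤ B := fun i => by
    have h0 := abs_nonneg (w 0)
    have h1 := abs_nonneg (w 1)
    fin_cases i <;> simp only [Fin.zero_eta, Fin.mk_one, hB] <;> linarith
  set a : ℕ → ℝ := fun n => root7 n ^ 2 / (n * (c * (root7 n)⁻¹) ^ 2) with ha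
  set h : ℕ → ℝ := fun n => c * (root7 n)⁻¹ with hh
  set φ₀ : ℕ → Fin 2 → ℝ → ℝ := fun n i y => w i * (a n * deriv k ((t - y) / h n)) with hφ₀
  have hφm : ∀ n i, Measurable (φ₀ n i) := fun n i => by fun_prop
  have hφb : ∀ n i y, |φ₀ n i y| ≤ B * (|a n| * K) := fun n i y => by
    simp only [hφ₀, abs_mul]
    exact mul_le_mul (hBw i) (mul_le_mul_of_nonneg_left (hK _) (abs_nonneg _)) (by positivity)
      (by positivity)
  set m : ℕ → ℝ := fun n => ∫ p, latent (φ₀ n) p ∂(P.prod Q) with hmdef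
  have hmb : ∀ n, |m n| ≤ B * (|a n| * K) := fun n => by
    have := norm_integral_le_of_norm_le_const (μ := P.prod Q) (f := latent (φ₀ n))
      (Eventually.of_forall fun p => hφb n (status p.1 p.2) p.2)
    simpa using this
  have hint : ∀ n, Integrable (latent (φ₀ n)) (P.prod Q) := fun n =>
    Integrable.of_bound (measurable_latent (hφm n)).aestronglyMeasurable _
      (Eventually.of_forall fun p => hφb n _ _)
  have hint2 : ∀ n, Integrable (fun p => latent (φ₀ n) p ^ 2) (P.prod Q) := fun n =>
    Integrable.of_bound ((measurable_latent (hφm n)).pow_const 2).aestronglyMeasurable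
      ((B * (|a n| * K)) ^ 2) (Eventually.of_forall fun p => by
        rw [Real.norm_eq_abs, abs_pow]
        exact pow_le_pow_left₀ (abs_nonneg _) (hφb n _ _) 2)
  have hpos : ∀ n : ℕ, 0 < n → 0 < h n := fun n hn => mul_pos hc (inv_pos.2 (root7_pos hn))
  have hm_eq : ∀ n : ℕ, 0 < n → m n = ∑ i, w i * (a n * (h n *
      ∫ u, deriv k u * subDensity (cdf P) g i (t - h n * u))) := fun n hn => by
    simp only [hmdef]
    rw [integral_latent hQ (hφm n) (hφb n), Fin.sum_univ_two]
    simp only [hφ₀, mul_assoc]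
    rw [integral_const_mul, integral_const_mul, integral_const_mul, integral_const_mul,
      integral_rescale _ _ t (hpos n hn), integral_rescale _ _ t (hpos n hn)]
  have hsq : ∀ n : ℕ, 0 < n → ∫ p, latent (φ₀ n) p ^ 2 ∂(P.prod Q)
      = a n ^ 2 * h n * ∑ i, w i ^ 2 * ∫ u, deriv k u ^ 2 * subDensity (cdf P) g i (t - h n * u) :=
    fun n hn => by
      have h1 := integral_latent (P := P) hQ (φ := fun i y => φ₀ n i y ^ 2)
        (fun i => (hφm n i).pow_const 2) (C := (B * (|a n| * K)) ^ 2) fun i y => by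
          rw [abs_pow]
          exact pow_le_pow_left₀ (abs_nonneg _) (hφb n _ _) 2
      have h2 : (fun p => latent (φ₀ n) p ^ 2) = latent fun i y => φ₀ n i y ^ 2 := rfl
      rw [h2, h1]
      simp only [hφ₀, mul_pow, mul_assoc]
      rw [integral_const_mul, integral_const_mul, integral_const_mul, integral_const_mul,
        integral_rescale (fun u => deriv k u ^ 2) _ t (hpos n hn),
        integral_rescale (fun u => deriv k u ^ 2) _ t (hpos n hn), Fin.sum_univ_two]
      ring
  have key := tendstoInDistribution_rowSum (μ := μ) hm.hasLaw_obs hm.iIndepFun_obs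
    (φ := fun n p => latent (φ₀ n) p - m n) (v := v) (M := fun n => 2 * (B * (|a n| * K)))
    (fun n => (measurable_latent (hφm n)).sub_const _) (fun n p => ?_) ?_ (fun n => ?_) ?_
  · refine key.congr (fun n => Eventually.of_forall fun ω => ?_) (ae_eq_refl _)
    -- For the empty sample `root7 0 = 0` makes both sides zero.
    rcases Nat.eq_zero_or_pos n with rfl | hn
    · simp [derivFluct, root7_zero]
    have hr := root7_pos hn
    have hn' : (0 : ℝ) < n := by exact_mod_cast hn
    simp only [Finset.sum_sub_distrib, Finset.sum_const, Finset.card_range, nsmul_eq_mul,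
      derivFluct, mul_sub]
    congr 1
    · have := sum_empSub_eq_latent (X := X) (T := T) n w
        (fun y => 1 / (c * (root7 n)⁻¹) ^ 2 * deriv k ((t - y) / (c * (root7 n)⁻¹))) ω
      unfold kernelMean
      rw [this, Finset.mul_sum, Finset.mul_sum]
      refine Finset.sum_congr rfl fun j _ => ?_
      simp only [latent, hφ₀, ha, hh]
      field_simp
    · rw [hm_eq n hn, Finset.mul_sum, Finset.mul_sum]
      refine Finset.sum_congr rfl fun i _ => ?_
      simp only [ha, hh, derivMean]
      field_simp
  · have h1 := hφb n (status p.1 p.2) p.2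
    have h2 := hmb n
    have h3 := abs_sub (latent (φ₀ n) p) (m n)
    have h4 : |latent (φ₀ n) p| ≤ B * (|a n| * K) := h1
    linarith
  · have h1 : Tendsto (fun n : ℕ => (c ^ 2)⁻¹ * ((root7 n)⁻¹) ^ 3) atTop
        (𝓝 ((c ^ 2)⁻¹ * 0 ^ 3)) :=
      ((tendsto_inv_atTop_zero.comp tendsto_root7).pow 3).const_mul _
    have h2 : Tendsto a atTop (𝓝 0) := by
      simp only [ne_eq, OfNat.ofNat_ne_zero, not_false_eq_true, zero_pow, mul_zero] at h1
      refine h1.congr' ?_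
      filter_upwards [eventually_gt_atTop 0] with n hn
      have := root7_pos hn
      simp only [ha]
      rw [← root7_pow n]
      field_simp
    have h3 := ((h2.abs.mul_const K).const_mul B).const_mul 2
    simpa using h3
  · rw [integral_sub (hint n) (integrable_const _)]
    simp [hmdef]
  · have hvar : ∀ n, ∫ p, (latent (φ₀ n) p - m n) ^ 2 ∂(P.prod Q)
        = (∫ p, latent (φ₀ n) p ^ 2 ∂(P.prod Q)) - m n ^ 2 := fun n => by
      have e : ∀ p, (latent (φ₀ n) p - m n) ^ 2
          = latent (φ₀ n) p ^ 2 - (2 * m n) * latent (φ₀ n) p + m n ^ 2 := fun p => by ring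
      simp_rw [e]
      have i1 : Integrable (fun p => latent (φ₀ n) p ^ 2 - 2 * m n * latent (φ₀ n) p)
          (P.prod Q) := (hint2 n).sub ((hint n).const_mul _)
      rw [integral_add i1 (integrable_const _), integral_sub (hint2 n) ((hint n).const_mul _),
        integral_const_mul]
      simp only [integral_const, probReal_univ, smul_eq_mul, one_mul]
      simp only [hmdef]
      ring
    simp_rw [hvar]
    have hs : ∀ i, Tendsto (fun n => ∫ u, deriv k u ^ 2 * subDensity (cdf P) g i (t - h n * u))
        atTop
        (𝓝 ((∫ u, deriv k u ^ 2) * subDensity (cdf P) g i t)) := fun i =>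
      (tendsto_smoothing (κ := fun u => deriv k u ^ 2) (by fun_prop)
        (fun u hu => by simp [hk.deriv_eq_zero_of_one_le hu]) (hq i)).comp (tendsto_bandwidth hc)
    have hs' : ∀ i, Tendsto (fun n => ∫ u, deriv k u * subDensity (cdf P) g i (t - h n * u)) atTop
        (𝓝 ((∫ u, deriv k u) * subDensity (cdf P) g i t)) := fun i =>
      (tendsto_smoothing hkc (fun u hu => hk.deriv_eq_zero_of_one_le hu)
        (hq i)).comp (tendsto_bandwidth hc)
    have l1 : Tendsto (fun n => (c ^ 3)⁻¹ * ∑ i, w i ^ 2 *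
        ∫ u, deriv k u ^ 2 * subDensity (cdf P) g i (t - h n * u)) atTop (𝓝 (v : ℝ)) := by
      have := (tendsto_finsetSum Finset.univ fun i _ => (hs i).const_mul (w i ^ 2)).const_mul
        (c ^ 3)⁻¹
      refine this.trans_eq ?_
      rw [hv]
      congr 2
      rw [Finset.mul_sum]
      exact Finset.sum_congr rfl fun i _ => by ring
    -- The squared mean contributes `n a² h²`, smaller than the second moment by a factor of order
    -- `h`.
    have l2 : Tendsto (fun n => (c ^ 2)⁻¹ * (root7 n)⁻¹ * (∑ i, w i *
        ∫ u, deriv k u * subDensity (cdf P) g i (t - h n * u)) ^ 2) atTop (𝓝 0) := by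
      have := ((tendsto_inv_atTop_zero.comp tendsto_root7).const_mul (c ^ 2)⁻¹).mul
        ((tendsto_finsetSum Finset.univ fun i _ => (hs' i).const_mul (w i)).pow 2)
      simpa using this
    have l3 := l1.sub l2
    rw [sub_zero] at l3
    refine l3.congr' ?_
    filter_upwards [eventually_gt_atTop 0] with n hn
    have hr := root7_pos hn
    rw [hsq n hn, hm_eq n hn]
    have e1 : ∑ i, w i * (a n * (h n * ∫ u, deriv k u * subDensity (cdf P) g i (t - h n * u)))
        = a n * h n * ∑ i, w i * ∫ u, deriv k u * subDensity (cdf P) g i (t - h n * u) := by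
      rw [Finset.mul_sum]
      exact Finset.sum_congr rfl fun i _ => by ring
    rw [e1]
    generalize (∑ i, w i * ∫ u, deriv k u * subDensity (cdf P) g i (t - h n * u)) = S₁
    generalize (∑ i, w i ^ 2 * ∫ u, deriv k u ^ 2 * subDensity (cdf P) g i (t - h n * u)) = S₂
    simp only [ha, hh]
    rw [← root7_pow n]
    field_simp

end CentralLimit

/-! ### Continuous mapping and transfer of convergence in law -/

section InMeasure

variable {Ω : Type*} [MeasurableSpace Ω] {μ : Measure Ω} [IsProbabilityMeasure μ]

/-- The continuous mapping theorem for convergence in measure to constants. -/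
lemma tendstoInMeasure_of_continuousAt {ι : Type*} [Fintype ι] {Z : ι → ℕ → Ω → ℝ} {z : ι → ℝ}
    (hZ : ∀ i, TendstoInMeasure μ (Z i) atTop fun _ => z i) {Φ : (ι → ℝ) → ℝ}
    (hΦ : ContinuousAt Φ z) {R : ℕ → Ω → ℝ} {U : Set (ι → ℝ)} (hU : U ∈ 𝓝 z)
    (hR : ∀ᶠ n in atTop, ∀ ω, (fun i => Z i n ω) ∈ U → R n ω = Φ fun i => Z i n ω) :
    TendstoInMeasure μ R atTop fun _ => Φ z := by
  rw [tendstoInMeasure_iff_norm]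
  intro ε hε
  obtain ⟨δ, hδ, H⟩ := Metric.eventually_nhds_iff.1
    ((Metric.tendsto_nhds.1 hΦ.tendsto ε hε).and hU)
  have hlim : Tendsto (fun n => ∑ i, μ {ω | δ ≤ ‖Z i n ω - z i‖}) atTop (𝓝 0) := by
    have := tendsto_finsetSum Finset.univ fun i _ => tendstoInMeasure_iff_norm.1 (hZ i) δ hδ
    simpa using this
  refine tendsto_of_tendsto_of_tendsto_of_le_of_le' tendsto_const_nhds hlim
    (Eventually.of_forall fun _ => zero_le) ?_
  filter_upwards [hR] with n hn
  refine (measure_mono (t := ⋃ i ∈ (Finset.univ : Finset ι), {ω | δ ≤ ‖Z i n ω - z i‖})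
    fun ω hω => ?_).trans (measure_biUnion_finset_le _ _)
  by_contra hcon
  have hlt : dist (fun i => Z i n ω) z < δ := by
    rw [dist_pi_lt_iff hδ]
    intro i
    by_contra hge
    exact hcon (by
      simp only [mem_iUnion]
      exact ⟨i, Finset.mem_univ i, by
        change δ ≤ ‖Z i n ω - z i‖
        rw [← dist_eq_norm]
        exact not_lt.1 hge⟩)
  have h1 := H hlt
  have hω' : ε ≤ ‖R n ω - Φ z‖ := hω
  rw [hn ω h1.2, ← dist_eq_norm] at hω'
  exact absurd h1.1 (not_lt.2 hω')

lemma tendstoInMeasure_const_of_tendsto {β : ℕ → ℝ} {b : ℝ} (hβ : Tendsto β atTop (𝓝 b)) :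
    TendstoInMeasure μ (fun n (_ : Ω) => β n) atTop fun _ => b := by
  rw [tendstoInMeasure_iff_norm]
  intro ε hε
  refine tendsto_const_nhds.congr' ?_
  filter_upwards [Metric.tendsto_nhds.1 hβ ε hε] with n hn
  rw [dist_eq_norm, ← not_le] at hn
  simp only [hn]
  simp

/-- Convergence in distribution, transferred to variables that agree with high probability. -/
lemma convergesInLaw_of_tendstoInDistribution {Y' Y : ℕ → Ω → ℝ} {ν : Measure ℝ}
    [IsProbabilityMeasure ν] {Z : ℝ → ℝ} {ν' : Measure ℝ} [IsProbabilityMeasure ν']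
    (hY : TendstoInDistribution Y' atTop Z (fun _ => μ) ν') (hZ : ν'.map Z = ν)
    (hne : Tendsto (fun n => μ {ω | Y n ω ≠ Y' n ω}) atTop (𝓝 0)) : ConvergesInLaw μ Y ν := by
  intro x hx
  have hport : ∀ S : Set ℝ, MeasurableSet S → frontier S ⊆ {x} →
      Tendsto (fun n => μ {ω | Y n ω ∈ S}) atTop (𝓝 (ν S)) := fun S hS hfr => by
    have h1 := ProbabilityMeasure.tendsto_measure_of_null_frontier_of_tendsto' hY.tendsto
      (E := S) (by
        simp only [ProbabilityMeasure.coe_mk, hZ]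
        exact measure_mono_null hfr hx)
    simp only [ProbabilityMeasure.coe_mk, hZ] at h1
    have h2 : ∀ n, μ.map (Y' n) S = μ {ω | Y' n ω ∈ S} := fun n =>
      Measure.map_apply_of_aemeasurable (hY.forall_aemeasurable n) hS
    simp_rw [h2] at h1
    -- `Y` may fail to be measurable. The sandwich uses only monotonicity and subadditivity, which
    -- `μ` keeps as an outer measure.
    have hup : ∀ n, μ {ω | Y n ω ∈ S} ≤ μ {ω | Y' n ω ∈ S} + μ {ω | Y n ω ≠ Y' n ω} := fun n => by
      refine (measure_mono fun ω hω => ?_).trans (measure_union_le _ _)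
      by_cases he : Y n ω = Y' n ω
      · left
        change Y' n ω ∈ S
        rw [← he]
        exact hω
      · right
        exact he
    have hlo : ∀ n, μ {ω | Y' n ω ∈ S} - μ {ω | Y n ω ≠ Y' n ω} ≤ μ {ω | Y n ω ∈ S} := fun n => by
      rw [tsub_le_iff_right]
      refine (measure_mono fun ω hω => ?_).trans (measure_union_le _ _)
      by_cases he : Y n ω = Y' n ω
      · left
        change Y n ω ∈ S
        rw [he]
        exact hω
      · right
        exact he
    refine tendsto_of_tendsto_of_tendsto_of_le_of_le (h := fun n => μ {ω | Y' n ω ∈ S}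
      + μ {ω | Y n ω ≠ Y' n ω}) (g := fun n => μ {ω | Y' n ω ∈ S} - μ {ω | Y n ω ≠ Y' n ω})
      ?_ ?_ hlo hup
    · simpa using ENNReal.Tendsto.sub h1 hne (Or.inl (measure_ne_top _ _))
    · simpa using h1.add hne
  exact ⟨hport (Iic x) measurableSet_Iic (by simp), hport (Ioi x) measurableSet_Ioi (by simp)⟩

end InMeasure


/-- The naive hazard rate in terms of the estimators `a i` of the subdensities and the estimators
`b i` of their derivatives. -/
def hazardRatio (a₀ a₁ b₀ b₁ : ℝ) : ℝ :=
  ((a₀ + a₁) * b₁ - (b₀ + b₁) * a₁) / (a₀ + a₁) ^ 2 / (1 - a₁ / (a₀ + a₁))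

/-- Since one minus the estimated `F` is `a₀ / (a₀ + a₁)`, a factor `a₀ + a₁` cancels. For `a₀ = 0`
both sides are zero by the convention for division by zero. -/
lemma hazardRatio_eq {a₀ a₁ b₀ b₁ : ℝ} (ha : a₀ + a₁ ≠ 0) :
    hazardRatio a₀ a₁ b₀ b₁ = (a₀ * b₁ - b₀ * a₁) / ((a₀ + a₁) * a₀) := by
  have h1 : 1 - a₁ / (a₀ + a₁) = a₀ / (a₀ + a₁) := by field_simp; ring
  unfold hazardRatio
  rw [h1, div_div_eq_mul_div, div_mul_eq_mul_div, div_div]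
  rcases eq_or_ne a₀ 0 with h0 | h0
  · simp [h0]
  · field_simp
    ring

/-! ### The error of the naive hazard as Gaussian part plus remainder -/

section Slutsky

variable {Ω : Type*} [MeasurableSpace Ω] {μ : Measure Ω} [IsProbabilityMeasure μ]
  {X T : ℕ → Ω → ℝ} {P Q : Measure ℝ} [IsProbabilityMeasure P] [IsProbabilityMeasure Q]
  {g k : ℝ → ℝ} {t c : ℝ}

/-- The naive hazard rate estimator, for the bandwidth `c n ^ (-1/7)`, wherever `t` is not in the
boundary region. -/
def interiorHazard (X T : ℕ → Ω → ℝ) (k : ℝ → ℝ) (t c : ℝ) (n : ℕ) (ω : Ω) : ℝ :=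
  hazardRatio (kernelMean X T k t (1 / (c * (root7 n)⁻¹)) (c * (root7 n)⁻¹) 0 n ω)
    (kernelMean X T k t (1 / (c * (root7 n)⁻¹)) (c * (root7 n)⁻¹) 1 n ω)
    (kernelMean X T (deriv k) t (1 / (c * (root7 n)⁻¹) ^ 2) (c * (root7 n)⁻¹) 0 n ω)
    (kernelMean X T (deriv k) t (1 / (c * (root7 n)⁻¹) ^ 2) (c * (root7 n)⁻¹) 1 n ω)

lemma aemeasurable_interiorHazard (hm : IsModel μ X T P Q) (hk : CondK1 k) (n : ℕ) :
    AEMeasurable (interiorHazard X T k t c n) μ := by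
  have h0 := fun i => aemeasurable_kernelMean (t := t) hm hk.continuous (1 / (c * (root7 n)⁻¹))
    (c * (root7 n)⁻¹) i n
  have h1 := fun i => aemeasurable_kernelMean (t := t) hm hk.continuous_deriv
    (1 / (c * (root7 n)⁻¹) ^ 2) (c * (root7 n)⁻¹) i n
  have m0 := h0 0
  have m1 := h0 1
  have m2 := h1 0
  have m3 := h1 1
  exact ((((m0.add m1).mul m3).sub ((m2.add m3).mul m1)).div ((m0.add m1).pow_const 2)).div
    (aemeasurable_const.sub (m1.div (m0.add m1)))

lemma hazardNaive_eq_interiorHazard (hk : CondK1 k) {n : ℕ} (hs : c * (root7 n)⁻¹ < t) (ω : Ω) :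
    hazardNaive k (c * (root7 n)⁻¹) n (fun j => T j ω) (fun j => status (X j ω) (T j ω)) t
      = interiorHazard X T k t c n ω := by
  unfold hazardNaive fNaive FNaive gHat interiorHazard hazardRatio kernelMean
  rw [gHatSub_of_lt hs, gHatSub_of_lt hs, (hk.hasDerivAt_gHatSub hs).deriv,
    (hk.hasDerivAt_gHatSub hs).deriv]

/-- Asymptotic normality of the naive hazard rate estimator, in terms of the subdensities `q i`
of the observations. -/
lemma tendstoInDistribution_interiorHazard (hm : IsModel μ X T P Q) (hQ : IsDensity Q g)
    (hk : CondK1 k) (hc : 0 < c) {q q' q₂ : Fin 2 → ℝ → ℝ} {q₃ : Fin 2 → ℝ}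
    (hqdef : q = subDensity (cdf P) g)
    (hq : ∀ i, ∀ᶠ y in 𝓝 t, HasDerivAt (q i) (q' i y) y)
    (hq' : ∀ i, ∀ᶠ y in 𝓝 t, HasDerivAt (q' i) (q₂ i y) y)
    (hq₂ : ∀ i, HasDerivAt (q₂ i) (q₃ i) t) (h0 : q 0 t ≠ 0) (h1 : q 0 t + q 1 t ≠ 0)
    {l B : ℝ} (hl : l = (q 0 t * q' 1 t - q' 0 t * q 1 t) / ((q 0 t + q 1 t) * q 0 t))
    (hB : B = c ^ 2 * m2 k / 2 * ((q 0 t * q₃ 1 - q 1 t * q₃ 0 + q₂ 0 t * q' 1 t - q₂ 1 t * q' 0 t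
      - l * ((q₂ 0 t + q₂ 1 t) * q 0 t + (q 0 t + q 1 t) * q₂ 0 t))
        / ((q 0 t + q 1 t) * q 0 t))) {v : NNReal}
    (hv : (v : ℝ) = (c ^ 3)⁻¹ * ((∫ u, deriv k u ^ 2) *
      (q 1 t ^ 2 / ((q 0 t + q 1 t) ^ 2 * q 0 t) + q 1 t / (q 0 t + q 1 t) ^ 2))) :
    TendstoInDistribution (fun (n : ℕ) ω => root7 n ^ 2 * (interiorHazard X T k t c n ω - l)) atTop
      (fun x : ℝ => x + B) (fun _ => μ) (gaussianReal 0 v) := by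
  set γ := q 0 t + q 1 t with hγ
  -- The partial derivatives of the hazard ratio with respect to `b₀` and `b₁` at the limit point.
  set w : Fin 2 → ℝ := ![-(q 1 t / (γ * q 0 t)), 1 / γ] with hw
  have hqc : ∀ i, ∀ᶠ y in 𝓝 t, ContinuousAt (subDensity (cdf P) g i) y := fun i => by
    rw [← hqdef]
    exact (hq i).mono fun y hy => hy.continuousAt
  have hV := tendstoInDistribution_derivFluct (μ := μ) (t := t) (v := v) hm hQ hk hc hqc w (by
    rw [hv, ← hqdef, Fin.sum_univ_two]
    simp only [hw, Matrix.cons_val_zero, Matrix.cons_val_one]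
    congr 2
    field_simp)
  have hp : ∀ i, TendstoInMeasure μ _ atTop _ := fun i =>
    tendstoInMeasure_scaled_gHatSub hm hQ hk hc (hqdef ▸ hq i) (hq' i).self_of_nhds
  have ha : ∀ i, TendstoInMeasure μ _ atTop _ := fun i =>
    tendstoInMeasure_gHatSub (i := i) hm hQ hk hc (hqc i)
  have hb : ∀ i, TendstoInMeasure μ _ atTop _ := fun i =>
    tendstoInMeasure_deriv_gHatSub hm hQ hk hc (hqdef ▸ hq i)
      ((hq' i).mono fun y hy => hy.continuousAt)
  have hβ : ∀ i, TendstoInMeasure μ _ atTop _ := fun i =>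
    tendstoInMeasure_const_of_tendsto (μ := μ)
      (tendsto_scaled_derivMean hk hc (hqdef ▸ hq i) (hq' i) (hq₂ i))
  have he : ∀ i, TendstoInMeasure μ _ atTop _ := fun i =>
    tendstoInMeasure_const_of_tendsto (μ := μ)
      (tendsto_derivMean hk hc (hqdef ▸ hq i) ((hq' i).mono fun y hy => hy.continuousAt))
  rw [← hqdef] at hp ha
  set p' : Fin 2 → ℕ → Ω → ℝ := fun i n ω => root7 n ^ 2 * (kernelMean X T k t
    (1 / (c * (root7 n)⁻¹)) (c * (root7 n)⁻¹) i n ω - q i t) with hp'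
  set a' : Fin 2 → ℕ → Ω → ℝ := fun i n ω => kernelMean X T k t
    (1 / (c * (root7 n)⁻¹)) (c * (root7 n)⁻¹) i n ω with ha'
  set b' : Fin 2 → ℕ → Ω → ℝ := fun i n ω => kernelMean X T (deriv k) t
    (1 / (c * (root7 n)⁻¹) ^ 2) (c * (root7 n)⁻¹) i n ω with hb'
  set e' : Fin 2 → ℕ → Ω → ℝ := fun i n _ => derivMean (cdf P) g k t (c * (root7 n)⁻¹) i with he'
  set β' : Fin 2 → ℕ → Ω → ℝ := fun i n _ =>
    root7 n ^ 2 * (derivMean (cdf P) g k t (c * (root7 n)⁻¹) i - q' i t) with hβ'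
  let ι := Fin 2 ⊕ Fin 2 ⊕ Fin 2 ⊕ Fin 2 ⊕ Fin 2
  let Z : ι → ℕ → Ω → ℝ := Sum.elim p' (Sum.elim a' (Sum.elim b' (Sum.elim β' e')))
  let z : ι → ℝ := Sum.elim (fun i => c ^ 2 * (m2 k * q₂ i t / 2)) (Sum.elim (fun i => q i t)
    (Sum.elim (fun i => q' i t) (Sum.elim (fun i => c ^ 2 * (m2 k * q₃ i / 2)) fun i => q' i t)))
  have hZ : ∀ j, TendstoInMeasure μ (Z j) atTop fun _ => z j := by
    rintro (i | i | i | i | i)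
    exacts [hp i, ha i, hb i, hβ i, he i]
  let p : Fin 2 → (ι → ℝ) → ℝ := fun i x => x (Sum.inl i)
  let a : Fin 2 → (ι → ℝ) → ℝ := fun i x => x (Sum.inr (Sum.inl i))
  let b : Fin 2 → (ι → ℝ) → ℝ := fun i x => x (Sum.inr (Sum.inr (Sum.inl i)))
  let β : Fin 2 → (ι → ℝ) → ℝ := fun i x => x (Sum.inr (Sum.inr (Sum.inr (Sum.inl i))))
  let e : Fin 2 → (ι → ℝ) → ℝ := fun i x => x (Sum.inr (Sum.inr (Sum.inr (Sum.inr i))))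
  -- The scaled error `n^(2/7) ((a₀ + a₁) a₀ - γ q₀)` of the denominator.
  let S : (ι → ℝ) → ℝ := fun x => (p 0 x + p 1 x) * a 0 x + γ * p 0 x
  -- An exact expression for the scaled error minus its Gaussian part, in place of a delta method.
  -- The last summand couples the unscaled deviations `b - e`, which tend to zero, with the bounded
  -- `S`, so it disappears in the limit.
  let Φ : (ι → ℝ) → ℝ := fun x => (q 0 t * β 1 x - q 1 t * β 0 x + p 0 x * b 1 x - p 1 x * b 0 x
    - l * S x - (w 1 * (b 1 x - e 1 x) + w 0 * (b 0 x - e 0 x)) * S x)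
      / ((a 0 x + a 1 x) * a 0 x)
  have hR := tendstoInMeasure_of_continuousAt (μ := μ) hZ (Φ := Φ)
    (U := {x | a 0 x ≠ 0 ∧ a 0 x + a 1 x ≠ 0})
    (R := fun n ω => root7 n ^ 2 * (interiorHazard X T k t c n ω - l)
      - derivFluct X T (cdf P) g k t c w n ω) ?_ ?_ ?_
  · have hz : Φ z = B := by
      rw [hB]
      simp only [Φ, S, p, a, b, β, e, z, Sum.elim_inl, Sum.elim_inr, sub_self, mul_zero, add_zero,
        zero_mul, sub_zero]
      rw [← hγ]
      field_simp
    rw [hz] at hR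
    refine (hV.add_of_tendstoInMeasure_const hR fun n => ?_).congr
      (fun n => Eventually.of_forall fun ω => ?_) (ae_eq_refl _)
    · exact (((aemeasurable_interiorHazard hm hk n).sub_const _).const_mul _).sub
        (hV.forall_aemeasurable n)
    · simp
  · refine ContinuousAt.div (by fun_prop) (by fun_prop) (mul_ne_zero h1 h0)
  · refine IsOpen.mem_nhds ?_ ⟨h0, h1⟩
    exact (isOpen_ne_fun (by fun_prop) continuous_const).inter
      (isOpen_ne_fun (by fun_prop) continuous_const)
  · filter_upwards [eventually_gt_atTop 0] with n hn ω hU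
    have hx := (root7_pos hn).ne'
    obtain ⟨hU0, hU1⟩ := hU
    change a' 0 n ω ≠ 0 at hU0
    change a' 0 n ω + a' 1 n ω ≠ 0 at hU1
    change root7 n ^ 2 * (hazardRatio (a' 0 n ω) (a' 1 n ω) (b' 0 n ω) (b' 1 n ω) - l)
      - derivFluct X T (cdf P) g k t c w n ω
      = (q 0 t * β' 1 n ω - q 1 t * β' 0 n ω + p' 0 n ω * b' 1 n ω - p' 1 n ω * b' 0 n ω
        - l * ((p' 0 n ω + p' 1 n ω) * a' 0 n ω + γ * p' 0 n ω)
        - (w 1 * (b' 1 n ω - e' 1 n ω) + w 0 * (b' 0 n ω - e' 0 n ω))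
          * ((p' 0 n ω + p' 1 n ω) * a' 0 n ω + γ * p' 0 n ω))
        / ((a' 0 n ω + a' 1 n ω) * a' 0 n ω)
    rw [hazardRatio_eq hU1]
    have eV : derivFluct X T (cdf P) g k t c w n ω = root7 n ^ 2 *
        (w 0 * (b' 0 n ω - e' 0 n ω) + w 1 * (b' 1 n ω - e' 1 n ω)) := by
      unfold derivFluct
      rw [Fin.sum_univ_two]
    have ep : ∀ i, p' i n ω = root7 n ^ 2 * (a' i n ω - q i t) := fun i => rfl
    have eβ : ∀ i, β' i n ω = root7 n ^ 2 * (e' i n ω - q' i t) := fun i => rfl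
    rw [eV, ep, ep, eβ, eβ, hl]
    simp only [hw, Matrix.cons_val_zero, Matrix.cons_val_one]
    generalize a' 0 n ω = A0 at *
    generalize a' 1 n ω = A1 at *
    generalize b' 0 n ω = B0
    generalize b' 1 n ω = B1
    generalize e' 0 n ω = E0
    generalize e' 1 n ω = E1
    generalize root7 n = x at *
    clear_value γ
    generalize q 1 t = Q1 at *
    generalize q 0 t = Q0 at *
    generalize q' 1 t = D1
    generalize q' 0 t = D0
    rw [hγ] at h1 ⊢
    field_simp
    ring

end Slutsky


/-! ### Regularity of the subdensities near `t` -/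

section Regularity

variable {P Q : Measure ℝ} [IsProbabilityMeasure P] [IsProbabilityMeasure Q] {f g : ℝ → ℝ}
  {M₀ t : ℝ}

lemma ThirdDerivContinuousAt.eventually_hasDerivAt (h : ThirdDerivContinuousAt f t) :
    ∀ᶠ y in 𝓝 t, HasDerivAt f (deriv f y) y ∧ HasDerivAt (deriv f) (iteratedDeriv 2 f y) y ∧
      HasDerivAt (iteratedDeriv 2 f) (iteratedDeriv 3 f y) y := by
  refine h.1.mono fun y hy => ⟨?_, ?_, ?_⟩
  · have := (hy 0 (by norm_num)).hasDerivAt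
    rwa [iteratedDeriv_zero] at this
  · have := (hy 1 (by norm_num)).hasDerivAt
    rw [← iteratedDeriv_succ] at this
    rwa [iteratedDeriv_one] at this
  · have := (hy 2 (by norm_num)).hasDerivAt
    rwa [← iteratedDeriv_succ] at this

lemma IsDensity.cdf_eq (hP : IsDensity P f) (x : ℝ) : cdf P x = ∫ y in Iic x, f y := by
  have h := hP.integral_eq ((Iic x).indicator 1)
  rw [integral_indicator_one measurableSet_Iic] at h
  rw [cdf_eq_real, h, ← integral_indicator measurableSet_Iic]
  congr 1; ext y
  by_cases hy : y ∈ Iic x <;> simp [hy]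

lemma IsDensity.hasDerivAt_cdf (hP : IsDensity P f) {x : ℝ} (hf : ContinuousAt f x) :
    HasDerivAt (cdf P) (f x) x := by
  have h1 : ∀ y, cdf P y = (∫ u in Iic 0, f u) + ∫ u in 0..y, f u := fun y => by
    rw [hP.cdf_eq, ← intervalIntegral.integral_Iic_sub_Iic hP.integrable.integrableOn
      hP.integrable.integrableOn]
    ring
  have h2 := intervalIntegral.integral_hasDerivAt_right
    (hP.integrable.intervalIntegrable (a := 0) (b := x))
    hP.1.stronglyMeasurable.stronglyMeasurableAtFilter hf
  have h3 := h2.const_add (∫ u in Iic 0, f u)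
  rwa [← funext h1] at h3

/-- Beyond `M₀` all mass has been collected. So `t` lies inside the support, where both densities
are bounded away from zero. -/
lemma CondF1.lt_of_cdf_lt_one (hF : CondF1 P f M₀) (ht : cdf P t < 1) : t < M₀ := by
  by_contra hcon
  have h1 : P (Iic t) = 1 := by
    rw [prob_compl_eq_zero_iff measurableSet_Iic |>.symm]
    refine measure_mono_null ?_ (Measure.measure_compl_support (μ := P))
    intro y hy hy'
    rw [hF.2.1] at hy'
    exact hy (hy'.2.trans (not_lt.1 hcon))
  rw [cdf_eq_real, measureReal_def, h1] at ht
  simp at ht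

lemma CondF1.cdf_pos (hF : CondF1 P f M₀) (ht : 0 < t) (htM : t < M₀) : 0 < cdf P t :=
  (cdf_nonneg P 0).trans_lt (hF.2.2.1 ⟨le_rfl, hF.1.le⟩ ⟨ht.le, htM.le⟩ ht)

lemma CondF1.eventually_pos (hF : CondF1 P f M₀) (ht : 0 < t) (htM : t < M₀) :
    ∀ᶠ y in 𝓝 t, 0 < f y := by
  obtain ⟨-, -, -, -, ε, hε, H⟩ := hF
  filter_upwards [Icc_mem_nhds ht htM] with y hy
  exact hε.trans_le (H y hy)

lemma CondG1.eventually_pos (hG : CondG1 Q g M₀) (ht : 0 < t) (htM : t < M₀) :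
    ∀ᶠ y in 𝓝 t, 0 < g y := by
  obtain ⟨-, -, -, ⟨ε, hε, H⟩, -⟩ := hG
  filter_upwards [Icc_mem_nhds ht htM] with y hy
  exact hε.trans_le (H y hy)

lemma CondG1.integral_Iic_zero (hG : CondG1 Q g M₀) : ∫ y in Iic 0, g y = 0 := by
  have hQ := hG.2.2.1
  have h1 : Q (Iio 0) = 0 := by
    refine measure_mono_null ?_ (Measure.measure_compl_support (μ := Q))
    intro y hy hy'
    rw [hG.1] at hy'
    exact not_lt.2 (mem_Ici.1 hy') hy
  rw [integral_Iic_eq_integral_Iio]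
  have h := hQ.integral_eq ((Iio 0).indicator 1)
  rw [integral_indicator_one measurableSet_Iio, measureReal_def, h1] at h
  rw [← integral_indicator measurableSet_Iio]
  refine Eq.trans ?_ h.symm
  congr 1; ext y
  by_cases hy : y ∈ Iio (0 : ℝ) <;> simp [hy]

/-- The second derivatives of the subdensities, if `f` is the derivative of `F`. -/
def subDensityDeriv₂ (F g f : ℝ → ℝ) (i : Fin 2) (y : ℝ) : ℝ :=
  (if i = 1 then deriv f y else -deriv f y) * g y
    + 2 * ((if i = 1 then f y else -f y) * deriv g y)
    + (if i = 1 then F y else 1 - F y) * iteratedDeriv 2 g y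

/-- The third derivatives of the subdensities. -/
def subDensityDeriv₃ (F g f : ℝ → ℝ) (i : Fin 2) (y : ℝ) : ℝ :=
  (if i = 1 then iteratedDeriv 2 f y else -iteratedDeriv 2 f y) * g y
    + 3 * ((if i = 1 then deriv f y else -deriv f y) * deriv g y)
    + 3 * ((if i = 1 then f y else -f y) * iteratedDeriv 2 g y)
    + (if i = 1 then F y else 1 - F y) * iteratedDeriv 3 g y

variable {F : ℝ → ℝ} {y : ℝ}

lemma hasDerivAt_subDensityDeriv (hF : HasDerivAt F (f y) y) (hf : HasDerivAt f (deriv f y) y)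
    (hg : HasDerivAt g (deriv g y) y) (hg₂ : HasDerivAt (deriv g) (iteratedDeriv 2 g y) y)
    (i : Fin 2) :
    HasDerivAt (subDensityDeriv F g f (deriv g) i) (subDensityDeriv₂ F g f i y) y := by
  unfold subDensityDeriv subDensityDeriv₂
  split_ifs
  · exact ((hf.mul hg).add (hF.mul hg₂)).congr_deriv (by ring)
  · exact ((hf.neg.mul hg).add ((hF.const_sub 1).mul hg₂)).congr_deriv (by simp; ring)

lemma hasDerivAt_subDensityDeriv₂ (hF : HasDerivAt F (f y) y) (hf : HasDerivAt f (deriv f y) y)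
    (hf₂ : HasDerivAt (deriv f) (iteratedDeriv 2 f y) y)
    (hg : HasDerivAt g (deriv g y) y) (hg₂ : HasDerivAt (deriv g) (iteratedDeriv 2 g y) y)
    (hg₃ : HasDerivAt (iteratedDeriv 2 g) (iteratedDeriv 3 g y) y) (i : Fin 2) :
    HasDerivAt (subDensityDeriv₂ F g f i) (subDensityDeriv₃ F g f i y) y := by
  unfold subDensityDeriv₂ subDensityDeriv₃
  split_ifs
  · exact (((hf₂.mul hg).add ((hf.mul hg₂).const_mul 2)).add (hF.mul hg₃)).congr_deriv (by ring)
  · exact (((hf₂.neg.mul hg).add ((hf.neg.mul hg₂).const_mul 2)).add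
      ((hF.const_sub 1).mul hg₃)).congr_deriv (by simp; ring)

end Regularity

/-! ### The optimal bandwidth constant -/

section Optimal

variable {F f g k : ℝ → ℝ} {t : ℝ}

lemma CondK1.m2_pos (hk : CondK1 k) : 0 < m2 k := by
  have hc := hk.continuous
  have hcs : HasCompactSupport k :=
    hasCompactSupport_of_eq_zero fun u hu => hk.eq_zero_of_one_le hu
  obtain ⟨u, hu⟩ : ∃ u, u ^ 2 * k u ≠ 0 := by
    by_contra! hcon
    have h1 : k =ᵐ[volume] 0 := by
      filter_upwards [compl_mem_ae_iff.2 (measure_singleton (0 : ℝ))] with u hu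
      exact (mul_eq_zero.1 (hcon u)).resolve_left (pow_ne_zero 2 hu)
    have h2 := hk.2.1
    rw [integral_eq_zero_of_ae h1] at h2
    exact zero_ne_one h2
  exact Continuous.integral_pos_of_hasCompactSupport_nonneg_nonzero (f := fun u => u ^ 2 * k u)
    (by fun_prop) hcs.mul_left (fun u => mul_nonneg (sq_nonneg u) (hk.1 u)) hu

lemma CondK1.integral_deriv_sq_pos (hk : CondK1 k) : 0 < ∫ u, deriv k u ^ 2 := by
  have hc := hk.continuous_deriv
  have hz : ∀ u, 1 ≤ |u| → deriv k u ^ 2 = 0 := fun u hu => by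
    rw [hk.deriv_eq_zero_of_one_le hu, zero_pow two_ne_zero]
  obtain ⟨u, hu⟩ : ∃ u, deriv k u ^ 2 ≠ 0 := by
    by_contra! hcon
    have h1 : ∀ u, k u = 0 := fun u => by
      rw [is_const_of_deriv_eq_zero (hk.2.2.2.2.differentiable (by norm_num))
        (fun u => pow_eq_zero_iff two_ne_zero |>.1 (hcon u)) u 1]
      exact hk.eq_zero_of_one_le (by simp)
    have h2 := hk.2.1
    simp_rw [h1] at h2
    simp at h2
  exact Continuous.integral_pos_of_hasCompactSupport_nonneg_nonzero (f := fun u => deriv k u ^ 2)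
    (by fun_prop) (hasCompactSupport_of_eq_zero hz) (fun u => sq_nonneg _) hu

/-- The first order condition for minimizing `b c⁴ / 4 + V / c³` with `b = m₂² r²`, namely `b c⁷ =
3V`. -/
lemma cOpt_pow (hk : CondK1 k) (hF0 : 0 < F t) (hF1 : F t < 1) (hg : 0 < g t)
    (hr : rFun F f g t ≠ 0) :
    0 < cOpt F f g k t ∧ cOpt F f g k t ^ 7 * (m2 k ^ 2 * rFun F f g t ^ 2)
      = 3 * (F t / (g t * (1 - F t))) * ∫ u, deriv k u ^ 2 := by
  have h1 : 0 < 1 - F t := sub_pos.2 hF1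
  have hI := hk.integral_deriv_sq_pos
  have hm := hk.m2_pos
  have hA : 0 < 3 * (F t / (g t * (1 - F t))) * ∫ u, deriv k u ^ 2 := by positivity
  have hB : 0 < m2 k ^ 2 * rFun F f g t ^ 2 := by positivity
  unfold cOpt
  refine ⟨mul_pos (Real.rpow_pos_of_pos hA _) (Real.rpow_pos_of_pos hB _), ?_⟩
  rw [mul_pow, ← Real.rpow_natCast, ← Real.rpow_natCast, ← Real.rpow_mul hA.le,
    ← Real.rpow_mul hB.le]
  norm_num
  rw [Real.rpow_neg_one]
  field_simp

/-- Once `V` is expressed through the critical point `s`, the excess is `(c - s)²` times a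
polynomial with positive coefficients over `12 c³`, so strict and global minimality need no
calculus. -/
lemma aMSE_cOpt_lt (hk : CondK1 k) (hF0 : 0 < F t) (hF1 : F t < 1) (hg : 0 < g t)
    (hr : rFun F f g t ≠ 0) {c : ℝ} (hc : 0 < c) (hne : c ≠ cOpt F f g k t) :
    aMSE F f g k t (cOpt F f g k t) < aMSE F f g k t c := by
  obtain ⟨hs, hs7⟩ := cOpt_pow hk hF0 hF1 hg hr
  have h1 : 0 < 1 - F t := sub_pos.2 hF1
  have hB : 0 < m2 k ^ 2 * rFun F f g t ^ 2 := by
    have := hk.m2_pos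
    positivity
  set s := cOpt F f g k t
  set b := m2 k ^ 2 * rFun F f g t ^ 2 with hb
  have e : ∀ x : ℝ, 0 < x → aMSE F f g k t x = b / 4 * x ^ 4 + b * s ^ 7 / 3 / x ^ 3 := by
    intro x hx
    rw [mul_comm b (s ^ 7), hs7, hb]
    unfold aMSE hazardBias hazardVar
    field_simp
    ring
  rw [e s hs, e c hc]
  have hsq : 0 < (c - s) ^ 2 := by
    have := sub_ne_zero.2 hne
    positivity
  have key : b / 4 * c ^ 4 + b * s ^ 7 / 3 / c ^ 3 - (b / 4 * s ^ 4 + b * s ^ 7 / 3 / s ^ 3)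
      = b * (c - s) ^ 2 * (3 * c ^ 5 + 6 * c ^ 4 * s + 9 * c ^ 3 * s ^ 2 + 12 * c ^ 2 * s ^ 3
        + 8 * c * s ^ 4 + 4 * s ^ 5) / (12 * c ^ 3) := by
    field_simp
    ring
  have : 0 < b * (c - s) ^ 2 * (3 * c ^ 5 + 6 * c ^ 4 * s + 9 * c ^ 3 * s ^ 2 + 12 * c ^ 2 * s ^ 3
        + 8 * c * s ^ 4 + 4 * s ^ 5) / (12 * c ^ 3) := by positivity
  linarith

end Optimal


/-! ### Identification of the limit and agreement of the estimators -/

section Main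

variable {Ω : Type*} [MeasurableSpace Ω] {μ : Measure Ω} [IsProbabilityMeasure μ]
  {X T : ℕ → Ω → ℝ} {P Q : Measure ℝ} [IsProbabilityMeasure P] [IsProbabilityMeasure Q]
  {f₀ g k : ℝ → ℝ} {M₀ t c : ℝ}

lemma tendstoInDistribution_interiorHazard_hazard (hm : IsModel μ X T P Q) (hF : CondF1 P f₀ M₀)
    (hG : CondG1 Q g M₀) (hk : CondK1 k) (ht : 0 < t) (hFt : cdf P t < 1)
    (hf₀t : ThirdDerivContinuousAt f₀ t) (hgt : ThirdDerivContinuousAt g t) (hc : 0 < c) :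
    TendstoInDistribution (fun (n : ℕ) ω => root7 n ^ 2 * (interiorHazard X T k t c n ω
      - hazard (cdf P) f₀ t)) atTop (fun x : ℝ => x + hazardBias (cdf P) f₀ g k t c) (fun _ => μ)
      (gaussianReal 0 (hazardVar (cdf P) g k t c).toNNReal) := by
  have htM := hF.lt_of_cdf_lt_one hFt
  have hFpos := hF.cdf_pos ht htM
  have hgpos := (hG.eventually_pos ht htM).self_of_nhds
  have hG1 : 0 < 1 - cdf P t := sub_pos.2 hFt
  have hf := hf₀t.eventually_hasDerivAt
  have hg := hgt.eventually_hasDerivAt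
  have hq : ∀ i, ∀ᶠ y in 𝓝 t, HasDerivAt (subDensity (cdf P) g i)
      (subDensityDeriv (cdf P) g f₀ (deriv g) i y) y := fun i => by
    filter_upwards [hf, hg] with y hfy hgy
    exact hasDerivAt_subDensity (hF.2.2.2.1.hasDerivAt_cdf hfy.1.continuousAt) hgy.1 i
  have hq' : ∀ i, ∀ᶠ y in 𝓝 t, HasDerivAt (subDensityDeriv (cdf P) g f₀ (deriv g) i)
      (subDensityDeriv₂ (cdf P) g f₀ i y) y := fun i => by
    filter_upwards [hf, hg] with y hfy hgy
    exact hasDerivAt_subDensityDeriv (hF.2.2.2.1.hasDerivAt_cdf hfy.1.continuousAt) hfy.1 hgy.1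
      hgy.2.1 i
  have hq₂ : ∀ i, HasDerivAt (subDensityDeriv₂ (cdf P) g f₀ i)
      (subDensityDeriv₃ (cdf P) g f₀ i t) t := fun i => by
    have hfy := hf.self_of_nhds
    have hgy := hg.self_of_nhds
    exact hasDerivAt_subDensityDeriv₂ (hF.2.2.2.1.hasDerivAt_cdf hfy.1.continuousAt) hfy.1 hfy.2.1
      hgy.1 hgy.2.1 hgy.2.2 i
  have hsum : subDensity (cdf P) g 0 t + subDensity (cdf P) g 1 t = g t := by
    rw [subDensity_zero, subDensity_one]
    ring
  have hne := hgpos.ne'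
  have hne1 := hG1.ne'
  refine tendstoInDistribution_interiorHazard hm hG.2.2.1 hk hc rfl hq hq' hq₂ ?_ ?_ ?_ ?_ ?_
  · rw [subDensity_zero]
    positivity
  · rwa [hsum]
  · rw [hsum, subDensity_zero, subDensity_one]
    simp only [subDensityDeriv, hazard, Fin.isValue, zero_ne_one, if_true, if_false]
    field_simp
    ring
  -- The third derivative of `g` enters `q₀ q₁''' - q₁ q₀'''` with coefficients `(1 - F) g F` and `F
  -- g (1 - F)`, which cancel; this is why it is absent from `r`.
  · rw [hsum, subDensity_zero, subDensity_one]
    simp only [subDensityDeriv, subDensityDeriv₂, subDensityDeriv₃, hazard, hazardBias, rFun,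
      Fin.isValue, zero_ne_one, if_true, if_false]
    generalize iteratedDeriv 2 f₀ t = f2
    generalize iteratedDeriv 2 g t = g2
    generalize iteratedDeriv 3 g t = g3
    generalize deriv f₀ t = f1
    generalize deriv g t = g1
    generalize f₀ t = f0
    generalize g t = g0 at *
    generalize m2 k = m
    generalize cdf P t = F at *
    field_simp
    ring
  · have hI := hk.integral_deriv_sq_pos
    rw [Real.coe_toNNReal _ (by unfold hazardVar; positivity), hsum, subDensity_zero,
      subDensity_one]
    unfold hazardVar
    field_simp
    ring

/-- The maximum smoothed likelihood and naive hazard rate estimators agree at `t` with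
high probability. -/
lemma tendsto_measure_hazardMS_ne (hm : IsModel μ X T P Q) (hF : CondF1 P f₀ M₀)
    (hG : CondG1 Q g M₀) (hk : CondK1 k) (ht : 0 < t) (hFt : cdf P t < 1)
    (hf₀t : ThirdDerivContinuousAt f₀ t) (hgt : ThirdDerivContinuousAt g t) (hc : 0 < c) :
    Tendsto (fun n => μ {ω | hazardMS k (c * (root7 n)⁻¹) n (fun j => T j ω)
      (fun j => status (X j ω) (T j ω)) t ≠ interiorHazard X T k t c n ω}) atTop (𝓝 0) := by
  have htM := hF.lt_of_cdf_lt_one hFt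
  have hQ := hG.2.2.1
  obtain ⟨δ, hδ, H⟩ := Metric.eventually_nhds_iff.1 (hf₀t.eventually_hasDerivAt.and
    (hgt.eventually_hasDerivAt.and ((hF.eventually_pos ht htM).and (hG.eventually_pos ht htM))))
  -- Six rather than five, so that the window of radius `5r` stays strictly inside both the regular
  -- neighbourhood and the positive half-line.
  set r := min δ t / 6 with hr
  have hmin : 0 < min δ t := lt_min hδ ht
  have hrδ : 5 * r < δ := by linarith [min_le_left δ t]
  have hrt : 5 * r < t := by linarith [min_le_right δ t]
  have hin : ∀ y ∈ Icc (t - 5 * r) (t + 5 * r), dist y t < δ := fun y hy => by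
    rw [Real.dist_eq, abs_lt]
    constructor <;> linarith [hy.1, hy.2]
  obtain ⟨κ, hκ, hMS⟩ := hk.exists_hazardMS_eq (F := cdf P) (g := g) (f := f₀) (g' := deriv g)
    (monotone_cdf P) (cdf_nonneg P) (cdf_le_one P) hQ.integrable hQ.2.1 hQ.integral_eq_one
    hG.integral_Iic_zero (t := t) (r := r) (by positivity) hrt
    (fun y hy => hF.2.2.2.1.hasDerivAt_cdf (H (hin y hy)).1.1.continuousAt)
    (fun y hy => (H (hin y hy)).2.1.1)
    (fun y hy => (H (hin y hy)).1.1.continuousAt.continuousWithinAt)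
    (fun y hy => (H (hin y hy)).2.1.2.1.continuousAt.continuousWithinAt)
    (fun y hy => (H (hin y hy)).2.2.1) (fun y hy => (H (hin y hy)).2.2.2)
  -- With `η = a n^(-2/7)` the Glivenko-Cantelli radius `3η` is exactly `κ h²`. The failure bound `2
  -- (1/η + 3) / (n η²)` then has terms of order `n^(-1/7)` and `n^(-3/7)`.
  set a := κ * c ^ 2 / 3 with ha
  have ha0 : 0 < a := by positivity
  have hinv : Tendsto (fun n => (root7 n)⁻¹) atTop (𝓝 0) :=
    tendsto_inv_atTop_zero.comp tendsto_root7
  have hlim : Tendsto (fun n => ENNReal.ofReal (2 / a ^ 3 * (root7 n)⁻¹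
      + 6 / a ^ 2 * (root7 n)⁻¹ ^ 3)) atTop (𝓝 0) := by
    have h1 := (hinv.const_mul (2 / a ^ 3)).add ((hinv.pow 3).const_mul (6 / a ^ 2))
    have h2 := ENNReal.tendsto_ofReal h1
    simpa using h2
  refine tendsto_of_tendsto_of_tendsto_of_le_of_le' tendsto_const_nhds hlim
    (Eventually.of_forall fun _ => zero_le) ?_
  filter_upwards [eventually_gt_atTop 0, (tendsto_bandwidth hc).eventually
    (Ioo_mem_nhdsGT (lt_min hκ ht))] with n hn hh
  have hx := root7_pos hn
  have hη : 0 < a * (root7 n)⁻¹ ^ 2 := by positivity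
  refine (measure_mono fun ω hω => ?_).trans ((hm.measure_not_isClose_le hQ hG.integral_Iic_zero hn
    hη).trans (ENNReal.ofReal_le_ofReal (le_of_eq ?_)))
  · intro hcl
    refine hω ?_
    rw [← hazardNaive_eq_interiorHazard hk (hh.2.trans_le (min_le_right _ _))]
    refine hMS _ hh.1 (hh.2.trans_le (min_le_left _ _)) _ _ _ ?_
    convert hcl using 1
    rw [ha]
    ring
  · rw [← root7_pow n]
    field_simp
    ring

end Main

end CurrentStatus

end

theorem corollary3p7 {Ω : Type*} [MeasurableSpace Ω] (μ : Measure Ω) [IsProbabilityMeasure μ]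
    (X T : ℕ → Ω → ℝ) (P Q : Measure ℝ) [IsProbabilityMeasure P] [IsProbabilityMeasure Q]
    (f₀ g k : ℝ → ℝ) (M₀ t : ℝ)
    (hmodel : CurrentStatus.IsModel μ X T P Q)
    (hF : CurrentStatus.CondF1 P f₀ M₀) (hG : CurrentStatus.CondG1 Q g M₀)
    (hk : CurrentStatus.CondK1 k)
    (ht : 0 < t) (hFt : cdf P t < 1)
    (hf₀t : CurrentStatus.ThirdDerivContinuousAt f₀ t)
    (hgt : CurrentStatus.ThirdDerivContinuousAt g t)
    (hr : CurrentStatus.rFun (cdf P) f₀ g t ≠ 0) :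
    (∀ c : ℝ, 0 < c →
      CurrentStatus.ConvergesInLaw μ
        (fun n ω => (n : ℝ) ^ (2 / 7 : ℝ) *
          (CurrentStatus.hazardMS k (c * (n : ℝ) ^ (-(1 / 7) : ℝ)) n
              (fun i => T i ω) (fun i => CurrentStatus.status (X i ω) (T i ω)) t
            - CurrentStatus.hazard (cdf P) f₀ t))
        (gaussianReal (CurrentStatus.hazardBias (cdf P) f₀ g k t c)
          (CurrentStatus.hazardVar (cdf P) g k t c).toNNReal) ∧
      CurrentStatus.ConvergesInLaw μ
        (fun n ω => (n : ℝ) ^ (2 / 7 : ℝ) *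
          (CurrentStatus.hazardNaive k (c * (n : ℝ) ^ (-(1 / 7) : ℝ)) n
              (fun i => T i ω) (fun i => CurrentStatus.status (X i ω) (T i ω)) t
            - CurrentStatus.hazard (cdf P) f₀ t))
        (gaussianReal (CurrentStatus.hazardBias (cdf P) f₀ g k t c)
          (CurrentStatus.hazardVar (cdf P) g k t c).toNNReal)) ∧
    (0 < CurrentStatus.cOpt (cdf P) f₀ g k t ∧
      ∀ c : ℝ, 0 < c → c ≠ CurrentStatus.cOpt (cdf P) f₀ g k t →
        CurrentStatus.aMSE (cdf P) f₀ g k t (CurrentStatus.cOpt (cdf P) f₀ g k t)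
          < CurrentStatus.aMSE (cdf P) f₀ g k t c) := by
  have htM := hF.lt_of_cdf_lt_one hFt
  have hFpos := hF.cdf_pos ht htM
  have hgpos := (hG.eventually_pos ht htM).self_of_nhds
  refine ⟨fun c hc => ?_, (CurrentStatus.cOpt_pow hk hFpos hFt hgpos hr).1, fun c hc hne =>
    CurrentStatus.aMSE_cOpt_lt hk hFpos hFt hgpos hr hc hne⟩
  have hlim := CurrentStatus.tendstoInDistribution_interiorHazard_hazard hmodel hF hG hk ht hFt
    hf₀t hgt hc
  have hmap := gaussianReal_map_add_const (μ := 0)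
    (v := (CurrentStatus.hazardVar (cdf P) g k t c).toNNReal)
    (CurrentStatus.hazardBias (cdf P) f₀ g k t c)
  rw [zero_add] at hmap
  simp only [CurrentStatus.rpow_two_sevenths, CurrentStatus.rpow_neg_seventh]
  constructor
  · refine CurrentStatus.convergesInLaw_of_tendstoInDistribution hlim hmap ?_
    refine tendsto_of_tendsto_of_tendsto_of_le_of_le tendsto_const_nhds
      (CurrentStatus.tendsto_measure_hazardMS_ne hmodel hF hG hk ht hFt hf₀t hgt hc)
      (fun _ => zero_le) fun n => measure_mono fun ω hω heq => hω ?_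
    simp only [heq]
  · refine CurrentStatus.convergesInLaw_of_tendstoInDistribution hlim hmap ?_
    refine tendsto_const_nhds.congr' ?_
    -- Once `h < t`, the naive estimator has the interior form for every outcome, so the exceptional
    -- set is empty.
    filter_upwards [(CurrentStatus.tendsto_bandwidth hc).eventually (Ioo_mem_nhdsGT ht)] with n hn
    simp [CurrentStatus.hazardNaive_eq_interiorHazard hk hn.2]
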